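/- Conventions. A family $(x_a)$ of reals indexed by (tuples of) natural numbers is computable if there is a computable map $(a,n)\mapsto q_{a,n}\in\mathbb Q$ with $|q_{a,n}-x_a|\le 2^{-n}$ for all $a,n$. An effective enumeration of a metric space $(X,d)$ is a sequence $\{r_i\}_{i\in\mathbb N}$ with dense range in $X$ such that $(i,j)\mapsto d(r_i,r_j)$ is computable; $X$ is effective if it has an effective enumeration, and an effective Banach space is a (real) Banach space that is effective as a metric space. The Urysohn space $U$ is the complete separable metric space, unique up to isometry, such that for all finite metric spaces $K\subseteq L$ every isometric map $K\to U$ extends to an isometric map $L\to U$. The types are the expressions built from the variables $V_1,\dots,V_k$ by $\sigma,\tau\mapsto(\sigma\to\tau)$. For complete separable metric spaces $X_1,\dots,X_k$, the space $\sigma(X_1,\dots,X_k)$ is defined by interpreting $V_i$ as $X_i$, and $\sigma\to\tau$ as the set of continuous maps from $X=\sigma(X_1,\dots,X_k)$ to $Y=\tau(X_1,\dots,X_k)$ with the finest topology in which $f_n\to f$ whenever $f_n(x_n)\to f(x)$ for all convergent sequences $x_n\to x$ in $X$. Fix effective enumerations $\{r^i_j\}_{j\in\mathbb N}$ of the $X_i$.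 A function $p:\mathbb N\to\mathbb N$ is a name of $x\in X_i$ if $d(r^i_{p(n)},x)\le 2^{-n}$ for all $n$. A function $\alpha:\mathbb N\to\mathbb N$ is a name of $f\in(\sigma\to\tau)(X_1,\dots,X_k)$ if it is an associate (in the sense of Kleene) that transforms every name $p$ of every $x\in\sigma(X_1,\dots,X_k)$ into a name $q$ of $f(x)$; that is, for every $n$ there is a $t$ with $\alpha(\langle n,(p(0),\dots,p(t-1))\rangle)=q(n)+1$ and $\alpha(\langle n,(p(0),\dots,p(s-1))\rangle)=0$ for all $s<t$, where $\langle\cdot\rangle$ is a standard coding. A sequence $\{f_n\}_{n\in\mathbb N}$ in $\sigma(X_1,\dots,X_k)$ is an effective enumeration of a dense subset if $\{f_n\mid n\in\mathbb N\}$ is dense in $\sigma(X_1,\dots,X_k)$ and there is a computable $a:\mathbb N\times\mathbb N\to\mathbb N$ such that $a(n,\cdot)$ is a name of $f_n$ for each $n$. Theorem. Let each of $X_1,\dots,X_k$ be either an effective Banach space or the Urysohn space $U$, and let $\sigma$ be a type in the variables $V_1,\dots,V_k$. Then each $X_i$ is effective, and for every choice of effective enumerations of $X_1,\dots,X_k$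 the space $\sigma(X_1,\dots,X_k)$ has an effective enumeration of a dense subset. -/

import Mathlib

open Filter Topology

universe u

/-! ## Types and their interpretation in sequential spaces -/

/-- Formal types in the variables `V_0, …, V_{k-1}`. -/
inductive FType (k : ℕ) : Type
  | var : Fin k → FType k
  | arr : FType k → FType k → FType k

/-- Convergence of `F n` to `f` in the function space:
`x n → a` always implies `F n (x n) → f a`. -/
def ContConv {X Y : Type u} [TopologicalSpace X] [TopologicalSpace Y]
    (F : ℕ → C(X, Y)) (f : C(X, Y)) : Prop :=
  ∀ (x : ℕ → X) (a : X), Tendsto x atTop (𝓝 a) →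
    Tendsto (fun n => F n (x n)) atTop (𝓝 (f a))

/-- The finest topology on the set of continuous maps `X → Y` for which every sequence that
converges in the sense of `ContConv` does converge. (Mathlib's default topology on `C(X, Y)` is the
compact-open topology, which is not used here.) -/
@[reducible] def seqTopology (X Y : Type u) [TopologicalSpace X] [TopologicalSpace Y] :
    TopologicalSpace C(X, Y) where
  IsOpen W := ∀ (F : ℕ → C(X, Y)) (f : C(X, Y)), ContConv F f → f ∈ W → ∀ᶠ n in atTop, F n ∈ W
  isOpen_univ := fun _ _ _ _ => Eventually.of_forall fun _ => Set.mem_univ _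
  isOpen_inter := fun _ _ hS hT F f hF hf => (hS F f hF hf.1).and (hT F f hF hf.2)
  isOpen_sUnion := fun _ hS F f hF ⟨W, hW, hf⟩ =>
    (hS W hW F f hF hf).mono fun _ hn => ⟨W, hW, hn⟩

/-- The interpretation `σ(X_0, …, X_{k-1})`: variables are interpreted by the given metric spaces
and `σ → τ` by the space of continuous maps with the topology `seqTopology`. -/
def FType.interp {k : ℕ} (X : Fin k → Type u) [∀ i, MetricSpace (X i)] : FType k → TopCat.{u}
  | .var i => TopCat.of (X i)
  | .arr σ τ => @TopCat.of C(σ.interp X, τ.interp X) (seqTopology (σ.interp X) (τ.interp X))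

/-! ## Banach spaces and the Urysohn space as metric spaces -/

/-- The metric space `X` is (the underlying metric space of) a real Banach space. -/
def IsBanachSpace (X : Type u) [m : MetricSpace X] : Prop :=
  CompleteSpace X ∧
    ∃ (N : NormedAddCommGroup X) (_ : NormedSpace ℝ X), N.toMetricSpace = m

/-- Every isometric map of a subspace `K` of a finite metric space `L` into `X` extends to an
isometric map of `L` into `X`. -/
def FinitelySaturated (X : Type u) [MetricSpace X] : Prop :=
  ∀ (L : Type) [MetricSpace L] [Finite L] (K : Set L) (φ : K → X), Isometry φ →
    ∃ ψ : L → X, Isometry ψ ∧ ∀ x : K, ψ x = φ x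

/-- `X` is the Urysohn space (which is unique up to isometry). -/
def IsUrysohnSpace (X : Type u) [MetricSpace X] : Prop :=
  CompleteSpace X ∧ TopologicalSpace.SeparableSpace X ∧ FinitelySaturated X

/-! ## Effective metric spaces -/

/-- The rational number coded by a triple of natural numbers, as a real number. -/
noncomputable def ratVal (q : ℕ × ℕ × ℕ) : ℝ :=
  ((q.1 : ℝ) - (q.2.1 : ℝ)) / ((q.2.2 : ℝ) + 1)

/-- A family of real numbers is computable if some computable map assigns to every index a sequence
of rationals that converges fast (with error at most `2⁻ⁿ` at stage `n`) to the number. -/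
def IsComputableReals {α : Type} [Primcodable α] (x : α → ℝ) : Prop :=
  ∃ g : α → ℕ → ℕ × ℕ × ℕ, Computable₂ g ∧ ∀ a n, |ratVal (g a n) - x a| ≤ (1 / 2 : ℝ) ^ n

/-- `r` enumerates a dense subset of `X`, and the distances `d(r_i, r_j)` are computable. -/
def IsEffectiveEnum {X : Type u} [MetricSpace X] (r : ℕ → X) : Prop :=
  DenseRange r ∧ IsComputableReals fun ij : ℕ × ℕ => dist (r ij.1) (r ij.2)

/-- `X` is an effective metric space. -/
def IsEffectiveMetricSpace (X : Type u) [MetricSpace X] : Prop :=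
  ∃ r : ℕ → X, IsEffectiveEnum r

/-! ## Computable sequences of functionals -/

/-- `q` is the result of applying the associate `α` to `p`: the value `q n` is found
by feeding to `α` longer and longer initial segments of `p`, until `α` gives an answer other than
`0` (which means "more input is needed"); the answer `v + 1` means `q n = v`. -/
def AssocApp (α p q : ℕ → ℕ) : Prop :=
  ∀ n, ∃ t, α (Encodable.encode (n, (List.range t).map p)) = q n + 1 ∧
    ∀ s < t, α (Encodable.encode (n, (List.range s).map p)) = 0

/-- `FType.Names r σ p x` says that `p : ℕ → ℕ` is a name of `x ∈ σ(X_0, …, X_{k-1})`, relative to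
the dense sequences `r i` in the base spaces. A name of a point of a base space lists the indices of
a fast converging sequence; a name of a functional `f` is an associate that transforms
every name of every argument `x` into a name of `f x`. -/
def FType.Names {k : ℕ} {X : Fin k → Type u} [∀ i, MetricSpace (X i)] (r : ∀ i, ℕ → X i) :
    (σ : FType k) → (ℕ → ℕ) → σ.interp X → Prop
  | .var i, p, (x : X i) => ∀ n, dist (r i (p n)) x ≤ (1 / 2 : ℝ) ^ n
  | .arr σ τ, α, (f : C(σ.interp X, τ.interp X)) =>
      ∀ (p : ℕ → ℕ) (x : σ.interp X), FType.Names r σ p x →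
        ∃ q : ℕ → ℕ, AssocApp α p q ∧ FType.Names r τ q (f x)

/-- The sequence `f` in `σ(X_0, …, X_{k-1})` is computable: names of its members can be computed
uniformly. -/
def FType.IsComputableSeq {k : ℕ} {X : Fin k → Type u} [∀ i, MetricSpace (X i)]
    (r : ∀ i, ℕ → X i) (σ : FType k) (f : ℕ → σ.interp X) : Prop :=
  ∃ a : ℕ → ℕ → ℕ, Computable₂ a ∧ ∀ n, FType.Names r σ (a n) (f n)

/-!
The points of a space `σ(X_0, …, X_{k-1})` are approximated by finitely many coded functionals, and
the approximation is uniform enough to be passed on from `σ` and `τ` to `σ → τ`.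

A stage `n` approximation of a space `S` is a `FuzzyProj`: finitely many codes, continuous weights
`S → [0, 1]` that say how well a code fits a point, and a continuous map `comb` that combines the
coded points with given weights to a point of `S`. A code of a functional is a table that assigns a
code of a value to every code of an argument. Its weight at `f` is the least weight of a value in
the table at the value of `f` at the coded argument; the combination of functionals with weights
`μ` sends `x` to the combination with the weights obtained from `μ` and the weights at `x` by
application in the sense of fuzzy sets (`applyWeights`). The weights need no division, so they are
computable, and for each point some code has weight `1` (`FType.exists_weight_eq_one`). If codes
of positive weight are chosen at points that converge to `x`, then the codes converge to `x` in the
sense of `FType.CodeConv` (`FType.codeConv_of_weight_pos`), and combinations of codes that converge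
to `x` do converge to `x` (`FType.tendsto_comb`). Both facts are proved by induction on the type,
and they use that the convergent sequences of `seqTopology` are exactly those in the sense of
`ContConv` (`contConv_of_tendsto`). Hence the coded functionals are dense
(`FType.denseRange_comb_dirac`). Their names can be computed because weights can be computed from
names and combinations can be computed from weights, again by induction on the type
(`FType.weightComputable_and_combComputable`).

For the base spaces one needs computable combinations of finitely many points
(`exists_combination`). A continuous map from a cube to `X` with prescribed behaviour at its
vertices is the limit of maps on finer and finer grids; the value at a new grid point is close to
the midpoint of the values at two old grid points. What is used is that finite families of points
have midpoints that depend on the family in a non-expanding way (`HasMidpoints`). Banach spaces have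
such midpoints for obvious reasons, and in the Urysohn space they are found by extending the
isometry that is given on the family (`FinitelySaturated.hasMidpoints`). The tables of values on the
grids are found by unbounded search: their properties are strict inequalities between computable
real numbers, hence semidecidable, and computable dependent choice applies (`Semi.exists_chain`).

The Urysohn space is effective because a computable countable pseudometric space with enough
one-point extensions (`exists_computable_urysohn_pseudometric`) can be realized by a dense sequence
in it (`exists_dense_realization`).
-/

/-! ### Computable functions and their closure properties -/

attribute [fun_prop] Computable
attribute [fun_prop] Computable.id Computable.const Computable.comp

section Computable

variable {α β γ : Type*} [Primcodable α] [Primcodable β] [Primcodable γ]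

@[fun_prop] theorem Computable.fst_comp {f : α → β × γ} (hf : Computable f) :
    Computable fun x => (f x).1 := Computable.fst.comp hf

@[fun_prop] theorem Computable.snd_comp {f : α → β × γ} (hf : Computable f) :
    Computable fun x => (f x).2 := Computable.snd.comp hf

@[fun_prop] theorem Computable.prodMk {f : α → β} {g : α → γ} (hf : Computable f)
    (hg : Computable g) : Computable fun x => (f x, g x) := Computable.pair hf hg

@[fun_prop] theorem Computable.add {f g : α → ℕ} (hf : Computable f) (hg : Computable g) :
    Computable fun x => f x + g x := Primrec.nat_add.to_comp.comp hf hg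

@[fun_prop] theorem Computable.sub {f g : α → ℕ} (hf : Computable f) (hg : Computable g) :
    Computable fun x => f x - g x := Primrec.nat_sub.to_comp.comp hf hg

@[fun_prop] theorem Computable.mul {f g : α → ℕ} (hf : Computable f) (hg : Computable g) :
    Computable fun x => f x * g x := Primrec.nat_mul.to_comp.comp hf hg

@[fun_prop] theorem Computable.div {f g : α → ℕ} (hf : Computable f) (hg : Computable g) :
    Computable fun x => f x / g x := Primrec.nat_div.to_comp.comp hf hg

@[fun_prop] theorem Computable.mod {f g : α → ℕ} (hf : Computable f) (hg : Computable g) :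
    Computable fun x => f x % g x := Primrec.nat_mod.to_comp.comp hf hg

@[fun_prop] theorem Computable.pow {f g : α → ℕ} (hf : Computable f) (hg : Computable g) :
    Computable fun x => f x ^ g x := by
  have h : Computable fun x => Nat.rec (motive := fun _ => ℕ) 1 (fun _ y => y * f x) (g x) := by
    refine Computable.nat_rec (h := fun x (y : ℕ × ℕ) => y.2 * f x) hg (Computable.const 1) ?_
    exact (by fun_prop : Computable fun x : α × ℕ × ℕ => x.2.2 * f x.1)
  refine h.of_eq fun x => ?_
  induction g x with
  | zero => rfl
  | succ n ih => rw [pow_succ, ← ih]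

@[fun_prop] theorem Computable.unpair_comp {f : α → ℕ} (hf : Computable f) :
    Computable fun x => (f x).unpair := Computable.unpair.comp hf

@[fun_prop] theorem Computable.natPair {f g : α → ℕ} (hf : Computable f) (hg : Computable g) :
    Computable fun x => Nat.pair (f x) (g x) := Primrec₂.natPair.to_comp.comp hf hg

@[fun_prop] theorem Computable.encode_comp {f : α → β} (hf : Computable f) :
    Computable fun x => Encodable.encode (f x) := Computable.encode.comp hf

@[fun_prop] theorem Computable.ofNat_comp {δ : Type*} [Denumerable δ] {f : α → ℕ}
    (hf : Computable f) : Computable fun x => Denumerable.ofNat δ (f x) :=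
  (Computable.ofNat δ).comp hf

@[fun_prop] theorem Computable.length_comp {f : α → List β} (hf : Computable f) :
    Computable fun x => (f x).length := Computable.list_length.comp hf

@[fun_prop] theorem Computable.append {f g : α → List β} (hf : Computable f)
    (hg : Computable g) : Computable fun x => f x ++ g x := Computable.list_append.comp hf hg

@[fun_prop] theorem Computable.cons {f : α → β} {g : α → List β} (hf : Computable f)
    (hg : Computable g) : Computable fun x => f x :: g x := Computable.list_cons.comp hf hg

@[fun_prop] theorem Computable.getD {f : α → List β} {g : α → ℕ} {b : β} (hf : Computable f)
    (hg : Computable g) : Computable fun x => (f x).getD (g x) b :=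
  (Primrec.list_getD b).to_comp.comp hf hg

/-- The initial segment of length `t` of the sequence `p`. -/
def pre (p : ℕ → ℕ) (t : ℕ) : List ℕ := (List.range t).map p

@[simp] theorem length_pre (p : ℕ → ℕ) (t : ℕ) : (pre p t).length = t := by simp [pre]

theorem pre_succ (p : ℕ → ℕ) (t : ℕ) : pre p (t + 1) = pre p t ++ [p t] := by
  simp [pre, List.range_succ]

theorem pre_prefix (p : ℕ → ℕ) {s t : ℕ} (h : s ≤ t) : pre p s <+: pre p t := by
  induction h with
  | refl => exact List.prefix_rfl
  | step _ ih => rw [pre_succ]; exact ih.trans (List.prefix_append _ _)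

theorem getElem?_pre (p : ℕ → ℕ) (t k : ℕ) :
    (pre p t)[k]? = if k < t then some (p k) else none := by
  split_ifs with h
  · simp [pre, h]
  · simp [pre]; omega

theorem map_pre (ρ : ℕ → ℕ) (p : ℕ → ℕ) (t : ℕ) :
    (pre p t).map ρ = pre (fun n => ρ (p n)) t := by simp [pre]

@[fun_prop] theorem Computable.pre {p : α → ℕ → ℕ} {t : α → ℕ}
    (hp : Computable fun x : α × ℕ => p x.1 x.2) (ht : Computable t) :
    Computable fun x => pre (p x) (t x) := by
  have h : Computable fun x =>
      Nat.rec (motive := fun _ => List ℕ) [] (fun y l => l ++ [p x y]) (t x) := by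
    refine Computable.nat_rec (h := fun x (y : ℕ × List ℕ) => y.2 ++ [p x y.1]) ht
      (Computable.const []) ?_
    exact (by fun_prop : Computable fun x : α × ℕ × List ℕ => x.2.2 ++ [p x.1 x.2.1])
  refine h.of_eq fun x => ?_
  induction t x with
  | zero => rfl
  | succ n ih => rw [pre_succ, ← ih]

end Computable

/-! ### Semidecidable relations with a name as an oracle -/

section Semi

variable {ι κ : Type} [Primcodable ι] [Primcodable κ]
variable {D : Type*} {nm : D → ℕ → ℕ}

/-- `P i d` is semidecidable, uniformly in the index `i`, from the sequence `nm d` that names `d`: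
it is confirmed as soon as a sufficiently long initial segment of the name passes a primitive
recursive test. -/
def Semi (nm : D → ℕ → ℕ) (P : ι → D → Prop) : Prop :=
  ∃ F : ι × List ℕ → Prop, PrimrecPred F ∧ (∀ i l l', l <+: l' → F (i, l) → F (i, l')) ∧
    ∀ i d, P i d ↔ ∃ t, F (i, pre (nm d) t)

theorem Semi.of_iff {P Q : ι → D → Prop} (hP : Semi nm P) (h : ∀ i d, Q i d ↔ P i d) :
    Semi nm Q := by
  obtain ⟨F, hF, hm, hP⟩ := hP
  exact ⟨F, hF, hm, fun i d => (h i d).trans (hP i d)⟩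

theorem Semi.of_primrecPred {p : ι → Prop} (hp : PrimrecPred p) :
    Semi nm (fun i _ => p i) :=
  ⟨fun x => p x.1, hp.comp Primrec.fst, fun _ _ _ _ h => h, fun _ _ => ⟨fun h => ⟨0, h⟩,
    fun ⟨_, h⟩ => h⟩⟩

theorem Semi.and {P Q : ι → D → Prop} (hP : Semi nm P) (hQ : Semi nm Q) :
    Semi nm (fun i d => P i d ∧ Q i d) := by
  obtain ⟨F, hF, hFm, hP⟩ := hP
  obtain ⟨G, hG, hGm, hQ⟩ := hQ
  refine ⟨fun x => F x ∧ G x, hF.and hG, fun i l l' h hx => ⟨hFm i l l' h hx.1, hGm i l l' h hx.2⟩,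
    fun i d => ?_⟩
  beta_reduce
  rw [hP, hQ]
  constructor
  · rintro ⟨⟨s, hs⟩, ⟨t, ht⟩⟩
    exact ⟨max s t, hFm _ _ _ (pre_prefix _ (le_max_left _ _)) hs,
      hGm _ _ _ (pre_prefix _ (le_max_right _ _)) ht⟩
  · rintro ⟨t, h1, h2⟩
    exact ⟨⟨t, h1⟩, ⟨t, h2⟩⟩

theorem Semi.or {P Q : ι → D → Prop} (hP : Semi nm P) (hQ : Semi nm Q) :
    Semi nm (fun i d => P i d ∨ Q i d) := by
  obtain ⟨F, hF, hFm, hP⟩ := hP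
  obtain ⟨G, hG, hGm, hQ⟩ := hQ
  refine ⟨fun x => F x ∨ G x, hF.or hG,
    fun i l l' h hx => hx.imp (hFm i l l' h) (hGm i l l' h), fun i d => ?_⟩
  beta_reduce
  rw [hP, hQ, exists_or]

/-- Substitution of a computable function for the index. -/
theorem Semi.comp {P : κ → D → Prop} (hP : Semi nm P) {g : ι → κ} (hg : Computable g) :
    Semi nm (fun i d => P (g i) d) := by
  classical
  obtain ⟨F, hF, hFm, hP⟩ := hP
  obtain ⟨c, hc⟩ := Nat.Partrec.Code.exists_code.1 hg
  have hev : ∀ i, Nat.Partrec.Code.eval c (Encodable.encode i)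
      = Part.some (Encodable.encode (g i)) := by
    intro i; rw [hc]; simp
  -- A code of `g` is run for as many steps as the initial segment of the name is long.
  refine ⟨fun x => (Option.casesOn (motive := fun _ => Bool)
    (((Nat.Partrec.Code.evaln x.2.length c (Encodable.encode x.1)).bind
      (fun y => Encodable.decode (α := κ) y))) false
      (fun k => decide (F (k, x.2))) : Bool) = true, ?_, ?_, ?_⟩
  · refine PrimrecRel.comp (R := fun a b : Bool => a = b) Primrec.eq ?_ (Primrec.const true)
    refine Primrec.option_casesOn ?_ (Primrec.const false) ?_
    · refine Primrec.option_bind ?_ (Primrec.decode.comp Primrec.snd)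
      exact Nat.Partrec.Code.primrec_evaln.comp (Primrec.pair (Primrec.pair
        (Primrec.list_length.comp Primrec.snd) (Primrec.const c))
        (Primrec.encode.comp Primrec.fst))
    · exact hF.decide.comp (Primrec.pair Primrec.snd (Primrec.snd.comp Primrec.fst))
  · intro i l l' hl h
    rcases he : Nat.Partrec.Code.evaln l.length c (Encodable.encode i) with _ | y
    · simp [he] at h
    · have := Nat.Partrec.Code.evaln_mono hl.length_le (Option.mem_def.2 he)
      rw [Option.mem_def] at this
      simp only [he, this, Option.bind_some] at h ⊢
      rcases hd : Encodable.decode (α := κ) y with _ | k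
      · simp [hd] at h
      · simp only [hd, decide_eq_true_eq] at h ⊢
        exact hFm _ _ _ hl h
  · intro i d
    beta_reduce
    rw [hP]
    constructor
    · rintro ⟨t, ht⟩
      obtain ⟨k, hk⟩ := Nat.Partrec.Code.evaln_complete.1
        (show Encodable.encode (g i) ∈ Nat.Partrec.Code.eval c (Encodable.encode i) by
          rw [hev]; simp)
      have hk' := Nat.Partrec.Code.evaln_mono (le_max_left k t) hk
      rw [Option.mem_def] at hk'
      refine ⟨max k t, ?_⟩
      simp only [length_pre, hk', Option.bind_some, Encodable.encodek, decide_eq_true_eq]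
      exact hFm _ _ _ (pre_prefix _ (le_max_right _ _)) ht
    · rintro ⟨t, ht⟩
      refine ⟨t, ?_⟩
      rw [length_pre] at ht
      rcases he : Nat.Partrec.Code.evaln t c (Encodable.encode i) with _ | y
      · simp [he] at ht
      · have := Nat.Partrec.Code.evaln_sound (Option.mem_def.2 he)
        rw [hev, Part.mem_some_iff] at this
        subst this
        simpa [he] using ht

theorem Semi.ex {P : ι → κ → D → Prop} (hP : Semi nm fun (x : ι × κ) d => P x.1 x.2 d) :
    Semi nm (fun i d => ∃ k, P i k d) := by
  classical
  obtain ⟨F, hF, hFm, hP⟩ := hP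
  -- Witnesses are sought among the codes below the length of the initial segment of the name.
  refine ⟨fun x => ∃ n ∈ List.range x.2.length, (Option.casesOn (motive := fun _ => Bool)
      (Encodable.decode (α := κ) n) false (fun k => decide (F ((x.1, k), x.2))) : Bool) = true,
    ?_, ?_, ?_⟩
  · refine PrimrecRel.comp (PrimrecRel.exists_mem_list
      (R := fun (n : ℕ) (x : ι × List ℕ) => (Option.casesOn (motive := fun _ => Bool)
      (Encodable.decode (α := κ) n) false (fun k => decide (F ((x.1, k), x.2))) : Bool) = true) ?_)
      (Primrec.list_range.comp (Primrec.list_length.comp Primrec.snd)) Primrec.id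
    refine PrimrecRel.comp (R := fun a b : Bool => a = b) Primrec.eq ?_ (Primrec.const true)
    refine Primrec.option_casesOn (Primrec.decode.comp Primrec.fst) (Primrec.const false) ?_
    exact hF.decide.comp (Primrec.pair (Primrec.pair
      (Primrec.fst.comp (Primrec.snd.comp Primrec.fst)) Primrec.snd)
      (Primrec.snd.comp (Primrec.snd.comp Primrec.fst)))
  · rintro i l l' hl ⟨n, hn, h⟩
    refine ⟨n, List.mem_range.2 ((List.mem_range.1 hn).trans_le hl.length_le), ?_⟩
    rcases hd : Encodable.decode (α := κ) n with _ | k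
    · simp [hd] at h
    · simp only [hd, decide_eq_true_eq] at h ⊢
      exact hFm _ _ _ hl h
  · intro i d
    constructor
    · rintro ⟨k, hk⟩
      obtain ⟨t, ht⟩ := (hP (i, k) d).1 hk
      refine ⟨max t (Encodable.encode k + 1), Encodable.encode k, by simp, ?_⟩
      simp only [Encodable.encodek, decide_eq_true_eq]
      exact hFm _ _ _ (pre_prefix _ (le_max_left _ _)) ht
    · rintro ⟨t, n, _, h⟩
      rcases hd : Encodable.decode (α := κ) n with _ | k
      · simp [hd] at h
      · simp only [hd, decide_eq_true_eq] at h
        exact ⟨k, (hP (i, k) d).2 ⟨t, h⟩⟩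

theorem Semi.all_lt {P : ι → ℕ → D → Prop} {N : ι → ℕ}
    (hP : Semi nm fun (x : ι × ℕ) d => P x.1 x.2 d) (hN : Computable N) :
    Semi nm (fun i d => ∀ j < N i, P i j d) := by
  suffices h : Semi nm (fun (x : ι × ℕ) d => ∀ j < x.2, P x.1 j d) from
    h.comp (g := fun i => (i, N i)) (by fun_prop)
  obtain ⟨F, hF, hFm, hP⟩ := hP
  refine ⟨fun x => ∀ j ∈ List.range x.1.2, F ((x.1.1, j), x.2), ?_, ?_, ?_⟩
  · refine PrimrecRel.comp (PrimrecRel.forall_mem_list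
      (R := fun (j : ℕ) (x : (ι × ℕ) × List ℕ) => F ((x.1.1, j), x.2)) ?_)
      (Primrec.list_range.comp (Primrec.snd.comp Primrec.fst)) Primrec.id
    exact hF.comp (Primrec.pair (Primrec.pair (Primrec.fst.comp (Primrec.fst.comp Primrec.snd))
      Primrec.fst) (Primrec.snd.comp Primrec.snd))
  · exact fun i l l' hl h j hj => hFm _ _ _ hl (h j hj)
  · rintro ⟨i, N⟩ d
    simp only [List.mem_range]
    constructor
    · intro h
      have h' : ∀ j, ∃ t, j < N → F ((i, j), pre (nm d) t) := fun j => by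
        by_cases hj : j < N
        · obtain ⟨t, ht⟩ := (hP (i, j) d).1 (h j hj)
          exact ⟨t, fun _ => ht⟩
        · exact ⟨0, fun h => absurd h hj⟩
      choose t ht using h'
      refine ⟨(Finset.range N).sup t, fun j hj => hFm _ _ _ (pre_prefix _ ?_) (ht j hj)⟩
      exact Finset.le_sup (Finset.mem_range.2 hj)
    · rintro ⟨t, ht⟩ j hj
      exact (hP (i, j) d).2 ⟨t, ht j hj⟩

theorem Semi.eq {f g : ι → κ} (hf : Computable f) (hg : Computable g) :
    Semi nm (fun i _ => f i = g i) := by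
  classical
  exact (Semi.of_primrecPred (nm := nm) (p := fun x : κ × κ => x.1 = x.2)
    (Primrec.eq (α := κ))).comp (g := fun i => (f i, g i)) (by fun_prop)

theorem Semi.natLt {f g : ι → ℕ} (hf : Computable f) (hg : Computable g) :
    Semi nm (fun i _ => f i < g i) :=
  (Semi.of_primrecPred (nm := nm) (p := fun x : ℕ × ℕ => x.1 < x.2)
    Primrec.nat_lt).comp (g := fun i => (f i, g i)) (by fun_prop)

theorem Semi.natLe {f g : ι → ℕ} (hf : Computable f) (hg : Computable g) :
    Semi nm (fun i _ => f i ≤ g i) :=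
  (Semi.of_primrecPred (nm := nm) (p := fun x : ℕ × ℕ => x.1 ≤ x.2)
    Primrec.nat_le).comp (g := fun i => (f i, g i)) (by fun_prop)

theorem Semi.ne {f g : ι → ℕ} (hf : Computable f) (hg : Computable g) :
    Semi nm (fun i _ => f i ≠ g i) :=
  ((Semi.natLt (nm := nm) hf hg).or (Semi.natLt hg hf)).of_iff fun _ _ => Nat.ne_iff_lt_or_gt

theorem Semi.ex_lt {P : ι → ℕ → D → Prop} {N : ι → ℕ}
    (hP : Semi nm fun (x : ι × ℕ) d => P x.1 x.2 d) (hN : Computable N) :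
    Semi nm (fun i d => ∃ j < N i, P i j d) :=
  ((Semi.natLt (f := fun x : ι × ℕ => x.2) (g := fun x => N x.1)
    (by fun_prop) (by fun_prop)).and hP).ex

/-- Reading an entry of the name. -/
theorem Semi.read {f g : ι → ℕ} (hf : Computable f) (hg : Computable g) :
    Semi nm (fun i d => nm d (f i) = g i) := by
  refine Semi.comp (P := fun (x : ℕ × ℕ) d => nm d x.1 = x.2) ?_
    (g := fun i => (f i, g i)) (by fun_prop)
  refine ⟨fun x => x.2[x.1.1]? = some x.1.2, ?_, ?_, ?_⟩
  · exact PrimrecRel.comp Primrec.eq (Primrec.list_getElem?.comp Primrec.snd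
      (Primrec.fst.comp Primrec.fst)) (Primrec.option_some.comp (Primrec.snd.comp Primrec.fst))
  · rintro i l _ ⟨l', rfl⟩ h
    simp only at h ⊢
    rw [List.getElem?_append_left, h]
    exact (List.getElem?_eq_some_iff.1 h).1
  · rintro ⟨k, v⟩ d
    simp only [getElem?_pre]
    constructor
    · rintro rfl; exact ⟨k + 1, by simp⟩
    · rintro ⟨t, ht⟩; split_ifs at ht; simpa using ht

/-- Change of context along a map whose effect on names is to apply `ρ` entrywise. -/
theorem Semi.pullback {D' : Type*} {nm' : D' → ℕ → ℕ} {P : ι → D → Prop} (hP : Semi nm P)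
    {π : D' → D} {ρ : ℕ → ℕ} (hρ : Primrec ρ) (h : ∀ d n, nm (π d) n = ρ (nm' d n)) :
    Semi nm' (fun i d => P i (π d)) := by
  obtain ⟨F, hF, hFm, hP⟩ := hP
  refine ⟨fun x => F (x.1, x.2.map ρ), ?_, ?_, ?_⟩
  · exact hF.comp (Primrec.pair Primrec.fst
      (Primrec.list_map Primrec.snd (hρ.comp Primrec.snd).to₂))
  · intro i l l' hl; exact hFm i _ _ (hl.map ρ)
  · intro i d
    beta_reduce
    rw [hP]
    simp only [map_pre, ← h]

/-- The context without information: a single object, named by the zero sequence. -/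
def trivName : PUnit.{u + 1} → ℕ → ℕ := fun _ _ => 0

/-- An associate can search for a value that satisfies a semidecidable relation. -/
theorem Semi.exists_assoc {R : ι → ℕ → ℕ → D → Prop}
    (hR : Semi nm fun (x : ι × ℕ × ℕ) d => R x.1 x.2.1 x.2.2 d)
    (tot : ∀ i n d, ∃ v, R i n v d) :
    ∃ α : ι → ℕ → ℕ, Computable (fun x : ι × ℕ => α x.1 x.2) ∧
      ∀ i d, ∃ q, AssocApp (α i) (nm d) q ∧ ∀ n, R i n (q n) d := by
  classical
  obtain ⟨F, hF, hFm, hR⟩ := hR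
  -- The least value that is confirmed by the initial segment `l` and smaller than its length; if
  -- there is none, more input is asked for.
  let k : ι → ℕ → List ℕ → ℕ := fun i n l =>
    (List.range l.length).findIdx fun v => decide (F ((i, n, v), l))
  let β : ι → ℕ → List ℕ → ℕ := fun i n l => if k i n l < l.length then k i n l + 1 else 0
  let dec : ℕ → ℕ × List ℕ := fun m => Denumerable.ofNat (ℕ × List ℕ) m
  have hdec : Primrec dec := Primrec.ofNat _
  have hk : Primrec fun x : ι × ℕ × List ℕ => k x.1 x.2.1 x.2.2 := by
    refine Primrec.list_findIdx
      (Primrec.list_range.comp (Primrec.list_length.comp (Primrec.snd.comp Primrec.snd))) ?_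
    refine hF.decide.comp (Primrec.pair (Primrec.pair (Primrec.fst.comp Primrec.fst)
      (Primrec.pair (Primrec.fst.comp (Primrec.snd.comp Primrec.fst)) Primrec.snd))
      (Primrec.snd.comp (Primrec.snd.comp Primrec.fst)))
  have hβ : Primrec fun x : ι × ℕ × List ℕ => β x.1 x.2.1 x.2.2 :=
    Primrec.ite (PrimrecRel.comp Primrec.nat_lt hk
      (Primrec.list_length.comp (Primrec.snd.comp Primrec.snd))) (Primrec.succ.comp hk)
      (Primrec.const 0)
  refine ⟨fun i m => β i (dec m).1 (dec m).2, ?_, ?_⟩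
  · exact (hβ.comp (Primrec.pair Primrec.fst (hdec.comp Primrec.snd))).to_comp
  intro i d
  have hβ_pos : ∀ n t v, β i n (pre (nm d) t) = v + 1 → R i n v d := by
    intro n t v h
    simp only [β] at h
    split_ifs at h with hlt
    have hv : k i n (pre (nm d) t) = v := by omega
    have hlt' : k i n (pre (nm d) t) < (List.range (pre (nm d) t).length).length := by
      simpa using hlt
    have := List.findIdx_getElem (w := hlt')
    simp only [decide_eq_true_eq, List.getElem_range] at this
    exact (hR (i, n, v) d).2 ⟨t, by rw [← hv]; exact this⟩
  have hex : ∀ n, ∃ t, β i n (pre (nm d) t) ≠ 0 := by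
    intro n
    obtain ⟨v, hv⟩ := tot i n d
    obtain ⟨t, ht⟩ := (hR (i, n, v) d).1 hv
    refine ⟨max t (v + 1), ?_⟩
    have : k i n (pre (nm d) (max t (v + 1))) < (pre (nm d) (max t (v + 1))).length := by
      have h2 : (List.range (pre (nm d) (max t (v + 1))).length).findIdx
        (fun w => decide (F ((i, n, w), pre (nm d) (max t (v + 1))))) <
          (List.range (pre (nm d) (max t (v + 1))).length).length := by
        apply List.findIdx_lt_length_of_exists
        refine ⟨v, by simp, ?_⟩
        simpa using hFm _ _ _ (pre_prefix _ (le_max_left _ _)) ht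
      simpa [k] using h2
    simp only [β, if_pos this]
    omega
  refine ⟨fun n => β i n (pre (nm d) (Nat.find (hex n))) - 1, fun n => ?_, fun n => ?_⟩
  · refine ⟨Nat.find (hex n), ?_, fun s hs => ?_⟩
    · have h0 := Nat.find_spec (hex n)
      change β i (dec _).1 (dec _).2 = _
      simp only [dec, Denumerable.ofNat_encode]
      change β i n (pre (nm d) _) = _
      omega
    · have := Nat.find_min (hex n) hs
      change β i (dec _).1 (dec _).2 = _
      simp only [dec, Denumerable.ofNat_encode]
      exact not_not.1 this
  · refine hβ_pos n (Nat.find (hex n)) _ ?_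
    exact (Nat.succ_pred_eq_of_ne_zero (Nat.find_spec (hex n))).symm

/-- Semidecidability is preserved by applying a named functional to a computable argument. -/
theorem Semi.assocApp {D' : Type*} {nm' : D' → ℕ → ℕ} {P : ι → D' → Prop} (hP : Semi nm' P)
    {p : ι → ℕ → ℕ} (hp : Computable fun x : ι × ℕ => p x.1 x.2) {π : ι → D → D'}
    (h : ∀ i d, AssocApp (nm d) (p i) (nm' (π i d))) :
    Semi nm (fun i d => P i (π i d)) := by
  obtain ⟨F, hF, hFm, hP⟩ := hP
  -- An initial segment of the name of `π i d` is guessed and then verified.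
  have key : Semi nm (fun i d => ∃ l : List ℕ, F (i, l) ∧ ∀ m < l.length, ∃ t,
      nm d (Encodable.encode (m, pre (p i) t)) = l.getD m 0 + 1 ∧
        ∀ s < t, nm d (Encodable.encode (m, pre (p i) s)) = 0) := by
    refine Semi.ex (Semi.and (Semi.of_primrecPred hF) (Semi.all_lt (Semi.ex (Semi.and
      (Semi.read (ι := ((ι × List ℕ) × ℕ) × ℕ) ?_ ?_) (Semi.all_lt (Semi.read ?_ ?_) ?_))) ?_))
      <;> fun_prop
  refine key.of_iff fun i d => ?_
  rw [hP]
  constructor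
  · rintro ⟨t, ht⟩
    refine ⟨_, ht, fun m hm => ?_⟩
    obtain ⟨s, hs, hs'⟩ := h i d m
    refine ⟨s, ?_, hs'⟩
    have hm' : m < t := by simpa using hm
    rw [List.getD_eq_getElem?_getD, getElem?_pre, if_pos hm']
    exact hs
  · rintro ⟨l, hl, hq⟩
    refine ⟨l.length, ?_⟩
    have : pre (nm' (π i d)) l.length = l := by
      apply List.ext_getElem?
      intro m
      rw [getElem?_pre]
      split_ifs with hm
      · obtain ⟨t, ht, ht'⟩ := hq m hm
        obtain ⟨s, hs, hs'⟩ := h i d m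
        have hst : s = t := by
          rcases lt_trichotomy s t with hlt | rfl | hlt
          · exact absurd (hs.symm.trans (ht' s hlt)) (by omega)
          · rfl
          · exact absurd (ht.symm.trans (hs' t hlt)) (by omega)
        subst hst
        have hs2 : nm d (Encodable.encode (m, pre (p i) s)) = nm' (π i d) m + 1 := hs
        have h1 : nm' (π i d) m = l.getD m 0 := by omega
        rw [h1, List.getD_eq_getElem?_getD, List.getElem?_eq_getElem hm]
        rfl
      · simp [List.getElem?_eq_none (not_lt.1 hm)]
    rw [this]
    exact hl

/-- Search for a witness of a semidecidable relation, as a partial recursive function. -/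
theorem Semi.exists_partrec {P : ι → κ → Prop}
    (hP : Semi trivName.{0} fun (x : ι × κ) _ => P x.1 x.2) :
    ∃ g : ι →. κ, Partrec g ∧ (∀ i, ∀ k ∈ g i, P i k) ∧ ∀ i, (∃ k, P i k) → (g i).Dom := by
  classical
  obtain ⟨F, hF, hFm, hP⟩ := hP
  -- Candidates and lengths of initial segments are searched simultaneously.
  let f : ι → ℕ → Option κ := fun i t => (Encodable.decode (α := κ) t.unpair.1).bind
    fun k => if F ((i, k), pre (fun _ => 0) t.unpair.2) then some k else none
  have hf : Computable₂ f := by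
    refine Primrec.to_comp ?_
    refine Primrec.option_bind
      (Primrec.decode.comp (Primrec.fst.comp (Primrec.unpair.comp Primrec.snd))) ?_
    refine Primrec.ite ?_ (Primrec.option_some.comp Primrec.snd) (Primrec.const none)
    refine hF.comp (Primrec.pair (Primrec.pair (Primrec.fst.comp Primrec.fst) Primrec.snd) ?_)
    exact Primrec.list_map (Primrec.list_range.comp (Primrec.snd.comp (Primrec.unpair.comp
      (Primrec.snd.comp Primrec.fst)))) (Primrec.const 0).to₂
  refine ⟨_, Partrec.rfindOpt hf, ?_, ?_⟩
  · intro i k hk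
    obtain ⟨t, ht⟩ := Nat.rfindOpt_spec hk
    simp only [f, Option.mem_def, Option.bind_eq_some_iff] at ht
    obtain ⟨k', _, hk'⟩ := ht
    split_ifs at hk' with hF'
    cases hk'
    exact (hP (i, k) PUnit.unit).2 ⟨_, hF'⟩
  · rintro i ⟨k, hk⟩
    obtain ⟨t, ht⟩ := (hP (i, k) PUnit.unit).1 hk
    refine Nat.rfindOpt_dom.2 ⟨Nat.pair (Encodable.encode k) t, k, ?_⟩
    simp only [f, Nat.unpair_pair, Encodable.encodek, Option.bind_some, Option.mem_def]
    exact if_pos ht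

/-- Computable choice. -/
theorem Semi.exists_computable {P : ι → κ → Prop}
    (hP : Semi trivName.{0} fun (x : ι × κ) _ => P x.1 x.2) (tot : ∀ i, ∃ k, P i k) :
    ∃ g : ι → κ, Computable g ∧ ∀ i, P i (g i) := by
  obtain ⟨g, hg, h1, h2⟩ := hP.exists_partrec
  exact ⟨fun i => (g i).get (h2 i (tot i)), hg.of_eq_tot fun i => Part.get_mem _,
    fun i => h1 i _ (Part.get_mem _)⟩

/-- Computable dependent choice: if every valid state at stage `n` has a valid extension at stage
`n + 1` with a semidecidable relation to it, then there is a computable chain of extensions. -/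
theorem Semi.exists_chain {E : ι → ℕ → κ → κ → Prop} {V : ι → ℕ → κ → Prop}
    (hE : Semi trivName.{0} fun (x : (ι × ℕ × κ) × κ) _ => E x.1.1 x.1.2.1 x.1.2.2 x.2)
    {s₀ : ι → κ} (hs₀ : Computable s₀) (h₀ : ∀ i, V i 0 (s₀ i))
    (tot : ∀ i n s, V i n s → ∃ s', E i n s s')
    (hV : ∀ i n s s', V i n s → E i n s s' → V i (n + 1) s') :
    ∃ T : ι → ℕ → κ, Computable (fun x : ι × ℕ => T x.1 x.2) ∧ (∀ i, T i 0 = s₀ i) ∧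
      ∀ i n, V i n (T i n) ∧ E i n (T i n) (T i (n + 1)) := by
  obtain ⟨g, hg, h1, h2⟩ :=
    Semi.exists_partrec (P := fun (x : ι × ℕ × κ) s' => E x.1 x.2.1 x.2.2 s') hE
  let G : ι × ℕ →. κ := fun x => Nat.rec (Part.some (s₀ x.1))
    (fun n IH => IH.bind fun s => g (x.1, n, s)) x.2
  have hG : Partrec G := by
    refine Partrec.nat_rec (h := fun (x : ι × ℕ) (y : ℕ × κ) => g (x.1, y.1, y.2))
      Computable.snd (g := fun x => Part.some (s₀ x.1)) ?_ ?_
    · exact (by fun_prop : Computable fun x : ι × ℕ => s₀ x.1)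
    · exact hg.comp (by fun_prop : Computable fun x : (ι × ℕ) × ℕ × κ => (x.1.1, x.2.1, x.2.2))
  have hdom : ∀ i n, ∃ s, s ∈ G (i, n) ∧ V i n s := by
    intro i n
    induction n with
    | zero => exact ⟨_, Part.mem_some _, h₀ i⟩
    | succ n ih =>
      obtain ⟨s, hs, hv⟩ := ih
      obtain ⟨s', hs'⟩ := Part.dom_iff_mem.1 (h2 (i, n, s) (tot i n s hv))
      exact ⟨s', Part.mem_bind hs hs', hV i n s s' hv (h1 _ _ hs')⟩
  choose T hT hTV using hdom
  refine ⟨T, hG.of_eq_tot fun x => hT x.1 x.2, fun i => ?_, fun i n => ⟨hTV i n, ?_⟩⟩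
  · exact (Part.mem_some_iff.1 (hT i 0))
  · obtain ⟨s, hs, hs'⟩ := Part.mem_bind_iff.1 (hT i (n + 1))
    rw [Part.mem_unique (hT i n) hs]
    exact h1 _ _ hs'

end Semi

/-! ### Computable real numbers, given by their cuts -/

section RatCode

/-- Codes of rational numbers, decoded by `ratVal`. -/
abbrev RatCode : Type := ℕ × ℕ × ℕ

/-- Negation of rational codes. -/
def RatCode.neg (q : RatCode) : RatCode := (q.2.1, q.1, q.2.2)

/-- Addition of rational codes. -/
def RatCode.add (q s : RatCode) : RatCode :=
  (q.1 * (s.2.2 + 1) + s.1 * (q.2.2 + 1), q.2.1 * (s.2.2 + 1) + s.2.1 * (q.2.2 + 1),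
    (q.2.2 + 1) * (s.2.2 + 1) - 1)

/-- Division of a rational code by `k + 1`. -/
def RatCode.div (q : RatCode) (k : ℕ) : RatCode := (q.1, q.2.1, (q.2.2 + 1) * (k + 1) - 1)

theorem ratVal_neg (q : RatCode) : ratVal q.neg = -ratVal q := by
  simp only [ratVal, RatCode.neg]; ring

theorem ratVal_add (q s : RatCode) : ratVal (q.add s) = ratVal q + ratVal s := by
  have h : (((q.2.2 + 1) * (s.2.2 + 1) - 1 : ℕ) : ℝ) = ((q.2.2 : ℝ) + 1) * (s.2.2 + 1) - 1 := by
    rw [Nat.cast_sub (Nat.mul_pos (Nat.succ_pos _) (Nat.succ_pos _))]; push_cast; ring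
  simp only [ratVal, RatCode.add, h]
  push_cast
  field_simp
  ring

theorem ratVal_div (q : RatCode) (k : ℕ) : ratVal (q.div k) = ratVal q / (k + 1) := by
  have h : (((q.2.2 + 1) * (k + 1) - 1 : ℕ) : ℝ) = ((q.2.2 : ℝ) + 1) * (k + 1) - 1 := by
    rw [Nat.cast_sub (Nat.mul_pos (Nat.succ_pos _) (Nat.succ_pos _))]; push_cast; ring
  simp only [ratVal, RatCode.div, h]
  field_simp
  ring

@[simp] theorem ratVal_nat (n : ℕ) : ratVal (n, 0, 0) = n := by simp [ratVal]

theorem ratVal_half_pow (n : ℕ) : ratVal (1, 0, 2 ^ n - 1) = (1 / 2 : ℝ) ^ n := by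
  simp [ratVal, Nat.cast_sub Nat.one_le_two_pow]

theorem ratVal_lt_iff (q s : RatCode) : ratVal q < ratVal s ↔
    q.1 * (s.2.2 + 1) + s.2.1 * (q.2.2 + 1) < s.1 * (q.2.2 + 1) + q.2.1 * (s.2.2 + 1) := by
  rw [ratVal, ratVal, div_lt_div_iff₀ (by positivity) (by positivity), ← Nat.cast_lt (α := ℝ)]
  push_cast
  constructor <;> intro h <;> linarith

theorem exists_ratVal_eq (x : ℚ) : ∃ q : RatCode, ratVal q = x := by
  refine ⟨(x.num.toNat, (-x.num).toNat, x.den - 1), ?_⟩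
  have h1 : ((x.num.toNat : ℝ) - ((-x.num).toNat : ℝ)) = (x.num : ℝ) := by
    have : ((x.num.toNat : ℤ) - ((-x.num).toNat : ℤ)) = x.num := by omega
    exact_mod_cast this
  have h2 : ((x.den - 1 : ℕ) : ℝ) + 1 = x.den := by
    rw [Nat.cast_sub x.pos]; simp
  rw [ratVal, h1, h2]
  exact (Rat.cast_def x).symm

theorem exists_ratVal_btwn {x y : ℝ} (h : x < y) : ∃ q : RatCode, x < ratVal q ∧ ratVal q < y := by
  obtain ⟨z, h1, h2⟩ := exists_rat_btwn h
  obtain ⟨q, hq⟩ := exists_ratVal_eq z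
  exact ⟨q, by rwa [hq], by rwa [hq]⟩

variable {α : Type*} [Primcodable α]

@[fun_prop] theorem Computable.ratNeg {f : α → RatCode} (hf : Computable f) :
    Computable fun x => (f x).neg := by unfold RatCode.neg; fun_prop

@[fun_prop] theorem Computable.ratAdd {f g : α → RatCode} (hf : Computable f)
    (hg : Computable g) : Computable fun x => (f x).add (g x) := by unfold RatCode.add; fun_prop

@[fun_prop] theorem Computable.ratDiv {f : α → RatCode} {g : α → ℕ} (hf : Computable f)
    (hg : Computable g) : Computable fun x => (f x).div (g x) := by unfold RatCode.div; fun_prop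

end RatCode

section CompReal

variable {ι κ : Type} [Primcodable ι] [Primcodable κ]
variable {D : Type*} {nm : D → ℕ → ℕ}

theorem Semi.ratLt {f g : ι → RatCode} (hf : Computable f) (hg : Computable g) :
    Semi nm (fun i _ => ratVal (f i) < ratVal (g i)) :=
  (Semi.natLt (f := fun i => (f i).1 * ((g i).2.2 + 1) + (g i).2.1 * ((f i).2.2 + 1))
    (g := fun i => (g i).1 * ((f i).2.2 + 1) + (f i).2.1 * ((g i).2.2 + 1))
    (by fun_prop) (by fun_prop)).of_iff fun i _ => ratVal_lt_iff (f i) (g i)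

/-- The real number `h i d` is computable, uniformly in `i`, from the name of `d`: its lower and
its upper cut are semidecidable. -/
structure CompReal (nm : D → ℕ → ℕ) (h : ι → D → ℝ) : Prop where
  lower : Semi nm fun (x : ι × RatCode) d => ratVal x.2 < h x.1 d
  upper : Semi nm fun (x : ι × RatCode) d => h x.1 d < ratVal x.2

namespace CompReal

variable {f g : ι → D → ℝ}

theorem lt (hf : CompReal nm f) (hg : CompReal nm g) : Semi nm fun i d => f i d < g i d := by
  refine (Semi.ex (P := fun i q d => f i d < ratVal q ∧ ratVal q < g i d)
    (hf.upper.and hg.lower)).of_iff fun i d => ?_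
  exact ⟨exists_ratVal_btwn, fun ⟨_, h1, h2⟩ => h1.trans h2⟩

theorem comp {h : κ → D → ℝ} (hh : CompReal nm h) {g : ι → κ} (hg : Computable g) :
    CompReal nm fun i d => h (g i) d :=
  ⟨hh.lower.comp (g := fun x : ι × RatCode => (g x.1, x.2)) (by fun_prop),
    hh.upper.comp (g := fun x : ι × RatCode => (g x.1, x.2)) (by fun_prop)⟩

theorem of_eq (hf : CompReal nm f) (h : ∀ i d, g i d = f i d) : CompReal nm g := by
  have : g = f := funext fun i => funext fun d => h i d
  rwa [this]

theorem pullback {D' : Type*} {nm' : D' → ℕ → ℕ} (hf : CompReal nm f)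
    {π : D' → D} {ρ : ℕ → ℕ} (hρ : Primrec ρ) (h : ∀ d n, nm (π d) n = ρ (nm' d n)) :
    CompReal nm' fun i d => f i (π d) :=
  ⟨hf.lower.pullback hρ h, hf.upper.pullback hρ h⟩

theorem assocApp {D' : Type*} {nm' : D' → ℕ → ℕ} {h : ι → D' → ℝ} (hh : CompReal nm' h)
    {p : ι → ℕ → ℕ} (hp : Computable fun x : ι × ℕ => p x.1 x.2) {π : ι → D → D'}
    (hπ : ∀ i d, AssocApp (nm d) (p i) (nm' (π i d))) :
    CompReal nm fun i d => h i (π i d) :=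
  ⟨hh.lower.assocApp (p := fun x : ι × RatCode => p x.1) (π := fun x => π x.1) (by fun_prop)
      fun x => hπ x.1,
    hh.upper.assocApp (p := fun x : ι × RatCode => p x.1) (π := fun x => π x.1) (by fun_prop)
      fun x => hπ x.1⟩

theorem rat {q : ι → RatCode} (hq : Computable q) : CompReal nm fun i _ => ratVal (q i) :=
  ⟨Semi.ratLt (f := fun x : ι × RatCode => x.2) (g := fun x => q x.1) (by fun_prop) (by fun_prop),
    Semi.ratLt (f := fun x : ι × RatCode => q x.1) (g := fun x => x.2) (by fun_prop)
      (by fun_prop)⟩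

theorem nat {n : ι → ℕ} (hn : Computable n) : CompReal nm fun i _ => (n i : ℝ) :=
  (rat (q := fun i => (n i, 0, 0)) (by fun_prop)).of_eq fun i _ => (ratVal_nat (n i)).symm

theorem half_pow {n : ι → ℕ} (hn : Computable n) : CompReal nm fun i _ => (1 / 2 : ℝ) ^ n i :=
  (rat (q := fun i => (1, 0, 2 ^ n i - 1)) (by fun_prop)).of_eq
    fun i _ => (ratVal_half_pow (n i)).symm

theorem neg (hf : CompReal nm f) : CompReal nm fun i d => -f i d := by
  constructor
  · exact (hf.upper.comp (g := fun x : ι × RatCode => (x.1, x.2.neg)) (by fun_prop)).of_iff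
      fun x d => by rw [ratVal_neg, lt_neg]
  · exact (hf.lower.comp (g := fun x : ι × RatCode => (x.1, x.2.neg)) (by fun_prop)).of_iff
      fun x d => by rw [ratVal_neg, neg_lt]

theorem add (hf : CompReal nm f) (hg : CompReal nm g) :
    CompReal nm fun i d => f i d + g i d := by
  constructor
  · refine (Semi.ex (P := fun (x : ι × RatCode) (y : RatCode × RatCode) d =>
      ratVal x.2 < ratVal (y.1.add y.2) ∧ ratVal y.1 < f x.1 d ∧ ratVal y.2 < g x.1 d)
      (Semi.and (Semi.ratLt ?_ ?_) (Semi.and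
        (hf.lower.comp (g := fun z : (ι × RatCode) × RatCode × RatCode => (z.1.1, z.2.1)) ?_)
        (hg.lower.comp (g := fun z : (ι × RatCode) × RatCode × RatCode => (z.1.1, z.2.2)) ?_)))
      ).of_iff fun x d => ?_
    iterate 4 fun_prop
    constructor
    · intro h
      obtain ⟨s, hs1, hs2⟩ := exists_ratVal_btwn (show ratVal x.2 - g x.1 d < f x.1 d by linarith)
      obtain ⟨t, ht1, ht2⟩ := exists_ratVal_btwn (show ratVal x.2 - ratVal s < g x.1 d by linarith)
      exact ⟨(s, t), by rw [ratVal_add]; linarith, hs2, ht2⟩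
    · rintro ⟨⟨s, t⟩, h1, h2, h3⟩
      rw [ratVal_add] at h1
      linarith
  · refine (Semi.ex (P := fun (x : ι × RatCode) (y : RatCode × RatCode) d =>
      ratVal (y.1.add y.2) < ratVal x.2 ∧ f x.1 d < ratVal y.1 ∧ g x.1 d < ratVal y.2)
      (Semi.and (Semi.ratLt ?_ ?_) (Semi.and
        (hf.upper.comp (g := fun z : (ι × RatCode) × RatCode × RatCode => (z.1.1, z.2.1)) ?_)
        (hg.upper.comp (g := fun z : (ι × RatCode) × RatCode × RatCode => (z.1.1, z.2.2)) ?_)))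
      ).of_iff fun x d => ?_
    iterate 4 fun_prop
    constructor
    · intro h
      obtain ⟨s, hs1, hs2⟩ := exists_ratVal_btwn (show f x.1 d < ratVal x.2 - g x.1 d by linarith)
      obtain ⟨t, ht1, ht2⟩ := exists_ratVal_btwn (show g x.1 d < ratVal x.2 - ratVal s by linarith)
      exact ⟨(s, t), by rw [ratVal_add]; linarith, hs1, ht1⟩
    · rintro ⟨⟨s, t⟩, h1, h2, h3⟩
      rw [ratVal_add] at h1
      linarith

theorem sub (hf : CompReal nm f) (hg : CompReal nm g) :
    CompReal nm fun i d => f i d - g i d :=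
  (hf.add hg.neg).of_eq fun _ _ => sub_eq_add_neg _ _

theorem two_pow_mul (hf : CompReal nm f) {e : ι → ℕ} (he : Computable e) :
    CompReal nm fun i d => 2 ^ e i * f i d := by
  have hq : ∀ x : ι × RatCode, ratVal (x.2.div (2 ^ e x.1 - 1)) = ratVal x.2 / 2 ^ e x.1 := by
    intro x
    rw [ratVal_div, Nat.cast_sub Nat.one_le_two_pow]
    simp
  constructor
  · refine (hf.lower.comp (g := fun x : ι × RatCode => (x.1, x.2.div (2 ^ e x.1 - 1)))
      (by fun_prop)).of_iff fun x d => ?_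
    rw [hq, div_lt_iff₀' (by positivity)]
  · refine (hf.upper.comp (g := fun x : ι × RatCode => (x.1, x.2.div (2 ^ e x.1 - 1)))
      (by fun_prop)).of_iff fun x d => ?_
    rw [hq, lt_div_iff₀' (by positivity)]

theorem max (hf : CompReal nm f) (hg : CompReal nm g) :
    CompReal nm fun i d => max (f i d) (g i d) :=
  ⟨(hf.lower.or hg.lower).of_iff fun _ _ => lt_max_iff,
    (hf.upper.and hg.upper).of_iff fun _ _ => max_lt_iff⟩

theorem min (hf : CompReal nm f) (hg : CompReal nm g) :
    CompReal nm fun i d => min (f i d) (g i d) :=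
  ⟨(hf.lower.and hg.lower).of_iff fun _ _ => lt_min_iff,
    (hf.upper.or hg.upper).of_iff fun _ _ => min_lt_iff⟩

theorem ite_eq (hf : CompReal nm f) (hg : CompReal nm g) {a b : ι → ℕ} (ha : Computable a)
    (hb : Computable b) : CompReal nm fun i d => if a i = b i then f i d else g i d := by
  have he : Semi nm fun (x : ι × RatCode) (_ : D) => a x.1 = b x.1 :=
    Semi.eq (by fun_prop) (by fun_prop)
  have hn : Semi nm fun (x : ι × RatCode) (_ : D) => a x.1 ≠ b x.1 :=
    Semi.ne (by fun_prop) (by fun_prop)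
  constructor
  · exact ((he.and hf.lower).or (hn.and hg.lower)).of_iff fun x d => by
      by_cases h : a x.1 = b x.1 <;> simp [h]
  · exact ((he.and hf.upper).or (hn.and hg.upper)).of_iff fun x d => by
      by_cases h : a x.1 = b x.1 <;> simp [h]

theorem finset_inf {f : ι → ℕ → D → unitInterval} {N : ι → ℕ}
    (hf : CompReal nm fun (x : ι × ℕ) d => (f x.1 x.2 d : ℝ)) (hN : Computable N) :
    CompReal nm fun i d => (((Finset.range (N i)).inf fun j => f i j d : unitInterval) : ℝ) := by
  -- The infimum of the empty set is `1`.
  have key : ∀ (q : ℝ) (s : Finset ℕ) (g : ℕ → unitInterval),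
      (q < ((s.inf g : unitInterval) : ℝ) ↔ q < 1 ∧ ∀ a ∈ s, q < g a) := by
    intro q s g
    induction s using Finset.cons_induction with
    | empty => simp
    | cons a s ha ih =>
      rw [Finset.inf_cons, Finset.forall_mem_cons]
      have : (((g a ⊓ s.inf g : unitInterval)) : ℝ) =
        Min.min (g a : ℝ) ((s.inf g : unitInterval) : ℝ) := rfl
      rw [this, lt_min_iff, ih]
      tauto
  have key' : ∀ (q : ℝ) (s : Finset ℕ) (g : ℕ → unitInterval),
      (((s.inf g : unitInterval) : ℝ) < q ↔ 1 < q ∨ ∃ a ∈ s, g a < q) := by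
    intro q s g
    induction s using Finset.cons_induction with
    | empty => simp
    | cons a s ha ih =>
      simp only [Finset.inf_cons, Finset.mem_cons, exists_eq_or_imp]
      have : (((g a ⊓ s.inf g : unitInterval)) : ℝ) =
        Min.min (g a : ℝ) ((s.inf g : unitInterval) : ℝ) := rfl
      rw [this, min_lt_iff, ih]
      tauto
  have h1 : CompReal nm fun (_ : ι × RatCode) (_ : D) => ((1 : ℕ) : ℝ) := nat (by fun_prop)
  have hq : CompReal nm fun (x : ι × RatCode) (_ : D) => ratVal x.2 := rat (by fun_prop)
  constructor
  · refine ((hq.lt h1).and (Semi.all_lt (P := fun x j d => ratVal x.2 < f x.1 j d)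
      (N := fun x => N x.1) (hf.lower.comp
        (g := fun z : (ι × RatCode) × ℕ => ((z.1.1, z.2), z.1.2)) ?_) ?_)).of_iff fun x d => ?_
    · fun_prop
    · fun_prop
    · rw [key]; simp
  · refine ((h1.lt hq).or (Semi.ex_lt (P := fun x j d => f x.1 j d < ratVal x.2)
      (N := fun x => N x.1) (hf.upper.comp
        (g := fun z : (ι × RatCode) × ℕ => ((z.1.1, z.2), z.1.2)) ?_) ?_)).of_iff fun x d => ?_
    · fun_prop
    · fun_prop
    · rw [key']; simp

theorem finset_sup {f : ι → ℕ → D → unitInterval} {N : ι → ℕ}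
    (hf : CompReal nm fun (x : ι × ℕ) d => (f x.1 x.2 d : ℝ)) (hN : Computable N) :
    CompReal nm fun i d => (((Finset.range (N i)).sup fun j => f i j d : unitInterval) : ℝ) := by
  -- The supremum of the empty set is `0`.
  have key : ∀ (q : ℝ) (s : Finset ℕ) (g : ℕ → unitInterval),
      (((s.sup g : unitInterval) : ℝ) < q ↔ 0 < q ∧ ∀ a ∈ s, g a < q) := by
    intro q s g
    induction s using Finset.cons_induction with
    | empty => simp
    | cons a s ha ih =>
      rw [Finset.sup_cons, Finset.forall_mem_cons]
      have : (((g a ⊔ s.sup g : unitInterval)) : ℝ) =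
        Max.max (g a : ℝ) ((s.sup g : unitInterval) : ℝ) := rfl
      rw [this, max_lt_iff, ih]
      tauto
  have key' : ∀ (q : ℝ) (s : Finset ℕ) (g : ℕ → unitInterval),
      (q < ((s.sup g : unitInterval) : ℝ) ↔ q < 0 ∨ ∃ a ∈ s, q < g a) := by
    intro q s g
    induction s using Finset.cons_induction with
    | empty => simp
    | cons a s ha ih =>
      simp only [Finset.sup_cons, Finset.mem_cons, exists_eq_or_imp]
      have : (((g a ⊔ s.sup g : unitInterval)) : ℝ) =
        Max.max (g a : ℝ) ((s.sup g : unitInterval) : ℝ) := rfl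
      rw [this, lt_max_iff, ih]
      tauto
  have h0 : CompReal nm fun (_ : ι × RatCode) (_ : D) => ((0 : ℕ) : ℝ) := nat (by fun_prop)
  have hq : CompReal nm fun (x : ι × RatCode) (_ : D) => ratVal x.2 := rat (by fun_prop)
  constructor
  · refine ((hq.lt h0).or (Semi.ex_lt (P := fun x j d => ratVal x.2 < f x.1 j d)
      (N := fun x => N x.1) (hf.lower.comp
        (g := fun z : (ι × RatCode) × ℕ => ((z.1.1, z.2), z.1.2)) ?_) ?_)).of_iff fun x d => ?_
    · fun_prop
    · fun_prop
    · rw [key']; simp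
  · refine ((h0.lt hq).and (Semi.all_lt (P := fun x j d => f x.1 j d < ratVal x.2)
      (N := fun x => N x.1) (hf.upper.comp
        (g := fun z : (ι × RatCode) × ℕ => ((z.1.1, z.2), z.1.2)) ?_) ?_)).of_iff fun x d => ?_
    · fun_prop
    · fun_prop
    · rw [key]; simp

end CompReal

theorem IsComputableReals.compReal {x : ι → ℝ} (hx : IsComputableReals x) :
    CompReal nm fun i _ => x i := by
  obtain ⟨g, hg, hgx⟩ := hx
  have hg' : Computable fun y : ι × ℕ => g y.1 y.2 := hg
  have hpow : ∀ ε : ℝ, 0 < ε → ∃ n, (1 / 2 : ℝ) ^ n < ε := fun ε hε =>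
    exists_pow_lt_of_lt_one hε (by norm_num)
  have hq : CompReal nm fun (z : (ι × RatCode) × ℕ) (_ : D) => ratVal z.1.2 :=
    CompReal.rat (by fun_prop)
  have hp : CompReal nm fun (z : (ι × RatCode) × ℕ) (_ : D) => (1 / 2 : ℝ) ^ z.2 :=
    CompReal.half_pow (by fun_prop)
  have hG : CompReal nm fun (z : (ι × RatCode) × ℕ) (_ : D) => ratVal (g z.1.1 z.2) :=
    CompReal.rat (by fun_prop)
  constructor
  · refine (Semi.ex (P := fun (y : ι × RatCode) (n : ℕ) _ =>
      ratVal y.2 + (1 / 2 : ℝ) ^ n < ratVal (g y.1 n)) ((hq.add hp).lt hG)).of_iff fun y _ => ?_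
    constructor
    · intro h
      obtain ⟨n, hn⟩ := hpow ((x y.1 - ratVal y.2) / 2) (by linarith)
      exact ⟨n, by linarith [(abs_le.1 (hgx y.1 n)).1]⟩
    · rintro ⟨n, hn⟩
      linarith [(abs_le.1 (hgx y.1 n)).2]
  · refine (Semi.ex (P := fun (y : ι × RatCode) (n : ℕ) _ =>
      ratVal (g y.1 n) + (1 / 2 : ℝ) ^ n < ratVal y.2) ((hG.add hp).lt hq)).of_iff fun y _ => ?_
    constructor
    · intro h
      obtain ⟨n, hn⟩ := hpow ((ratVal y.2 - x y.1) / 2) (by linarith)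
      exact ⟨n, by linarith [(abs_le.1 (hgx y.1 n)).2]⟩
    · rintro ⟨n, hn⟩
      linarith [(abs_le.1 (hgx y.1 n)).1]

end CompReal

/-! ### Convergence in the sequential function space topology -/

section SeqTopology

variable {X Y : Type u} [TopologicalSpace X] [TopologicalSpace Y]

theorem ContConv.tendsto {F : ℕ → C(X, Y)} {f : C(X, Y)} (h : ContConv F f) :
    Tendsto F atTop (@nhds _ (seqTopology X Y) f) :=
  (@tendsto_nhds _ (seqTopology X Y) _ _ _ _).2 fun _ hW hf => hW F f h hf

/-- No sequences other than those that converge in the sense of `ContConv` converge in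
`seqTopology`. -/
theorem contConv_of_tendsto {F : ℕ → C(X, Y)} {f : C(X, Y)}
    (h : Tendsto F atTop (@nhds _ (seqTopology X Y) f)) : ContConv F f := by
  classical
  intro x a hx
  rw [tendsto_nhds]
  intro O hO hfa
  obtain ⟨m, hm⟩ := eventually_atTop.1
    (((f.continuous.tendsto a).comp hx).eventually (hO.mem_nhds hfa))
  -- The maps that send `a` and a tail of the sequence `x` into `O` form an open set.
  let W : Set C(X, Y) := {g | g a ∈ O ∧ ∀ j ≥ m, g (x j) ∈ O}
  have hW : @IsOpen _ (seqTopology X Y) W := by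
    intro G g hG hg
    have hconst : ∀ b, g b ∈ O → ∀ᶠ n in atTop, G n b ∈ O := fun b hb =>
      (hG (fun _ => b) b tendsto_const_nhds).eventually (hO.mem_nhds hb)
    let B : ℕ → ℕ → Prop := fun n j => m ≤ j ∧ G n (x j) ∉ O
    -- The first counterexample, if there is one, moves to infinity with `n`.
    let z : ℕ → X := fun n => if hn : ∃ j, B n j then x (Nat.find hn) else a
    have hz : Tendsto z atTop (𝓝 a) := by
      rw [tendsto_nhds]
      intro V hV haV
      obtain ⟨J, hJ⟩ := eventually_atTop.1 (hx.eventually (hV.mem_nhds haV))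
      have hsmall : ∀ᶠ n in atTop, ∀ j ∈ Finset.range J, m ≤ j → G n (x j) ∈ O := by
        rw [eventually_all_finset]
        intro j _
        by_cases hj : m ≤ j
        · exact (hconst (x j) (hg.2 j hj)).mono fun n hn _ => hn
        · exact Eventually.of_forall fun n h => absurd h hj
      filter_upwards [hsmall] with n hn
      simp only [Set.mem_preimage, z]
      split_ifs with hB
      · apply hJ
        by_contra hlt
        have hs := Nat.find_spec hB
        exact hs.2 (hn _ (Finset.mem_range.2 (not_le.1 hlt)) hs.1)
      · exact haV
    filter_upwards [hconst a hg.1, (hG z a hz).eventually (hO.mem_nhds hg.1)] with n h1 h2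
    refine ⟨h1, fun j hj => ?_⟩
    by_contra hjO
    have hB : ∃ j, B n j := ⟨j, hj, hjO⟩
    simp only [z, dif_pos hB] at h2
    exact (Nat.find_spec hB).2 h2
  have hev := (@tendsto_nhds _ (seqTopology X Y) _ _ _ _).1 h W hW ⟨hfa, fun j hj => hm j hj⟩
  filter_upwards [hev, eventually_ge_atTop m] with n hn hmn
  exact hn.2 n hmn

theorem continuous_eval_seqTopology (a : X) :
    @Continuous _ _ (seqTopology X Y) _ fun f : C(X, Y) => f a := by
  refine @Continuous.mk _ _ (seqTopology X Y) _ _ fun O hO F f hF hf => ?_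
  exact (hF (fun _ => a) a tendsto_const_nhds).eventually (hO.mem_nhds hf)

theorem continuous_seqTopology_of_seq {Z : Type*} [TopologicalSpace Z] [SequentialSpace Z]
    {h : Z → C(X, Y)}
    (hh : ∀ (z : ℕ → Z) (c : Z), Tendsto z atTop (𝓝 c) → ContConv (fun n => h (z n)) (h c)) :
    @Continuous _ _ _ (seqTopology X Y) h :=
  letI := seqTopology X Y
  continuous_iff_seqContinuous.2 fun z c hz => (hh z c hz).tendsto

end SeqTopology

/-! ### Midpoints in Banach spaces and in the Urysohn space -/

/-- Finite families of points have systems of midpoints that behave as in a normed space. The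
midpoints may depend on the whole family, which is what makes the Urysohn space have them. -/
def HasMidpoints (X : Type u) [MetricSpace X] : Prop :=
  ∀ (N : ℕ) (u : ℕ → X), ∃ m : ℕ → ℕ → X, (∀ a < N, m a a = u a) ∧
    (∀ a < N, ∀ b < N, m a b = m b a) ∧
      ∀ a < N, ∀ b < N, ∀ c < N, dist (m a b) (m a c) ≤ dist (u b) (u c) / 2

theorem IsBanachSpace.hasMidpoints {X : Type u} [m : MetricSpace X] (h : IsBanachSpace X) :
    HasMidpoints X := by
  obtain ⟨_, N, S, rfl⟩ := h
  intro n u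
  refine ⟨fun a b => (2⁻¹ : ℝ) • (u a + u b), fun a _ => ?_, fun a _ b _ => ?_,
    fun a _ b _ c _ => ?_⟩
  · beta_reduce; rw [← two_smul ℝ, smul_smul]; norm_num
  · simp only [add_comm]
  · rw [dist_eq_norm, ← smul_sub, norm_smul, dist_eq_norm]
    simp only [add_sub_add_left_eq_sub]
    norm_num
    linarith

/-- Finite saturation for pseudometric spaces: points at distance zero are identified first. -/
theorem FinitelySaturated.exists_extension {X : Type u} [MetricSpace X] (hX : FinitelySaturated X)
    {L : Type} [PseudoMetricSpace L] [Finite L] (S : Set L) (u : L → X)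
    (hu : ∀ a ∈ S, ∀ b ∈ S, dist (u a) (u b) = dist a b) :
    ∃ ψ : L → X, Isometry ψ ∧ ∀ a ∈ S, ψ a = u a := by
  let mk : L → SeparationQuotient L := SeparationQuotient.mk
  have : Finite (SeparationQuotient L) := Finite.of_surjective _ SeparationQuotient.surjective_mk
  have hK : ∀ k : mk '' S, ∃ a ∈ S, mk a = k := fun k => k.2
  choose s hs hsk using hK
  obtain ⟨ψ, hψ, hψK⟩ := hX (SeparationQuotient L) (mk '' S) (fun k => u (s k))
    (Isometry.of_dist_eq fun k l => by
      rw [hu _ (hs k) _ (hs l), ← SeparationQuotient.dist_mk, Subtype.dist_eq, ← hsk, ← hsk])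
  refine ⟨fun a => ψ (mk a), Isometry.of_dist_eq fun a b => ?_, fun a ha => ?_⟩
  · rw [hψ.dist_eq, SeparationQuotient.dist_mk]
  · have hk := hsk ⟨mk a, a, ha, rfl⟩
    refine (hψK ⟨mk a, a, ha, rfl⟩).trans ?_
    rw [← dist_eq_zero, hu _ (hs _) _ ha, ← SeparationQuotient.dist_mk]
    change dist (mk _) (mk a) = 0
    rw [hk, dist_self]

/-- The Kuratowski embedding of a finite family of points into a space of vectors with the
supremum norm. -/
theorem dist_kuratowski {X : Type u} [MetricSpace X] {ι : Type} [Fintype ι] (u : ι → X) (a b : ι) :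
    dist (fun i => dist (u a) (u i)) (fun i => dist (u b) (u i)) = dist (u a) (u b) := by
  apply le_antisymm
  · refine (dist_pi_le_iff dist_nonneg).2 fun i => ?_
    rw [Real.dist_eq]
    exact abs_dist_sub_le _ _ _
  · refine le_trans ?_ (dist_le_pi_dist _ _ b)
    simp

theorem FinitelySaturated.hasMidpoints {X : Type u} [MetricSpace X] (hX : FinitelySaturated X) :
    HasMidpoints X := by
  intro N u
  let κ : Fin N → Fin N → ℝ := fun a i => dist (u a) (u i)
  let f : Fin N × Fin N → Fin N → ℝ := fun x => (2⁻¹ : ℝ) • (κ x.1 + κ x.2)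
  let _ : PseudoMetricSpace (Fin N × Fin N) := PseudoMetricSpace.induced f inferInstance
  have hd : ∀ x y : Fin N × Fin N, dist x y = dist (f x) (f y) := fun _ _ => rfl
  have hf : ∀ a, f (a, a) = κ a := fun a => by
    change (2⁻¹ : ℝ) • (κ a + κ a) = κ a
    rw [← two_smul ℝ, smul_smul]; norm_num
  obtain ⟨ψ, hψ, hψS⟩ := hX.exists_extension (L := Fin N × Fin N) (Set.range fun a => (a, a))
    (fun x => u x.1)
    (by
      rintro _ ⟨a, rfl⟩ _ ⟨b, rfl⟩
      rw [hd, hf, hf]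
      exact (dist_kuratowski (fun i : Fin N => u i) a b).symm)
  have hψd : ∀ a b c d : Fin N, dist (ψ (a, b)) (ψ (c, d)) = dist (f (a, b)) (f (c, d)) :=
    fun a b c d => hψ.dist_eq _ _
  refine ⟨fun a b => if h : a < N ∧ b < N then ψ (⟨a, h.1⟩, ⟨b, h.2⟩) else u a,
    fun a ha => ?_, fun a ha b hb => ?_, fun a ha b hb c hc => ?_⟩
  · simp only [ha, and_self, dif_pos]
    exact hψS (⟨a, ha⟩, ⟨a, ha⟩) ⟨_, rfl⟩
  · simp only [ha, hb, and_self, dif_pos]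
    rw [← dist_eq_zero, hψd]
    simp only [f, add_comm, dist_self]
  · simp only [ha, hb, hc, and_self, dif_pos]
    have hκ : dist (κ ⟨b, hb⟩) (κ ⟨c, hc⟩) = dist (u b) (u c) :=
      dist_kuratowski (fun i : Fin N => u i) ⟨b, hb⟩ ⟨c, hc⟩
    rw [hψd, ← hκ, dist_eq_norm, dist_eq_norm]
    simp only [f]
    rw [← smul_sub, norm_smul, add_sub_add_left_eq_sub]
    norm_num
    linarith

/-! ### Numbers as codes of finite functions -/

/-- The digit of `x` at position `j` in base `K`. Numbers below `K ^ m` code the functions from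
`{0, …, m - 1}` to `{0, …, K - 1}` by their digits. -/
def digit (K x j : ℕ) : ℕ := x / K ^ j % K

@[fun_prop] theorem Computable.digit {α : Type*} [Primcodable α] {K x j : α → ℕ}
    (hK : Computable K) (hx : Computable x) (hj : Computable j) :
    Computable fun a => digit (K a) (x a) (j a) := by unfold _root_.digit; fun_prop

theorem digit_lt {K : ℕ} (hK : 0 < K) (x j : ℕ) : digit K x j < K := Nat.mod_lt _ hK

theorem exists_digit_eq (K m : ℕ) (f : ℕ → ℕ) (hf : ∀ j < m, f j < K) :
    ∃ x < K ^ m, ∀ j < m, digit K x j = f j := by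
  let g : Fin m → Fin K := fun j => ⟨f j, hf j j.2⟩
  refine ⟨finFunctionFinEquiv g, (finFunctionFinEquiv g).2, fun j hj => ?_⟩
  have := congrArg Fin.val (congrFun (finFunctionFinEquiv.symm_apply_apply g) ⟨j, hj⟩)
  exact this

theorem digit_injOn {K m x y : ℕ} (hx : x < K ^ m) (hy : y < K ^ m)
    (h : ∀ j < m, digit K x j = digit K y j) : x = y := by
  have : finFunctionFinEquiv.symm (⟨x, hx⟩ : Fin (K ^ m)) = finFunctionFinEquiv.symm ⟨y, hy⟩ := by
    ext j
    exact h j j.2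
  exact congrArg Fin.val (finFunctionFinEquiv.symm.injective this)

/-! ### Computable combinations of finitely many points -/

section Grid

variable {X : Type u} [MetricSpace X] (r : ℕ → X)

/-- `T` is an admissible table for the grid with mesh `2⁻ᴺ` in the cube of dimension `n + 1`: it
assigns to the grid point with code `x` the point `r (T x)`. Neighbouring grid points have images
at distance less than `C n * (2 / 3) ^ N`. The image of a grid point whose `j`-th coordinate is `1`
is not further from `r j`, up to an error of `2⁻ⁿ`, than some `r b` such that the `b`-th coordinate
is positive. Implications are written as disjunctions, which makes it evident that the property is
semidecidable. -/
structure GridTable (C : ℕ → ℕ) (n N : ℕ) (T : List ℕ) : Prop where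
  edge : ∀ x < (2 ^ N + 1) ^ (n + 1), ∀ y < (2 ^ N + 1) ^ (n + 1), ∀ j < n + 1,
    digit (2 ^ N + 1) y j ≠ digit (2 ^ N + 1) x j + 1 ∨
      (∃ i < n + 1, i ≠ j ∧ digit (2 ^ N + 1) y i ≠ digit (2 ^ N + 1) x i) ∨
        dist (r (T.getD x 0)) (r (T.getD y 0)) < C n * (2 / 3 : ℝ) ^ N
  near : ∀ x < (2 ^ N + 1) ^ (n + 1), ∀ j < n + 1, digit (2 ^ N + 1) x j ≠ 2 ^ N ∨
    ∃ b < n + 1, digit (2 ^ N + 1) x b ≠ 0 ∧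
      dist (r (T.getD x 0)) (r j) < dist (r j) (r b) + (1 / 2 : ℝ) ^ n

/-- The table `T'` for mesh `2⁻ᴺ⁻¹` is a small modification of the table `T` for mesh `2⁻ᴺ`. -/
def GridRefine (C : ℕ → ℕ) (n N : ℕ) (T T' : List ℕ) : Prop :=
  ∀ x < (2 ^ N + 1) ^ (n + 1), ∀ y < (2 ^ (N + 1) + 1) ^ (n + 1),
    (∃ j < n + 1, digit (2 ^ N + 1) x j ≠ digit (2 ^ (N + 1) + 1) y j / 2) ∨
      dist (r (T'.getD y 0)) (r (T.getD x 0)) < (n + 1 : ℕ) * (C n * (2 / 3 : ℝ) ^ N)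

variable {r} {C : ℕ → ℕ}

theorem GridTable.dist_le {n N : ℕ} {T : List ℕ} (hT : GridTable r C n N T) {x y : ℕ}
    (hx : x < (2 ^ N + 1) ^ (n + 1)) (hy : y < (2 ^ N + 1) ^ (n + 1))
    (h : ∀ j < n + 1, digit (2 ^ N + 1) x j ≤ digit (2 ^ N + 1) y j + 1 ∧
      digit (2 ^ N + 1) y j ≤ digit (2 ^ N + 1) x j + 1) :
    dist (r (T.getD x 0)) (r (T.getD y 0)) ≤ (n + 1 : ℕ) * (C n * (2 / 3 : ℝ) ^ N) := by
  set K := 2 ^ N + 1 with hK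
  have hKpos : 0 < K := Nat.succ_pos _
  -- Replace the coordinates of `x` by those of `y` one after the other.
  have key : ∀ i ≤ n + 1, ∃ z < K ^ (n + 1), (∀ j < n + 1, digit K z j =
      if j < i then digit K y j else digit K x j) ∧
        dist (r (T.getD x 0)) (r (T.getD z 0)) ≤ i * (C n * (2 / 3 : ℝ) ^ N) := by
    intro i
    induction i with
    | zero => exact fun _ => ⟨x, hx, by simp, by simp⟩
    | succ i ih =>
      intro hi
      obtain ⟨z, hz, hzd, hzx⟩ := ih (by omega)
      obtain ⟨w, hw, hwd⟩ := exists_digit_eq K (n + 1)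
        (fun j => if j < i + 1 then digit K y j else digit K x j)
        (fun j _ => by split_ifs <;> exact digit_lt hKpos _ _)
      refine ⟨w, hw, hwd, ?_⟩
      have hother : ∀ k < n + 1, k ≠ i → digit K w k = digit K z k := by
        intro k hk hki
        rw [hwd k hk, hzd k hk]
        have : k < i + 1 ↔ k < i := by omega
        simp only [this]
      have hzi : digit K z i = digit K x i := by rw [hzd i hi]; simp
      have hwi : digit K w i = digit K y i := by rw [hwd i hi]; simp
      have hstep : dist (r (T.getD z 0)) (r (T.getD w 0)) ≤ C n * (2 / 3 : ℝ) ^ N := by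
        obtain ⟨h1, h2⟩ := h i hi
        rcases lt_trichotomy (digit K x i) (digit K y i) with hlt | heq | hlt
        · rcases hT.edge z hz w hw i hi with h' | ⟨k, hk, hki, h'⟩ | h'
          · exact absurd (by rw [← hK, hzi, hwi]; omega) h'
          · exact absurd (hother k hk hki) h'
          · exact h'.le
        · have : z = w := digit_injOn hz hw fun k hk => by
            by_cases hki : k = i
            · subst hki; rw [hzi, hwi, heq]
            · exact (hother k hk hki).symm
          rw [this, dist_self]
          positivity
        · rcases hT.edge w hw z hz i hi with h' | ⟨k, hk, hki, h'⟩ | h'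
          · exact absurd (by rw [← hK, hzi, hwi]; omega) h'
          · exact absurd (hother k hk hki).symm h'
          · rw [dist_comm]; exact h'.le
      calc _ ≤ _ := dist_triangle _ _ _
        _ ≤ _ := add_le_add hzx hstep
        _ = _ := by push_cast; ring
  obtain ⟨z, hz, hzd, h'⟩ := key (n + 1) le_rfl
  have : z = y := digit_injOn hz hy fun j hj => by rw [hzd j hj, if_pos hj]
  rwa [this] at h'

/-- Every admissible table can be refined: the new value at a grid point `p` is close to the
midpoint of the old values at `⌊p / 2⌋` and `⌈p / 2⌉`. A step in one coordinate moves only one of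
these two points, and that by one step, so that the distances between neighbours are halved up to
an arbitrarily small error. -/
theorem GridTable.exists_refine (hr : DenseRange r) (hmid : HasMidpoints X) {n N : ℕ}
    {T : List ℕ} (hC : 0 < C n) (hT : GridTable r C n N T) :
    ∃ T', GridTable r C n (N + 1) T' ∧ GridRefine r C n N T T' := by
  set K := 2 ^ N + 1 with hK
  set K' := 2 ^ (N + 1) + 1 with hK'
  have hKpos : 0 < K := Nat.succ_pos _
  have hK'pos : 0 < K' := Nat.succ_pos _
  have hKK : K' = 2 * 2 ^ N + 1 := by rw [hK', pow_succ]; ring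
  -- The points `r j` are added to the family of the values of `T`.
  set M := K ^ (n + 1) with hM
  let u : ℕ → X := fun x => if x < M then r (T.getD x 0) else r (x - M)
  have hu : ∀ x < M, u x = r (T.getD x 0) := fun x hx => if_pos hx
  have hu' : ∀ j, u (M + j) = r j := fun j => by simp [u]
  obtain ⟨mid, hmid1, hmid2, hmid3⟩ : ∃ mid : ℕ → ℕ → X, (∀ a < M + (n + 1), mid a a = u a) ∧
      (∀ a < M, ∀ b < M + (n + 1), mid a b = mid b a) ∧
        ∀ a < M + (n + 1), ∀ b < M + (n + 1), ∀ c < M + (n + 1),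
          dist (mid a b) (mid a c) ≤ dist (u b) (u c) / 2 := by
    obtain ⟨mid, h1, h2, h3⟩ := hmid (M + (n + 1)) u
    exact ⟨mid, h1, fun a ha => h2 a (ha.trans_le (Nat.le_add_right _ _)), h3⟩
  have hfl : ∀ y, ∃ x < M, ∀ j < n + 1, digit K x j = digit K' y j / 2 := fun y =>
    exists_digit_eq K (n + 1) _ fun j _ => by have := digit_lt hK'pos y j; omega
  have hce : ∀ y, ∃ x < M, ∀ j < n + 1, digit K x j = (digit K' y j + 1) / 2 := fun y =>
    exists_digit_eq K (n + 1) _ fun j _ => by have := digit_lt hK'pos y j; omega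
  choose fl hfl_lt hfl using hfl
  choose ce hce_lt hce using hce
  have hfl_lt' : ∀ y, fl y < M + (n + 1) := fun y => (hfl_lt y).trans_le (Nat.le_add_right _ _)
  have hce_lt' : ∀ y, ce y < M + (n + 1) := fun y => (hce_lt y).trans_le (Nat.le_add_right _ _)
  set A : ℝ := C n * (2 / 3 : ℝ) ^ N with hA
  have hApos : 0 < A := by positivity
  let z : ℕ → X := fun y => mid (fl y) (ce y)
  -- Neighbours in direction `j` have the same lower neighbour in the coarse grid if the smaller of
  -- the two `j`-th coordinates is even, and the same upper neighbour if it is odd.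
  have hz_edge : ∀ x y, ∀ j < n + 1, digit K' y j = digit K' x j + 1 →
      (∀ i < n + 1, i ≠ j → digit K' y i = digit K' x i) → dist (z x) (z y) ≤ A / 2 := by
    intro x y j hj hyx hother
    rcases Nat.even_or_odd' (digit K' x j) with ⟨d, hd | hd⟩
    · have h1 : fl y = fl x := digit_injOn (hfl_lt _) (hfl_lt _) fun i hi => by
        rw [hfl y i hi, hfl x i hi]
        by_cases hij : i = j
        · subst hij; omega
        · rw [hother i hi hij]
      have h2 := hmid3 (fl x) (hfl_lt' x) (ce x) (hce_lt' x) (ce y) (hce_lt' y)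
      rw [hu _ (hce_lt x), hu _ (hce_lt y)] at h2
      simp only [z]
      rw [h1]
      refine h2.trans ?_
      rcases hT.edge (ce x) (hce_lt x) (ce y) (hce_lt y) j hj with h' | ⟨i, hi, hij, h'⟩ | h'
      · rw [← hK, hce y j hj, hce x j hj] at h'
        omega
      · rw [← hK, hce y i hi, hce x i hi, hother i hi hij] at h'
        exact absurd rfl h'
      · linarith
    · have h1 : ce y = ce x := digit_injOn (hce_lt _) (hce_lt _) fun i hi => by
        rw [hce y i hi, hce x i hi]
        by_cases hij : i = j
        · subst hij; omega
        · rw [hother i hi hij]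
      have h2 := hmid3 (ce x) (hce_lt' x) (fl x) (hfl_lt' x) (fl y) (hfl_lt' y)
      rw [hu _ (hfl_lt x), hu _ (hfl_lt y)] at h2
      simp only [z]
      rw [h1, hmid2 (fl x) (hfl_lt x) (ce x) (hce_lt' x),
        hmid2 (fl y) (hfl_lt y) (ce x) (hce_lt' x)]
      refine h2.trans ?_
      rcases hT.edge (fl x) (hfl_lt x) (fl y) (hfl_lt y) j hj with h' | ⟨i, hi, hij, h'⟩ | h'
      · rw [← hK, hfl y j hj, hfl x j hj] at h'
        omega
      · rw [← hK, hfl y i hi, hfl x i hi, hother i hi hij] at h'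
        exact absurd rfl h'
      · linarith
  have hz_fl : ∀ y, dist (z y) (r (T.getD (fl y) 0)) ≤ (n + 1 : ℕ) * A / 2 := by
    intro y
    have h1 := hmid3 (fl y) (hfl_lt' y) (ce y) (hce_lt' y) (fl y) (hfl_lt' y)
    rw [hmid1 _ (hfl_lt' y), hu _ (hfl_lt y), hu _ (hce_lt y)] at h1
    refine h1.trans ?_
    have := hT.dist_le (hce_lt y) (hfl_lt y) fun j hj => by
      rw [← hK, hfl y j hj, hce y j hj]; omega
    linarith
  have hz_near : ∀ y < K' ^ (n + 1), ∀ j < n + 1, digit K' y j = 2 ^ (N + 1) →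
      ∃ b < n + 1, digit K' y b ≠ 0 ∧ dist (z y) (r j) < dist (r j) (r b) + (1 / 2 : ℝ) ^ n := by
    intro y hy j hj hyj
    rw [pow_succ] at hyj
    have h1 : digit K (fl y) j = 2 ^ N := by rw [hfl y j hj]; omega
    have h2 : digit K (ce y) j = 2 ^ N := by rw [hce y j hj]; omega
    have hfar : ∀ x < M, digit K x j = 2 ^ N →
        (∀ b < n + 1, digit K x b ≠ 0 → digit K' y b ≠ 0) →
        ∃ b < n + 1, digit K' y b ≠ 0 ∧ dist (u x) (r j) < dist (r j) (r b) + (1 / 2 : ℝ) ^ n := by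
      intro x hx hxj hsub
      rcases hT.near x hx j hj with h | ⟨b, hb, hxb, h⟩
      · exact absurd hxj h
      · exact ⟨b, hb, hsub b hb hxb, by rwa [hu x hx]⟩
    obtain ⟨b, hb, hyb, hbd⟩ := hfar (fl y) (hfl_lt y) h1 fun b hb => by rw [hfl y b hb]; omega
    obtain ⟨c, hc, hyc, hcd⟩ := hfar (ce y) (hce_lt y) h2 fun b hb => by rw [hce y b hb]; omega
    have hMj : M + j < M + (n + 1) := by omega
    have h3 := hmid3 (fl y) (hfl_lt' y) (ce y) (hce_lt' y) (M + j) hMj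
    have h4 := hmid3 (M + j) hMj (fl y) (hfl_lt' y) (M + j) hMj
    rw [← hmid2 (fl y) (hfl_lt y) (M + j) hMj, hmid1 _ hMj] at h4
    rw [hu'] at h3 h4
    have h5 := dist_triangle (z y) (mid (fl y) (M + j)) (r j)
    rcases le_total (dist (r j) (r b)) (dist (r j) (r c)) with h | h
    · exact ⟨c, hc, hyc, by linarith⟩
    · exact ⟨b, hb, hyb, by linarith⟩
  -- The midpoints are replaced by sufficiently close points of the dense sequence.
  have happrox : ∀ y, ∃ k, dist (r k) (z y) < A / 24 ∧ (y < K' ^ (n + 1) → ∀ j < n + 1,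
      digit K' y j = 2 ^ (N + 1) → ∃ b < n + 1, digit K' y b ≠ 0 ∧
        dist (r k) (r j) < dist (r j) (r b) + (1 / 2 : ℝ) ^ n) := by
    intro y
    have h1 : ∀ᶠ w in 𝓝 (z y), dist w (z y) < A / 24 :=
      Metric.eventually_nhds_iff.2 ⟨A / 24, by positivity, fun w hw => hw⟩
    have h2 : ∀ᶠ w in 𝓝 (z y), ∀ j ∈ Finset.range (n + 1), y < K' ^ (n + 1) →
        digit K' y j = 2 ^ (N + 1) → ∃ b < n + 1, digit K' y b ≠ 0 ∧
          dist w (r j) < dist (r j) (r b) + (1 / 2 : ℝ) ^ n := by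
      rw [eventually_all_finset]
      intro j hj
      by_cases hy : y < K' ^ (n + 1) ∧ digit K' y j = 2 ^ (N + 1)
      · obtain ⟨b, hb, hyb, hlt⟩ := hz_near y hy.1 j (Finset.mem_range.1 hj) hy.2
        have : ∀ᶠ w in 𝓝 (z y), dist w (r j) < dist (r j) (r b) + (1 / 2 : ℝ) ^ n :=
          (continuous_id.dist continuous_const).tendsto (z y) |>.eventually_lt_const hlt
        exact this.mono fun w hw _ _ => ⟨b, hb, hyb, hw⟩
      · exact Eventually.of_forall fun w h3 h4 => absurd ⟨h3, h4⟩ hy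
    obtain ⟨k, hk1, hk2⟩ := hr.exists_mem_open isOpen_interior
      ⟨z y, mem_interior_iff_mem_nhds.2 (h1.and h2)⟩ |>.imp fun k hk => interior_subset hk
    exact ⟨k, hk1, fun hy j hj => hk2 j (Finset.mem_range.2 hj) hy⟩
  choose g hg1 hg2 using happrox
  have hget : ∀ y < K' ^ (n + 1), ((List.range (K' ^ (n + 1))).map g).getD y 0 = g y := by
    intro y hy
    simp [List.getD_eq_getElem?_getD, hy]
  refine ⟨(List.range (K' ^ (n + 1))).map g, ⟨fun x hx y hy j hj => ?_, fun x hx j hj => ?_⟩,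
    fun x hx y hy => ?_⟩
  · by_cases h1 : digit K' y j = digit K' x j + 1
    · by_cases h2 : ∀ i < n + 1, i ≠ j → digit K' y i = digit K' x i
      · right; right
        rw [hget x hx, hget y hy]
        have h3 := hz_edge x y j hj h1 h2
        have h4 := dist_triangle4 (r (g x)) (z x) (z y) (r (g y))
        have h5 := hg1 x
        have h6 := hg1 y
        rw [dist_comm] at h6
        have h7 : C n * (2 / 3 : ℝ) ^ (N + 1) = 2 / 3 * A := by rw [hA]; ring
        rw [h7]
        linarith
      · right; left
        push Not at h2
        exact h2
    · exact Or.inl h1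
  · rw [hget x hx, ← imp_iff_not_or]
    exact hg2 x hx j hj
  · by_cases h : ∀ j < n + 1, digit K x j = digit K' y j / 2
    · right
      have hxy : x = fl y := digit_injOn hx (hfl_lt y) fun j hj => by rw [h j hj, hfl y j hj]
      rw [hget y hy, hxy]
      have h1 := hz_fl y
      have h2 := dist_triangle (r (g y)) (z y) (r (T.getD (fl y) 0))
      have h3 := hg1 y
      have h4 : A ≤ (n + 1 : ℕ) * A := le_mul_of_one_le_left hApos.le (by simp)
      linarith
    · left
      push Not at h
      exact h

end Grid

section GridComputable

variable {X : Type u} [MetricSpace X] {r : ℕ → X} {C : ℕ → ℕ}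

theorem IsEffectiveEnum.compReal_dist (hr : IsEffectiveEnum r) {ι : Type} [Primcodable ι]
    {D : Type*} {nm : D → ℕ → ℕ} {a b : ι → ℕ} (ha : Computable a) (hb : Computable b) :
    CompReal nm fun i _ => dist (r (a i)) (r (b i)) :=
  (hr.2.compReal (nm := nm)).comp (g := fun i => (a i, b i)) (by fun_prop)

theorem compReal_gridBound (hC : Computable C) {ι : Type} [Primcodable ι]
    {D : Type*} {nm : D → ℕ → ℕ} {n N : ι → ℕ} (hn : Computable n) (hN : Computable N) :
    CompReal nm fun i _ => C (n i) * (2 / 3 : ℝ) ^ N i := by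
  refine (CompReal.rat (q := fun i => (C (n i) * 2 ^ N i, 0, 3 ^ N i - 1)) (by fun_prop)).of_eq
    fun i _ => ?_
  simp only [ratVal]
  rw [Nat.cast_sub (Nat.one_le_pow _ _ (by norm_num))]
  push_cast
  rw [div_pow]
  ring

theorem GridTable.semi (hr : IsEffectiveEnum r) (hC : Computable C) {ι : Type} [Primcodable ι]
    {D : Type*} {nm : D → ℕ → ℕ} {n N : ι → ℕ} {T : ι → List ℕ} (hn : Computable n)
    (hN : Computable N) (hT : Computable T) :
    Semi nm fun i _ => GridTable r C (n i) (N i) (T i) := by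
  refine Semi.of_iff (P := fun i (_ : D) =>
    (∀ x < (2 ^ N i + 1) ^ (n i + 1), ∀ y < (2 ^ N i + 1) ^ (n i + 1), ∀ j < n i + 1,
      digit (2 ^ N i + 1) y j ≠ digit (2 ^ N i + 1) x j + 1 ∨
        (∃ l < n i + 1, l ≠ j ∧ digit (2 ^ N i + 1) y l ≠ digit (2 ^ N i + 1) x l) ∨
          dist (r ((T i).getD x 0)) (r ((T i).getD y 0)) < C (n i) * (2 / 3 : ℝ) ^ N i) ∧
    (∀ x < (2 ^ N i + 1) ^ (n i + 1), ∀ j < n i + 1, digit (2 ^ N i + 1) x j ≠ 2 ^ N i ∨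
      ∃ b < n i + 1, digit (2 ^ N i + 1) x b ≠ 0 ∧
        dist (r ((T i).getD x 0)) (r j) < dist (r j) (r b) + (1 / 2 : ℝ) ^ n i)) ?_
    fun i _ => ⟨fun h => ⟨h.1, h.2⟩, fun h => ⟨h.1, h.2⟩⟩
  refine Semi.and ?_ ?_
  · refine Semi.all_lt (Semi.all_lt (Semi.all_lt (Semi.or (Semi.ne ?_ ?_)
      (Semi.or (Semi.ex_lt (Semi.and (Semi.ne ?_ ?_) (Semi.ne ?_ ?_)) ?_)
        ((hr.compReal_dist ?_ ?_).lt (compReal_gridBound hC ?_ ?_)))) ?_) ?_) ?_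
    all_goals fun_prop
  · refine Semi.all_lt (Semi.all_lt (Semi.or (Semi.ne ?_ ?_) (Semi.ex_lt (Semi.and (Semi.ne ?_ ?_)
      ((hr.compReal_dist ?_ ?_).lt ((hr.compReal_dist ?_ ?_).add (CompReal.half_pow ?_)))) ?_))
      ?_) ?_
    all_goals fun_prop

theorem GridRefine.semi (hr : IsEffectiveEnum r) (hC : Computable C) {ι : Type} [Primcodable ι]
    {D : Type*} {nm : D → ℕ → ℕ} {n N : ι → ℕ} {T T' : ι → List ℕ} (hn : Computable n)
    (hN : Computable N) (hT : Computable T) (hT' : Computable T') :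
    Semi nm fun i _ => GridRefine r C (n i) (N i) (T i) (T' i) := by
  have hb : ∀ {κ : Type} [Primcodable κ] {n N : κ → ℕ}, Computable n → Computable N →
      CompReal nm fun (i : κ) (_ : D) => ((n i + 1 : ℕ) : ℝ) * (C (n i) * (2 / 3 : ℝ) ^ N i) := by
    intro κ _ n N hn hN
    refine (compReal_gridBound (C := fun x => (x.unpair.1 + 1) * C x.unpair.2) (n := fun i =>
      Nat.pair (n i) (n i)) (N := N) (by fun_prop) (by fun_prop) hN).of_eq fun i _ => ?_
    simp only [Nat.unpair_pair]
    push_cast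
    ring
  unfold GridRefine
  refine Semi.all_lt (Semi.all_lt (Semi.or (Semi.ex_lt (Semi.ne ?_ ?_) ?_)
    ((hr.compReal_dist ?_ ?_).lt (hb ?_ ?_))) ?_) ?_
  all_goals fun_prop

/-- The vertices of the cube are the subsets of `{0, …, n}`; a nonempty set is sent to one of the
points `r b` with `b` in the set. -/
theorem GridTable.exists_initial {n : ℕ} (hC : ∀ a < n + 1, ∀ b < n + 1, dist (r a) (r b) < C n) :
    ∃ T, GridTable r C n 0 T := by
  classical
  have h : ∀ x, ∃ b < n + 1, ∀ j < n + 1, digit 2 x j ≠ 0 → digit 2 x b ≠ 0 := by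
    intro x
    by_cases hx : ∃ b < n + 1, digit 2 x b ≠ 0
    · obtain ⟨b, hb, hxb⟩ := hx
      exact ⟨b, hb, fun _ _ _ => hxb⟩
    · push Not at hx
      exact ⟨0, by omega, fun j hj h => absurd (hx j hj) h⟩
  choose g hg hg' using h
  have hget : ∀ y < 2 ^ (n + 1), ((List.range (2 ^ (n + 1))).map g).getD y 0 = g y := by
    intro y hy
    simp [List.getD_eq_getElem?_getD, hy]
  refine ⟨(List.range (2 ^ (n + 1))).map g, ⟨fun x hx y hy j hj => ?_, fun x hx j hj => ?_⟩⟩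
  · right; right
    rw [hget x (by simpa using hx), hget y (by simpa using hy), pow_zero, mul_one]
    exact hC _ (hg x) _ (hg y)
  · rw [← imp_iff_not_or]
    intro hxj
    simp only [pow_zero, Nat.reduceAdd] at hx hxj ⊢
    refine ⟨g x, hg x, hg' x j hj (by omega), ?_⟩
    rw [hget x hx, dist_comm]
    linarith [show (0 : ℝ) < (1 / 2) ^ n by positivity]

/-- Tables for the cubes of all dimensions can be found computably, since the search for a table
that refines the previous one succeeds. -/
theorem exists_gridTables (hr : IsEffectiveEnum r) (hmid : HasMidpoints X) :
    ∃ (C : ℕ → ℕ) (T : ℕ → ℕ → List ℕ), Computable C ∧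
      Computable (fun x : ℕ × ℕ => T x.1 x.2) ∧
        ∀ n N, GridTable r C n N (T n N) ∧ GridRefine r C n N (T n N) (T n (N + 1)) := by
  obtain ⟨C, hC, hCr⟩ := Semi.exists_computable (ι := ℕ) (κ := ℕ)
    (P := fun n c => 0 < c ∧ ∀ a < n + 1, ∀ b < n + 1, dist (r a) (r b) < (c : ℝ))
    (Semi.and (Semi.natLt (by fun_prop) (by fun_prop)) (Semi.all_lt (Semi.all_lt
      ((hr.compReal_dist (by fun_prop) (by fun_prop)).lt (CompReal.nat (by fun_prop)))
      (by fun_prop)) (by fun_prop)))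
    (by
      intro n
      obtain ⟨c, hc⟩ := ((Finset.range (n + 1) ×ˢ Finset.range (n + 1)).image
        fun x => dist (r x.1) (r x.2)).bddAbove
      obtain ⟨k, hk⟩ := exists_nat_gt c
      refine ⟨k + 1, Nat.succ_pos _, fun a ha b hb => ?_⟩
      have := hc (Finset.mem_coe.2 (Finset.mem_image.2 ⟨(a, b), by simp [ha, hb], rfl⟩))
      push_cast
      simp only at this
      linarith)
  obtain ⟨T₀, hT₀, hT₀r⟩ := Semi.exists_computable (ι := ℕ) (κ := List ℕ)
    (P := fun n T => GridTable r C n 0 T)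
    (GridTable.semi hr hC (by fun_prop) (by fun_prop) (by fun_prop))
    fun n => GridTable.exists_initial (hCr n).2
  obtain ⟨T, hT, -, hT'⟩ := Semi.exists_chain (ι := ℕ) (κ := List ℕ)
    (E := fun n N T T' => GridTable r C n (N + 1) T' ∧ GridRefine r C n N T T')
    (V := fun n N T => GridTable r C n N T)
    (Semi.and (GridTable.semi hr hC (by fun_prop) (by fun_prop) (by fun_prop))
      (GridRefine.semi hr hC (by fun_prop) (by fun_prop) (by fun_prop) (by fun_prop)))
    hT₀ hT₀r (fun n N T hT => hT.exists_refine hr.1 hmid (hCr n).1) fun _ _ _ _ _ h => h.1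
  exact ⟨C, T, hC, hT, fun n N => ⟨(hT' n N).1, (hT' n N).2.2⟩⟩

/-- Combination maps for the points `r 0, r 1, …`: the continuous map `c n` sends systems of weights
in `[0, 1]` to points of `X`. If `μ j = 1`, then `c n μ` is not much further from `r j` than the
farthest of the points `r b` with `b ≤ n` and positive weight; hence it is close to `r j` if all
these points are. Moreover, a name of `c n μ` can be computed from data that allow to compute the
weights. The value `c n μ` is the limit of the values of the tables at grid points near `μ`. -/
theorem exists_combination [CompleteSpace X] (hr : IsEffectiveEnum r) (hmid : HasMidpoints X) :
    ∃ c : ℕ → C(ℕ → unitInterval, X),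
      (∀ n μ, ∀ j ≤ n, μ j = 1 → ∃ b ≤ n, 0 < μ b ∧
        dist (c n μ) (r j) ≤ dist (r j) (r b) + (1 / 2 : ℝ) ^ n) ∧
      ∀ (ι : Type) [Primcodable ι] (D : Type u) (nm : D → ℕ → ℕ) (n : ι → ℕ)
        (μ : ι → D → ℕ → unitInterval), Computable n →
        CompReal nm (fun (x : ι × ℕ) d => (μ x.1 d x.2 : ℝ)) →
        ∃ α : ι → ℕ → ℕ, Computable (fun x : ι × ℕ => α x.1 x.2) ∧ ∀ i d, ∃ q,
          AssocApp (α i) (nm d) q ∧ ∀ k, dist (r (q k)) (c (n i) (μ i d)) ≤ (1 / 2 : ℝ) ^ k := by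
  obtain ⟨C, T, hC, hT, hCT⟩ := exists_gridTables hr hmid
  -- The grid point next to `μ` towards the origin.
  let fl : ℕ → (ℕ → unitInterval) → ℕ → ℕ := fun N μ j => ⌊2 ^ N * (μ j : ℝ)⌋₊
  have hfl_lt : ∀ N μ j, fl N μ j < 2 ^ N + 1 := by
    intro N μ j
    have : (2 : ℝ) ^ N * (μ j : ℝ) ≤ (2 ^ N : ℕ) := by
      push_cast
      exact mul_le_of_le_one_right (by positivity) (μ j).2.2
    exact Nat.lt_succ_of_le (Nat.floor_le_of_le this)
  have hfl_le : ∀ N μ j, (fl N μ j : ℝ) ≤ 2 ^ N * (μ j : ℝ) := fun N μ j =>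
    Nat.floor_le (mul_nonneg (by positivity) (μ j).2.1)
  have hlt_fl : ∀ N μ j, 2 ^ N * (μ j : ℝ) < fl N μ j + 1 := fun N μ j => Nat.lt_floor_add_one _
  have hx : ∀ n N μ, ∃ x < (2 ^ N + 1) ^ (n + 1), ∀ j < n + 1,
      digit (2 ^ N + 1) x j = fl N μ j := fun n N μ => exists_digit_eq _ _ _ fun j _ => hfl_lt N μ j
  choose x hx_lt hx using hx
  let s : ℕ → (ℕ → unitInterval) → ℕ → X := fun n μ N => r ((T n N).getD (x n N μ) 0)
  let B : ℕ → ℕ → ℝ := fun n N => (n + 1 : ℕ) * (C n * (2 / 3 : ℝ) ^ N)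
  have hB0 : ∀ n N, 0 ≤ B n N := fun n N => by positivity
  have hs : ∀ n μ N, dist (s n μ N) (s n μ (N + 1)) ≤ ((n + 1 : ℕ) * C n) * (2 / 3 : ℝ) ^ N := by
    intro n μ N
    rcases (hCT n N).2 (x n N μ) (hx_lt n N μ) (x n (N + 1) μ) (hx_lt n (N + 1) μ) with
      ⟨j, hj, h⟩ | h
    · refine absurd ?_ h
      rw [hx n N μ j hj, hx n (N + 1) μ j hj]
      simp only [fl]
      rw [← Nat.floor_div_natCast]
      congr 1
      push_cast
      rw [pow_succ]
      ring
    · rw [dist_comm, mul_assoc]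
      exact h.le
  have hlim : ∀ n μ, ∃ a, Tendsto (s n μ) atTop (𝓝 a) := fun n μ =>
    cauchySeq_tendsto_of_complete (cauchySeq_of_le_geometric _ _ (by norm_num) (hs n μ))
  choose c hc using hlim
  have hsc : ∀ n μ N, dist (s n μ N) (c n μ) ≤ 3 * B n N := by
    intro n μ N
    have := dist_le_of_le_geometric_of_tendsto _ _ (by norm_num) (hs n μ) (hc n μ) N
    refine this.trans (le_of_eq ?_)
    simp only [B]
    ring
  have happrox : ∀ n N μ, ∀ y < (2 ^ N + 1) ^ (n + 1),
      (∀ j < n + 1, digit (2 ^ N + 1) y j ≤ fl N μ j + 1 ∧ fl N μ j ≤ digit (2 ^ N + 1) y j + 1) →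
      dist (r ((T n N).getD y 0)) (c n μ) ≤ 4 * B n N := by
    intro n N μ y hy h
    have h1 := (hCT n N).1.dist_le hy (hx_lt n N μ) fun j hj => by rw [hx n N μ j hj]; exact h j hj
    have h2 := dist_triangle (r ((T n N).getD y 0)) (s n μ N) (c n μ)
    have h3 := hsc n μ N
    have h4 : dist (r ((T n N).getD y 0)) (s n μ N) ≤ B n N := h1
    linarith
  have hBlim : ∀ n, Tendsto (B n) atTop (𝓝 0) := by
    intro n
    have := ((tendsto_pow_atTop_nhds_zero_of_lt_one (r := (2 / 3 : ℝ)) (by norm_num)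
      (by norm_num)).const_mul (C n : ℝ)).const_mul ((n + 1 : ℕ) : ℝ)
    simpa [B] using this
  have hcont : ∀ n, Continuous (c n) := by
    intro n
    rw [continuous_iff_continuousAt]
    intro μ
    rw [ContinuousAt, Metric.tendsto_nhds]
    intro ε hε
    obtain ⟨N, hN⟩ := ((hBlim n).eventually_lt_const (show 0 < ε / 8 by positivity)).exists
    have hev : ∀ᶠ ν in 𝓝 μ, ∀ j ∈ Finset.range (n + 1), |(ν j : ℝ) - μ j| < 1 / 2 ^ N := by
      rw [eventually_all_finset]
      intro j _
      have : Continuous fun ν : ℕ → unitInterval => |(ν j : ℝ) - μ j| := by fun_prop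
      refine (this.tendsto μ).eventually_lt_const ?_
      simp
    filter_upwards [hev] with ν hν
    have h1 := happrox n N μ (x n N ν) (hx_lt n N ν) fun j hj => by
      rw [hx n N ν j hj]
      have h2 := hν j (Finset.mem_range.2 hj)
      rw [abs_lt, lt_div_iff₀ (by positivity), neg_lt, ← neg_sub (μ j : ℝ), neg_neg] at h2
      have h3 : ((μ j : ℝ) - ν j) * 2 ^ N < 1 := by
        have := h2.1
        rwa [lt_div_iff₀ (by positivity)] at this
      have h4 := h2.2
      have h5 := hfl_le N μ j
      have h6 := hlt_fl N μ j
      have h7 := hfl_le N ν j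
      have h8 := hlt_fl N ν j
      constructor
      · have : (fl N ν j : ℝ) < fl N μ j + 1 + 1 := by linarith
        have : fl N ν j < fl N μ j + 1 + 1 := by exact_mod_cast this
        omega
      · have : (fl N μ j : ℝ) < fl N ν j + 1 + 1 := by linarith
        have : fl N μ j < fl N ν j + 1 + 1 := by exact_mod_cast this
        omega
    have h2 := hsc n ν N
    have h3 := dist_triangle_left (c n ν) (c n μ) (s n ν N)
    have h4 : dist (s n ν N) (c n μ) ≤ 4 * B n N := h1
    linarith
  refine ⟨fun n => ⟨c n, hcont n⟩, ?_, ?_⟩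
  · intro n μ j hj hμj
    obtain ⟨b, hb, hmax⟩ := ((Finset.range (n + 1)).filter fun b => 0 < μ b).exists_max_image
      (fun b => dist (r j) (r b)) ⟨j, by simp [hμj]; omega⟩
    simp only [Finset.mem_filter, Finset.mem_range] at hb hmax
    refine ⟨b, by omega, hb.2, le_of_tendsto ((hc n μ).dist tendsto_const_nhds)
      (Eventually.of_forall fun N => ?_)⟩
    rcases (hCT n N).1.near (x n N μ) (hx_lt n N μ) j (by omega) with h | ⟨b', hb', h0, h⟩
    · refine absurd ?_ h
      rw [hx n N μ j (by omega)]
      simp only [fl, hμj]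
      have : (2 : ℝ) ^ N * ((1 : unitInterval) : ℝ) = (2 ^ N : ℕ) := by simp
      rw [this, Nat.floor_natCast]
    · refine h.le.trans (add_le_add (hmax b' ⟨hb', ?_⟩) le_rfl)
      rw [hx n N μ b' hb'] at h0
      rw [pos_iff_ne_zero]
      intro h1
      simp [fl, h1] at h0
  · intro ι _ D nm n μ hn hμ
    let R : ι → ℕ → ℕ → D → Prop := fun i k v d =>
      ∃ N, ∃ y < (2 ^ N + 1) ^ (n i + 1), (v = (T (n i) N).getD y 0 ∧
        ∀ j < n i + 1, ((digit (2 ^ N + 1) y j : ℕ) : ℝ) < 2 ^ N * (μ i d j : ℝ) + (1 : ℕ) ∧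
          2 ^ N * (μ i d j : ℝ) < ((digit (2 ^ N + 1) y j : ℕ) : ℝ) + (1 : ℕ)) ∧
        (((4 * (n i + 1) * C (n i) : ℕ)) : ℝ) * (2 / 3 : ℝ) ^ N < (1 / 2 : ℝ) ^ k
    have hR : Semi nm fun (x : ι × ℕ × ℕ) d => R x.1 x.2.1 x.2.2 d := by
      let g : (((ι × ℕ × ℕ) × ℕ) × ℕ) × ℕ → ι × ℕ := fun z => (z.1.1.1.1, z.2)
      have hg : Computable g := by fun_prop
      refine Semi.ex (Semi.ex_lt (Semi.and (Semi.and (Semi.eq ?_ ?_) (Semi.all_lt (Semi.and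
        ((CompReal.nat ?_).lt ((CompReal.two_pow_mul (hμ.comp (g := g) ?_)
          ?_).add (CompReal.nat ?_)))
        ((CompReal.two_pow_mul (hμ.comp (g := g) ?_) ?_).lt
          ((CompReal.nat ?_).add (CompReal.nat ?_)))) ?_))
        ((compReal_gridBound (C := fun x => x) Computable.id ?_ ?_).lt (CompReal.half_pow ?_))) ?_)
      all_goals fun_prop
    have htot : ∀ i k d, ∃ v, R i k v d := by
      intro i k d
      have hlim4 : Tendsto (fun N => (((4 * (n i + 1) * C (n i) : ℕ)) : ℝ) * (2 / 3 : ℝ) ^ N)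
          atTop (𝓝 0) := by
        have := (tendsto_pow_atTop_nhds_zero_of_lt_one (r := (2 / 3 : ℝ)) (by norm_num)
          (by norm_num)).const_mul (((4 * (n i + 1) * C (n i) : ℕ)) : ℝ)
        simpa using this
      obtain ⟨N, hN⟩ := (hlim4.eventually_lt_const
        (show (0 : ℝ) < (1 / 2) ^ k by positivity)).exists
      refine ⟨_, N, x (n i) N (μ i d), hx_lt _ _ _, ⟨rfl, fun j hj => ?_⟩, hN⟩
      rw [hx _ _ _ j hj]
      have h5 := hfl_le N (μ i d) j
      have h6 := hlt_fl N (μ i d) j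
      push_cast
      constructor <;> linarith
    obtain ⟨α, hα, hα'⟩ := Semi.exists_assoc hR htot
    refine ⟨α, hα, fun i d => ?_⟩
    obtain ⟨q, hq, hqR⟩ := hα' i d
    refine ⟨q, hq, fun k => ?_⟩
    obtain ⟨N, y, hy, ⟨hv, hdig⟩, hB⟩ := hqR k
    rw [hv]
    refine (happrox (n i) N (μ i d) y hy fun j hj => ?_).trans (le_of_lt ?_)
    · obtain ⟨h1, h2⟩ := hdig j hj
      have h5 := hfl_le N (μ i d) j
      have h6 := hlt_fl N (μ i d) j
      push_cast at h1 h2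
      constructor
      · have : (digit (2 ^ N + 1) y j : ℝ) < fl N (μ i d) j + 1 + 1 := by linarith
        have : digit (2 ^ N + 1) y j < fl N (μ i d) j + 1 + 1 := by exact_mod_cast this
        omega
      · have : (fl N (μ i d) j : ℝ) < digit (2 ^ N + 1) y j + 1 := by linarith
        have : fl N (μ i d) j < digit (2 ^ N + 1) y j + 1 := by exact_mod_cast this
        omega
    · refine lt_of_eq_of_lt ?_ hB
      simp only [B]
      push_cast
      ring

end GridComputable

/-! ### Approximate projections onto finitely many functionals -/

/-- The weight of the point `r i` in the fuzzy finite set that approximates `x` at stage `n`: it is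
`1` if `r i` is the closest to `x` among the points `r 0, …, r n`, and it is positive only if `r i`
is closest up to an error of `2⁻ⁿ`. -/
noncomputable def baseWeight {X : Type u} [MetricSpace X] (r : ℕ → X) (n i : ℕ) (x : X) :
    unitInterval :=
  (Finset.range (n + 1)).inf fun j =>
    Set.projIcc 0 1 zero_le_one (1 + 2 ^ n * (dist x (r j) - dist x (r i)))

section baseWeight

variable {X : Type u} [MetricSpace X] (r : ℕ → X)

theorem continuous_baseWeight (n i : ℕ) : Continuous (baseWeight r n i) := by
  unfold baseWeight
  refine Continuous.finset_inf_apply fun j _ => ?_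
  exact continuous_projIcc.comp (by fun_prop)

theorem exists_baseWeight_eq_one (n : ℕ) (x : X) : ∃ i < n + 1, baseWeight r n i x = 1 := by
  obtain ⟨i, hi, hmin⟩ :=
    (Finset.range (n + 1)).exists_min_image (fun j => dist x (r j)) ⟨0, by simp⟩
  refine ⟨i, Finset.mem_range.1 hi, ?_⟩
  have : ∀ j ∈ Finset.range (n + 1),
      Set.projIcc (0 : ℝ) 1 zero_le_one (1 + 2 ^ n * (dist x (r j) - dist x (r i))) = 1 := by
    intro j hj
    refine Set.projIcc_of_right_le _ ?_
    have := mul_nonneg (show (0 : ℝ) ≤ 2 ^ n by positivity) (sub_nonneg.2 (hmin j hj))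
    linarith
  rw [baseWeight, eq_top_iff.2 (Finset.le_inf fun j hj => (this j hj).ge)]
  rfl

theorem dist_lt_of_baseWeight_pos {n i : ℕ} {x : X} (h : 0 < baseWeight r n i x) {j : ℕ}
    (hj : j ≤ n) : dist x (r i) < dist x (r j) + (1 / 2) ^ n := by
  have h1 : 0 < Set.projIcc (0 : ℝ) 1 zero_le_one (1 + 2 ^ n * (dist x (r j) - dist x (r i))) :=
    h.trans_le (Finset.inf_le (Finset.mem_range.2 (Nat.lt_succ_of_le hj)))
  have h2 : 0 < 1 + 2 ^ n * (dist x (r j) - dist x (r i)) := by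
    by_contra hle
    rw [Set.projIcc_of_le_left _ (not_lt.1 hle)] at h1
    exact lt_irrefl _ h1
  have h3 : (2 : ℝ) ^ n * (1 / 2) ^ n = 1 := by rw [← mul_pow]; norm_num
  have h4 : (0 : ℝ) < 2 ^ n := by positivity
  by_contra hle
  have h5 := mul_le_mul_of_nonneg_left (not_lt.1 hle) h4.le
  nlinarith

theorem tendsto_of_baseWeight_pos (hr : DenseRange r) {x : ℕ → X} {a : X}
    (hx : Tendsto x atTop (𝓝 a)) {φ : ℕ → ℕ} (hφ : ∀ n, 0 < baseWeight r n (φ n) (x n)) :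
    Tendsto (fun n => r (φ n)) atTop (𝓝 a) := by
  rw [Metric.tendsto_atTop]
  intro ε hε
  obtain ⟨j, hj⟩ := hr.exists_dist_lt a (show 0 < ε / 4 by positivity)
  obtain ⟨n₁, hn₁⟩ := Metric.tendsto_atTop.1 hx (ε / 4) (by positivity)
  obtain ⟨n₂, hn₂⟩ := exists_pow_lt_of_lt_one (show 0 < ε / 4 by positivity)
    (show (1 / 2 : ℝ) < 1 by norm_num)
  refine ⟨max j (max n₁ n₂), fun n hn => ?_⟩
  have h1 := dist_lt_of_baseWeight_pos r (hφ n) ((le_max_left _ _).trans hn)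
  have h2 := hn₁ n ((le_max_left _ _).trans ((le_max_right _ _).trans hn))
  have h3 : (1 / 2 : ℝ) ^ n ≤ (1 / 2) ^ n₂ := pow_le_pow_of_le_one (by norm_num) (by norm_num)
    ((le_max_right _ _).trans ((le_max_right _ _).trans hn))
  have h4 := dist_triangle (x n) a (r j)
  have h5 := dist_triangle_left (r (φ n)) a (x n)
  linarith

end baseWeight

/-- The image of a fuzzy set `μ` of codes of functions and a fuzzy set `ω` of codes of arguments
under application: the weight of `b` is the supremum of `min (μ φ) (ω a)` over the codes `φ` and `a`
such that the function with code `φ` sends `a` to `b`. -/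
def applyWeights (N M : ℕ) (μ ω : ℕ → unitInterval) (b : ℕ) : unitInterval :=
  (Finset.range (M ^ N)).sup fun φ => (Finset.range N).sup fun a =>
    if digit M φ a = b then μ φ ⊓ ω a else 0

theorem Continuous.applyWeights {Z : Type*} [TopologicalSpace Z] {N M : ℕ}
    {μ ω : Z → ℕ → unitInterval}
    (hμ : Continuous μ) (hω : Continuous ω) :
    Continuous fun z => applyWeights N M (μ z) (ω z) := by
  refine continuous_pi fun b => ?_
  refine Continuous.finset_sup_apply fun φ _ => Continuous.finset_sup_apply fun a _ => ?_
  split_ifs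
  · exact ((continuous_apply φ).comp hμ).inf ((continuous_apply a).comp hω)
  · exact continuous_const

theorem applyWeights_eq_one {N M : ℕ} {μ ω : ℕ → unitInterval} {φ a : ℕ} (hφ : φ < M ^ N)
    (ha : a < N) (hμ : μ φ = 1) (hω : ω a = 1) : applyWeights N M μ ω (digit M φ a) = 1 := by
  refine le_antisymm le_top ?_
  refine le_trans ?_ (Finset.le_sup (f := fun φ' => (Finset.range N).sup fun a' =>
    if digit M φ' a' = digit M φ a then μ φ' ⊓ ω a' else 0) (Finset.mem_range.2 hφ))
  refine le_trans ?_ (Finset.le_sup (f := fun a' =>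
    if digit M φ a' = digit M φ a then μ φ ⊓ ω a' else 0) (Finset.mem_range.2 ha))
  simp [hμ, hω]

theorem exists_of_applyWeights_pos {N M : ℕ} {μ ω : ℕ → unitInterval} {b : ℕ}
    (h : 0 < applyWeights N M μ ω b) :
    ∃ φ < M ^ N, ∃ a < N, digit M φ a = b ∧ 0 < μ φ ∧ 0 < ω a := by
  obtain ⟨φ, hφ, h⟩ := Finset.lt_sup_iff.1 h
  obtain ⟨a, ha, h⟩ := Finset.lt_sup_iff.1 h
  split_ifs at h with hb
  · exact ⟨φ, Finset.mem_range.1 hφ, a, Finset.mem_range.1 ha, hb, lt_inf_iff.1 h⟩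
  · exact absurd h (lt_irrefl _)

/-- The fuzzy set with the single element `φ`. -/
def diracWeight (φ b : ℕ) : unitInterval := if b = φ then 1 else 0

/-- Finitely many elements of the space `S`, coded by numbers, together with the data of an
approximate projection onto them: continuous weights `weight φ : S → [0, 1]` of the codes, and a
continuous map `comb` that combines the coded elements with given weights to an element of `S`. -/
structure FuzzyProj (S : Type u) [TopologicalSpace S] where
  comb : (ℕ → unitInterval) → S
  weight : ℕ → S → unitInterval
  continuous_comb : Continuous comb
  continuous_weight : ∀ φ, Continuous (weight φ)

/-- A version of `Continuous.finset_inf_apply` with the topology on `Z` accessible to unification,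
for use with `seqTopology`, which is not an instance. -/
theorem continuous_finset_inf_range {Z : Type*} [TopologicalSpace Z] {N : ℕ}
    {g : ℕ → Z → unitInterval} (hg : ∀ a, Continuous (g a)) :
    Continuous fun z => (Finset.range N).inf fun a => g a z :=
  Continuous.finset_inf_apply fun a _ => hg a

section arr

variable {S T : Type u} [TopologicalSpace S] [TopologicalSpace T] (P : FuzzyProj S)
  (Q : FuzzyProj T) (N M : ℕ)

/-- The combination of coded functions from `S` to `T`; see `FuzzyProj.arr`. -/
def FuzzyProj.arrComb (μ : ℕ → unitInterval) : C(S, T) :=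
  ⟨fun x => Q.comb (applyWeights N M μ fun a => P.weight a x),
    Q.continuous_comb.comp (continuous_const.applyWeights
      (continuous_pi fun a => P.continuous_weight a))⟩

/-- The weights of codes of functions from `S` to `T`; see `FuzzyProj.arr`. -/
def FuzzyProj.arrWeight (φ : ℕ) (f : C(S, T)) : unitInterval :=
  (Finset.range N).inf fun a => Q.weight (digit M φ a) (f (P.comb (diracWeight a)))

theorem continuous_seqTopology_of_uncurry {Z : Type*} [TopologicalSpace Z] [SequentialSpace Z]
    {h : Z → C(S, T)} (hh : Continuous fun y : Z × S => h y.1 y.2) :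
    @Continuous _ _ _ (seqTopology S T) h := by
  refine continuous_seqTopology_of_seq fun z c hz x a hx => ?_
  exact (hh.tendsto (c, a)).comp (hz.prodMk_nhds hx)

theorem FuzzyProj.continuous_uncurry_arrComb :
    Continuous fun y : (ℕ → unitInterval) × S => P.arrComb Q N M y.1 y.2 := by
  have h1 : Continuous fun y : (ℕ → unitInterval) × S => fun a => P.weight a y.2 :=
    continuous_pi fun a => (P.continuous_weight a).comp continuous_snd
  exact Q.continuous_comb.comp (continuous_fst.applyWeights h1)

theorem FuzzyProj.continuous_arrComb :
    @Continuous (ℕ → unitInterval) C(S, T) _ (seqTopology S T) (P.arrComb Q N M) :=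
  continuous_seqTopology_of_uncurry (P.continuous_uncurry_arrComb Q N M)

theorem FuzzyProj.continuous_arrWeight (φ : ℕ) :
    @Continuous _ _ (seqTopology S T) _ (P.arrWeight Q N M φ) := by
  refine @continuous_finset_inf_range C(S, T) (seqTopology S T) N
    (fun a f => Q.weight (digit M φ a) (f (P.comb (diracWeight a)))) fun a => ?_
  exact @Continuous.comp _ _ _ (seqTopology S T) _ _ _ _ (Q.continuous_weight (digit M φ a))
    (continuous_eval_seqTopology (P.comb (diracWeight a)))

/-- Approximate projections for a space of functions. A number `φ < M ^ N` codes the function that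
sends the `a`-th code for `S` to the `digit M φ a`-th code for `T`. -/
def FuzzyProj.arr : @FuzzyProj C(S, T) (seqTopology S T) :=
  @FuzzyProj.mk C(S, T) (seqTopology S T) (P.arrComb Q N M) (P.arrWeight Q N M)
    (P.continuous_arrComb Q N M) (P.continuous_arrWeight Q N M)

end arr

namespace FType

variable {k : ℕ}

/-- The number of codes at stage `n`. -/
def size (n : ℕ) : FType k → ℕ
  | .var _ => n + 1
  | .arr σ τ => τ.size n ^ σ.size n

theorem size_pos (n : ℕ) : ∀ σ : FType k, 0 < σ.size n
  | .var _ => Nat.succ_pos n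
  | .arr _ τ => pow_pos (τ.size_pos n) _

theorem computable_size : ∀ σ : FType k, Computable fun n => σ.size n
  | .var _ => by simp only [size]; fun_prop
  | .arr σ τ => by
    have h1 := computable_size σ
    have h2 := computable_size τ
    simp only [size]
    fun_prop

variable {X : Fin k → Type u} [∀ i, MetricSpace (X i)] (r : ∀ i, ℕ → X i)
  (c : ∀ i, ℕ → C(ℕ → unitInterval, X i))

/-- The approximate projections at stage `n`, for all types. -/
noncomputable def proj (n : ℕ) : (σ : FType k) → FuzzyProj (σ.interp X)
  | .var i => (⟨c i n, baseWeight (r i) n, (c i n).continuous, continuous_baseWeight (r i) n⟩ :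
      FuzzyProj (X i))
  | .arr σ τ => (proj n σ).arr (proj n τ) (σ.size n) (τ.size n)

theorem weight_arr (n : ℕ) (σ τ : FType k) (φ : ℕ) (f : C(σ.interp X, τ.interp X)) :
    ((σ.arr τ).proj r c n).weight φ f = (Finset.range (σ.size n)).inf fun a =>
      (τ.proj r c n).weight (digit (τ.size n) φ a)
        (f ((σ.proj r c n).comb (diracWeight a))) := rfl

theorem exists_weight_eq_one (n : ℕ) : ∀ (σ : FType k) (x : σ.interp X),
    ∃ φ < σ.size n, (σ.proj r c n).weight φ x = 1
  | .var i, x => exists_baseWeight_eq_one (r i) n x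
  | .arr σ τ, (f : C(σ.interp X, τ.interp X)) => by
    choose b hb hb1 using fun a =>
      exists_weight_eq_one n τ (f ((σ.proj r c n).comb (diracWeight a)))
    obtain ⟨φ, hφ, hφb⟩ := exists_digit_eq (τ.size n) (σ.size n) b fun a _ => hb a
    refine ⟨φ, hφ, le_antisymm le_top ?_⟩
    rw [weight_arr]
    refine Finset.le_inf fun a ha => ?_
    rw [hφb a (Finset.mem_range.1 ha)]
    exact (hb1 a).ge

/-- `CodeConv σ φ x` says that the codes `φ n` at stage `n` converge to `x`, in a sense that does
not refer to the functionals given by the codes. -/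
def CodeConv : (σ : FType k) → (ℕ → ℕ) → σ.interp X → Prop
  | .var i, φ, (x : X i) => Tendsto (fun n => r i (φ n)) atTop (𝓝 x)
  | .arr σ τ, φ, (f : C(σ.interp X, τ.interp X)) =>
      ∀ (u : ℕ → σ.interp X) (a : σ.interp X), Tendsto u atTop (𝓝 a) →
      ∀ α : ℕ → ℕ, (∀ n, α n < σ.size n ∧ 0 < (σ.proj r c n).weight (α n) (u n)) →
        CodeConv τ (fun n => digit (τ.size n) (φ n) (α n)) (f a)

variable (hc : ∀ i n μ, ∀ j ≤ n, μ j = 1 → ∃ b ≤ n, 0 < μ b ∧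
  dist (c i n μ) (r i j) ≤ dist (r i j) (r i b) + (1 / 2 : ℝ) ^ n)

include hc in
/-- If every choice of codes of positive weight converges to `y`, so do the combinations. -/
theorem tendsto_comb : ∀ (σ : FType k) (μ : ℕ → ℕ → unitInterval) (y : σ.interp X),
    (∀ n, ∃ φ < σ.size n, μ n φ = 1) →
    (∀ φ : ℕ → ℕ, (∀ n, φ n < σ.size n ∧ 0 < μ n (φ n)) → CodeConv r c σ φ y) →
    Tendsto (fun n => (σ.proj r c n).comb (μ n)) atTop (𝓝 y)
  | .var i, μ, (y : X i), h1, h2 => by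
    choose j hj hμj using h1
    choose b hb hμb hd using fun n => hc i n (μ n) (j n) (Nat.le_of_lt_succ (hj n)) (hμj n)
    have hrj : Tendsto (fun n => r i (j n)) atTop (𝓝 y) :=
      h2 j fun n => ⟨hj n, by rw [hμj]; exact zero_lt_one⟩
    have hrb : Tendsto (fun n => r i (b n)) atTop (𝓝 y) :=
      h2 b fun n => ⟨Nat.lt_succ_of_le (hb n), hμb n⟩
    have h3 : Tendsto (fun n => dist (r i (j n)) (r i (b n)) + (1 / 2 : ℝ) ^ n) atTop (𝓝 0) := by
      have := (hrj.dist hrb).add (tendsto_pow_atTop_nhds_zero_of_lt_one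
        (r := (1 / 2 : ℝ)) (by norm_num) (by norm_num))
      simpa only [dist_self, add_zero] using this
    have h4 : Tendsto (fun n => dist (r i (j n)) (c i n (μ n))) atTop (𝓝 0) :=
      squeeze_zero (fun _ => dist_nonneg) (fun n => by rw [dist_comm]; exact hd n) h3
    exact (tendsto_iff_of_dist h4).1 hrj
  | .arr σ τ, μ, (g : C(σ.interp X, τ.interp X)), h1, h2 => by
    refine ContConv.tendsto fun u a hu => ?_
    refine tendsto_comb τ (fun n => applyWeights (σ.size n) (τ.size n) (μ n)
      fun b => (σ.proj r c n).weight b (u n)) (g a) (fun n => ?_) fun β hβ => ?_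
    · obtain ⟨φ, hφ, hμφ⟩ := h1 n
      obtain ⟨b, hb, hwb⟩ := exists_weight_eq_one r c n σ (u n)
      exact ⟨_, digit_lt (τ.size_pos n) φ b, applyWeights_eq_one hφ hb hμφ hwb⟩
    · choose φ hφ α hα hβφ hμφ hwα using fun n => exists_of_applyWeights_pos (hβ n).2
      have : β = fun n => digit (τ.size n) (φ n) (α n) := funext fun n => (hβφ n).symm
      rw [this]
      exact h2 φ (fun n => ⟨hφ n, hμφ n⟩) u a hu α fun n => ⟨hα n, hwα n⟩

include hc in
theorem tendsto_comb_dirac (σ : FType k) {φ : ℕ → ℕ} {y : σ.interp X}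
    (hφ : ∀ n, φ n < σ.size n) (h : CodeConv r c σ φ y) :
    Tendsto (fun n => (σ.proj r c n).comb (diracWeight (φ n))) atTop (𝓝 y) := by
  refine tendsto_comb r c hc σ _ y (fun n => ⟨φ n, hφ n, by simp [diracWeight]⟩) fun ψ hψ => ?_
  have : ψ = φ := funext fun n => by
    by_contra hne
    have := (hψ n).2
    simp [diracWeight, hne] at this
  rwa [this]

include hc in
/-- Codes that have positive weight at the members of a convergent sequence converge to its
limit. -/
theorem codeConv_of_weight_pos (hr : ∀ i, DenseRange (r i)) :
    ∀ (σ : FType k) (x : ℕ → σ.interp X) (a : σ.interp X) (φ : ℕ → ℕ),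
    Tendsto x atTop (𝓝 a) →
    (∀ n, φ n < σ.size n ∧ 0 < (σ.proj r c n).weight (φ n) (x n)) → CodeConv r c σ φ a
  | .var i, x, a, φ, hx, hφ => tendsto_of_baseWeight_pos (r i) (hr i) hx fun n => (hφ n).2
  | .arr σ τ, f, (g : C(σ.interp X, τ.interp X)), φ, hf, hφ => by
    intro u a hu α hα
    have h1 := codeConv_of_weight_pos hr σ u a α hu hα
    have h2 := tendsto_comb_dirac r c hc σ (fun n => (hα n).1) h1
    refine codeConv_of_weight_pos hr τ _ _ _ (contConv_of_tendsto hf _ _ h2) fun n =>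
      ⟨digit_lt (τ.size_pos n) _ _, ?_⟩
    have h3 := (hφ n).2
    exact (h3.trans_eq (weight_arr r c n σ τ (φ n) (f n))).trans_le
      (Finset.inf_le (Finset.mem_range.2 (hα n).1))

include hc in
/-- The coded functionals are dense. -/
theorem denseRange_comb_dirac (hr : ∀ i, DenseRange (r i)) (σ : FType k) :
    DenseRange fun e : ℕ => (σ.proj r c e.unpair.1).comb (diracWeight e.unpair.2) := by
  intro y
  choose φ hφ hw using fun n => exists_weight_eq_one r c n σ y
  have h1 := codeConv_of_weight_pos r c hc hr σ (fun _ => y) y φ tendsto_const_nhds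
    fun n => ⟨hφ n, by rw [hw]; exact zero_lt_one⟩
  refine mem_closure_of_tendsto (tendsto_comb_dirac r c hc σ hφ h1)
    (Eventually.of_forall fun n => ⟨Nat.pair n (φ n), ?_⟩)
  simp

end FType

/-! ### Names of coded functionals can be computed -/

/-- A name of the distance to the points of the enumeration can be computed from a name. -/
theorem IsEffectiveEnum.compReal_dist_of_name {X : Type u} [MetricSpace X] {r : ℕ → X}
    (hr : IsEffectiveEnum r) {D : Type*} {nm : D → ℕ → ℕ} {x : D → X}
    (hx : ∀ d n, dist (r (nm d n)) (x d) ≤ (1 / 2 : ℝ) ^ n) :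
    CompReal nm fun (a : ℕ) d => dist (x d) (r a) where
  lower := by
    have h : Semi nm fun (y : (ℕ × RatCode) × ℕ × ℕ) d => nm d y.2.1 = y.2.2 ∧
        ratVal y.1.2 + (1 / 2 : ℝ) ^ y.2.1 < dist (r y.2.2) (r y.1.1) :=
      (Semi.read (by fun_prop) (by fun_prop)).and
        (((CompReal.rat (by fun_prop)).add (CompReal.half_pow (by fun_prop))).lt
          (hr.compReal_dist (by fun_prop) (by fun_prop)))
    refine (Semi.ex (P := fun (i : ℕ × RatCode) (y : ℕ × ℕ) d => nm d y.1 = y.2 ∧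
        ratVal i.2 + (1 / 2 : ℝ) ^ y.1 < dist (r y.2) (r i.1)) h).of_iff fun i d => ?_
    constructor
    · intro hlt
      obtain ⟨n, hn⟩ := exists_pow_lt_of_lt_one
        (show 0 < (dist (x d) (r i.1) - ratVal i.2) / 2 by linarith)
        (show (1 / 2 : ℝ) < 1 by norm_num)
      refine ⟨(n, nm d n), rfl, ?_⟩
      have h1 := hx d n
      have h2 := dist_triangle_left (x d) (r i.1) (r (nm d n))
      dsimp only
      linarith
    · rintro ⟨⟨n, v⟩, hv, hlt⟩
      have h1 := hx d n
      have h2 := dist_triangle (r (nm d n)) (x d) (r i.1)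
      dsimp only at hv hlt
      rw [← hv] at hlt
      linarith
  upper := by
    have h : Semi nm fun (y : (ℕ × RatCode) × ℕ × ℕ) d => nm d y.2.1 = y.2.2 ∧
        dist (r y.2.2) (r y.1.1) + (1 / 2 : ℝ) ^ y.2.1 < ratVal y.1.2 :=
      (Semi.read (by fun_prop) (by fun_prop)).and
        (((hr.compReal_dist (by fun_prop) (by fun_prop)).add
          (CompReal.half_pow (by fun_prop))).lt (CompReal.rat (by fun_prop)))
    refine (Semi.ex (P := fun (i : ℕ × RatCode) (y : ℕ × ℕ) d => nm d y.1 = y.2 ∧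
        dist (r y.2) (r i.1) + (1 / 2 : ℝ) ^ y.1 < ratVal i.2) h).of_iff fun i d => ?_
    constructor
    · intro hlt
      obtain ⟨n, hn⟩ := exists_pow_lt_of_lt_one
        (show 0 < (ratVal i.2 - dist (x d) (r i.1)) / 2 by linarith)
        (show (1 / 2 : ℝ) < 1 by norm_num)
      refine ⟨(n, nm d n), rfl, ?_⟩
      have h1 := hx d n
      have h2 := dist_triangle (r (nm d n)) (x d) (r i.1)
      dsimp only
      linarith
    · rintro ⟨⟨n, v⟩, hv, hlt⟩
      have h1 := hx d n
      have h2 := dist_triangle_left (x d) (r i.1) (r (nm d n))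
      dsimp only at hv hlt
      rw [← hv] at hlt
      linarith

theorem CompReal.baseWeight {X : Type u} [MetricSpace X] {r : ℕ → X}
    (hr : IsEffectiveEnum r) {D : Type*} {nm : D → ℕ → ℕ} {x : D → X}
    (hx : ∀ d n, dist (r (nm d n)) (x d) ≤ (1 / 2 : ℝ) ^ n) :
    CompReal nm fun (y : ℕ × ℕ) d => (baseWeight r y.1 y.2 (x d) : ℝ) := by
  have hd := hr.compReal_dist_of_name hx
  refine CompReal.finset_inf (f := fun (y : ℕ × ℕ) j d => Set.projIcc (0 : ℝ) 1 zero_le_one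
    (1 + 2 ^ y.1 * (dist (x d) (r j) - dist (x d) (r y.2)))) ?_ (by fun_prop)
  have h1 : CompReal nm fun (z : (ℕ × ℕ) × ℕ) d => dist (x d) (r z.2) - dist (x d) (r z.1.2) :=
    (hd.comp (g := fun z : (ℕ × ℕ) × ℕ => z.2) (by fun_prop)).sub
      (hd.comp (g := fun z : (ℕ × ℕ) × ℕ => z.1.2) (by fun_prop))
  have h2 := (CompReal.nat (nm := nm) (n := fun _ : (ℕ × ℕ) × ℕ => 1) (by fun_prop)).add
    (h1.two_pow_mul (e := fun z => z.1.1) (by fun_prop))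
  refine ((CompReal.nat (n := fun _ => 0) (by fun_prop)).max
    ((CompReal.nat (n := fun _ => 1) (by fun_prop)).min h2)).of_eq fun z d => ?_
  simp only [Set.coe_projIcc, Nat.cast_zero, Nat.cast_one]

theorem CompReal.applyWeights {ι : Type} [Primcodable ι] {D : Type*} {nm : D → ℕ → ℕ}
    {μ ω : ι → D → ℕ → unitInterval} {N M : ι → ℕ} (hN : Computable N) (hM : Computable M)
    (hμ : CompReal nm fun (x : ι × ℕ) d => (μ x.1 d x.2 : ℝ))
    (hω : CompReal nm fun (x : ι × ℕ) d => (ω x.1 d x.2 : ℝ)) :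
    CompReal nm fun (x : ι × ℕ) d =>
      (applyWeights (N x.1) (M x.1) (μ x.1 d) (ω x.1 d) x.2 : ℝ) := by
  have hNM : Computable fun x : ι × ℕ => M x.1 ^ N x.1 :=
    Computable.pow (hM.comp Computable.fst) (hN.comp Computable.fst)
  refine CompReal.finset_sup (f := fun (x : ι × ℕ) φ d => (Finset.range (N x.1)).sup fun a =>
    if digit (M x.1) φ a = x.2 then μ x.1 d φ ⊓ ω x.1 d a else 0) ?_ hNM
  refine CompReal.finset_sup (f := fun (x : (ι × ℕ) × ℕ) a d =>
    if digit (M x.1.1) x.2 a = x.1.2 then μ x.1.1 d x.2 ⊓ ω x.1.1 d a else 0) ?_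
    (hN.comp (by fun_prop))
  have hdig : Computable fun x : ((ι × ℕ) × ℕ) × ℕ => digit (M x.1.1.1) x.1.2 x.2 :=
    Computable.digit (hM.comp (by fun_prop)) (by fun_prop) (by fun_prop)
  refine (((hμ.comp (g := fun x : ((ι × ℕ) × ℕ) × ℕ => (x.1.1.1, x.1.2)) (by fun_prop)).min
    (hω.comp (g := fun x : ((ι × ℕ) × ℕ) × ℕ => (x.1.1.1, x.2)) (by fun_prop))).ite_eq
    (CompReal.nat (n := fun _ => 0) (by fun_prop)) hdig
    (b := fun x : ((ι × ℕ) × ℕ) × ℕ => x.1.1.2) (by fun_prop)).of_eq fun x d => ?_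
  split_ifs
  · rfl
  · simp

theorem CompReal.diracWeight {ι : Type} [Primcodable ι] {D : Type*} {nm : D → ℕ → ℕ}
    {φ : ι → ℕ} (hφ : Computable φ) :
    CompReal nm fun (x : ι × ℕ) _ => (diracWeight (φ x.1) x.2 : ℝ) := by
  refine ((CompReal.nat (n := fun _ => 1) (by fun_prop)).ite_eq
    (CompReal.nat (n := fun _ => 0) (by fun_prop)) (a := fun x : ι × ℕ => x.2) (by fun_prop)
    (b := fun x : ι × ℕ => φ x.1) (hφ.comp Computable.fst)).of_eq fun x d => ?_
  unfold _root_.diracWeight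
  split_ifs <;> simp

/-- A computable associate that is applied to a constant sequence yields a computable sequence. -/
theorem exists_computable_of_assocApp {ι : Type} [Primcodable ι] {α : ι → ℕ → ℕ}
    (hα : Computable fun x : ι × ℕ => α x.1 x.2) {Q : ι → (ℕ → ℕ) → Prop}
    (h : ∀ i, ∃ q, AssocApp (α i) (fun _ => 0) q ∧ Q i q) :
    ∃ q : ι → ℕ → ℕ, Computable (fun x : ι × ℕ => q x.1 x.2) ∧ ∀ i, Q i (q i) := by
  choose q hq hQ using h
  have hpre : Computable fun y : (ι × ℕ) × ℕ =>
      α y.1.1 (Encodable.encode (y.1.2, pre (fun _ => 0) y.2)) :=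
    hα.comp (g := fun y : (ι × ℕ) × ℕ => (y.1.1, Encodable.encode (y.1.2, pre (fun _ => 0) y.2)))
      (by fun_prop)
  have hS : Semi trivName.{0} fun (x : (ι × ℕ) × ℕ) _ => ∃ t,
      α x.1.1 (Encodable.encode (x.1.2, pre (fun _ => 0) t)) = x.2 + 1 ∧
        ∀ s < t, α x.1.1 (Encodable.encode (x.1.2, pre (fun _ => 0) s)) = 0 :=
    Semi.ex (P := fun (x : (ι × ℕ) × ℕ) t _ =>
      α x.1.1 (Encodable.encode (x.1.2, pre (fun _ => 0) t)) = x.2 + 1 ∧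
        ∀ s < t, α x.1.1 (Encodable.encode (x.1.2, pre (fun _ => 0) s)) = 0)
      ((Semi.eq (hpre.comp (g := fun y : ((ι × ℕ) × ℕ) × ℕ => (y.1.1, y.2)) (by fun_prop))
        (by fun_prop)).and (Semi.all_lt (P := fun (y : ((ι × ℕ) × ℕ) × ℕ) s _ =>
          α y.1.1.1 (Encodable.encode (y.1.1.2, pre (fun _ => 0) s)) = 0)
          (Semi.eq (hpre.comp (g := fun y : (((ι × ℕ) × ℕ) × ℕ) × ℕ => (y.1.1.1, y.2))
            (by fun_prop)) (by fun_prop)) (by fun_prop)))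
  obtain ⟨g, hg, hgv⟩ := Semi.exists_computable (P := fun (x : ι × ℕ) (v : ℕ) => ∃ t,
      α x.1 (Encodable.encode (x.2, pre (fun _ => 0) t)) = v + 1 ∧
        ∀ s < t, α x.1 (Encodable.encode (x.2, pre (fun _ => 0) s)) = 0) hS
    fun x => ⟨q x.1 x.2, hq x.1 x.2⟩
  refine ⟨fun i n => g (i, n), hg, fun i => ?_⟩
  have : (fun n => g (i, n)) = q i := by
    funext n
    obtain ⟨t, ht, ht'⟩ := hgv (i, n)
    obtain ⟨s, hs, hs'⟩ := hq i n
    rcases lt_trichotomy s t with hst | rfl | hst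
    · exact absurd (hs.symm.trans (ht' s hst)) (Nat.succ_ne_zero _)
    · exact Nat.succ_injective (ht.symm.trans hs)
    · exact absurd (ht.symm.trans (hs' t hst)) (Nat.succ_ne_zero _)
  change Q i fun n => g (i, n)
  rw [this]
  exact hQ i

/-- The answer of the curried form of `α` to `w = (n, l)`, where `l` stands for an initial segment
of the second argument; it depends only on the initial segment of `p` of the same length. -/
def curryValue (α p : ℕ → ℕ) (w : ℕ × List ℕ) : ℕ :=
  α (Encodable.encode (w.1, pre (fun k => Nat.pair (p k) (w.2.getD k 0)) w.2.length))

/-- The curried form of an associate `α` that acts on pairs: the associate that yields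
`curryValue α p` as soon as enough of `p` is known. -/
def curryAssoc (α : ℕ → ℕ) (y : ℕ) : ℕ :=
  (1 - ((Denumerable.ofNat (ℕ × List ℕ) (Denumerable.ofNat (ℕ × List ℕ) y).1).2.length -
      (Denumerable.ofNat (ℕ × List ℕ) y).2.length)) *
    (curryValue α (fun k => (Denumerable.ofNat (ℕ × List ℕ) y).2.getD k 0)
      (Denumerable.ofNat (ℕ × List ℕ) (Denumerable.ofNat (ℕ × List ℕ) y).1) + 1)

theorem curryValue_congr (α : ℕ → ℕ) {p p' : ℕ → ℕ} {w : ℕ × List ℕ}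
    (h : ∀ k < w.2.length, p k = p' k) : curryValue α p w = curryValue α p' w := by
  have : pre (fun k => Nat.pair (p k) (w.2.getD k 0)) w.2.length =
      pre (fun k => Nat.pair (p' k) (w.2.getD k 0)) w.2.length :=
    List.map_congr_left fun k hk => by rw [h k (List.mem_range.1 hk)]
  rw [curryValue, this, curryValue]

theorem getD_pre (p : ℕ → ℕ) {t k : ℕ} (h : k < t) : (pre p t).getD k 0 = p k := by
  rw [List.getD_eq_getElem?_getD, getElem?_pre, if_pos h, Option.getD_some]

theorem curryValue_pre (α p p' : ℕ → ℕ) (n s : ℕ) : curryValue α p (n, pre p' s) =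
    α (Encodable.encode (n, pre (fun k => Nat.pair (p k) (p' k)) s)) := by
  have : pre (fun k => Nat.pair (p k) ((pre p' s).getD k 0)) s =
      pre (fun k => Nat.pair (p k) (p' k)) s :=
    List.map_congr_left fun k hk => by rw [getD_pre p' (List.mem_range.1 hk)]
  rw [curryValue, length_pre, this]

theorem curryAssoc_encode (α : ℕ → ℕ) (m : ℕ) (l : List ℕ) :
    curryAssoc α (Encodable.encode (m, l)) =
      (1 - ((Denumerable.ofNat (ℕ × List ℕ) m).2.length - l.length)) *
        (curryValue α (fun k => l.getD k 0) (Denumerable.ofNat (ℕ × List ℕ) m) + 1) := by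
  have he : Denumerable.ofNat (ℕ × List ℕ) (Encodable.encode (m, l)) = (m, l) :=
    Denumerable.ofNat_encode _
  rw [curryAssoc, he]

theorem assocApp_curryAssoc (α p : ℕ → ℕ) : AssocApp (curryAssoc α) p fun m =>
    curryValue α p (Denumerable.ofNat (ℕ × List ℕ) m) := by
  intro m
  refine ⟨(Denumerable.ofNat (ℕ × List ℕ) m).2.length, ?_, fun s hs => ?_⟩
  · refine (curryAssoc_encode α m (pre p _)).trans ?_
    rw [length_pre, Nat.sub_self, Nat.sub_zero, one_mul,
      curryValue_congr α fun k hk => getD_pre p hk]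
  · refine (curryAssoc_encode α m (pre p s)).trans ?_
    rw [length_pre, Nat.sub_eq_zero_of_le (Nat.sub_pos_of_lt hs), zero_mul]

theorem assocApp_curryValue {α p p' q : ℕ → ℕ}
    (h : AssocApp α (fun k => Nat.pair (p k) (p' k)) q) :
    AssocApp (fun m => curryValue α p (Denumerable.ofNat (ℕ × List ℕ) m)) p' q := by
  intro n
  obtain ⟨t, ht, ht'⟩ := h n
  have key : ∀ s, curryValue α p (Denumerable.ofNat (ℕ × List ℕ) (Encodable.encode
      (n, pre p' s))) = α (Encodable.encode (n, pre (fun k => Nat.pair (p k) (p' k)) s)) := by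
    intro s
    have he : Denumerable.ofNat (ℕ × List ℕ) (Encodable.encode (n, pre p' s)) =
      (n, pre p' s) := Denumerable.ofNat_encode _
    rw [he, curryValue_pre]
  exact ⟨t, (key t).trans ht, fun s hs => (key s).trans (ht' s hs)⟩

theorem computable_curryAssoc {ι : Type} [Primcodable ι] {α : ι → ℕ → ℕ}
    (hα : Computable fun x : ι × ℕ => α x.1 x.2) :
    Computable fun x : ι × ℕ => curryAssoc (α x.1) x.2 := by
  have h1 : Computable fun x : ι × ℕ => (Denumerable.ofNat (ℕ × List ℕ) x.2).2 := by fun_prop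
  have h2 : Computable fun x : ι × ℕ => (Denumerable.ofNat (ℕ × List ℕ)
      (Denumerable.ofNat (ℕ × List ℕ) x.2).1) := by fun_prop
  have h3 : Computable fun z : (ι × ℕ × List ℕ) × List ℕ =>
      curryValue (α z.1.1) (fun k => z.2.getD k 0) z.1.2 :=
    hα.comp (g := fun z : (ι × ℕ × List ℕ) × List ℕ => (z.1.1, Encodable.encode
      (z.1.2.1, pre (fun k => Nat.pair (z.2.getD k 0) (z.1.2.2.getD k 0)) z.1.2.2.length)))
      (by fun_prop)
  have h4 : Computable fun x : ι × ℕ => curryValue (α x.1)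
      (fun k => (Denumerable.ofNat (ℕ × List ℕ) x.2).2.getD k 0)
      (Denumerable.ofNat (ℕ × List ℕ) (Denumerable.ofNat (ℕ × List ℕ) x.2).1) :=
    h3.comp (g := fun x : ι × ℕ => ((x.1, Denumerable.ofNat (ℕ × List ℕ)
      (Denumerable.ofNat (ℕ × List ℕ) x.2).1), (Denumerable.ofNat (ℕ × List ℕ) x.2).2))
      ((Computable.fst.prodMk h2).prodMk h1)
  simp only [curryAssoc]
  fun_prop

namespace FType

variable {k : ℕ} {X : Fin k → Type u} [∀ i, MetricSpace (X i)] (r : ∀ i, ℕ → X i)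
  (c : ∀ i, ℕ → C(ℕ → unitInterval, X i))

/-- The elements of `σ(X_0, …, X_{k-1})`, each together with a name. -/
def NamedPoint (σ : FType k) : Type u :=
  {d : (ℕ → ℕ) × σ.interp X // FType.Names r σ d.1 d.2}

/-- The weights of codes for an element can be computed from a name of the element. -/
def WeightComputable (σ : FType k) : Prop :=
  CompReal (fun d : NamedPoint r σ => d.1.1) fun (x : ℕ × ℕ) d =>
    ((σ.proj r c x.1).weight x.2 d.1.2 : ℝ)

/-- A name of the combination with weights `μ` can be computed from any data that allow to compute
the weights. -/
def CombComputable (σ : FType k) : Prop :=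
  ∀ (ι : Type) [Primcodable ι] (D : Type u) (nm : D → ℕ → ℕ) (n : ι → ℕ)
    (μ : ι → D → ℕ → unitInterval), Computable n →
    CompReal nm (fun (x : ι × ℕ) d => (μ x.1 d x.2 : ℝ)) →
    ∃ α : ι → ℕ → ℕ, Computable (fun x : ι × ℕ => α x.1 x.2) ∧ ∀ i d, ∃ q,
      AssocApp (α i) (nm d) q ∧ FType.Names r σ q ((σ.proj r c (n i)).comb (μ i d))

variable {r c}

/-- Names of the coded elements can be computed. -/
theorem CombComputable.exists_names_dirac {σ : FType k} (h : CombComputable r c σ) :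
    ∃ p : ℕ × ℕ → ℕ → ℕ, Computable (fun x : (ℕ × ℕ) × ℕ => p x.1 x.2) ∧
      ∀ x, FType.Names r σ (p x) ((σ.proj r c x.1).comb (diracWeight x.2)) := by
  obtain ⟨α, hα, h⟩ := h (ℕ × ℕ) PUnit.{u + 1} trivName (fun x => x.1)
    (fun x _ => diracWeight x.2) (by fun_prop) (CompReal.diracWeight (by fun_prop))
  exact exists_computable_of_assocApp hα fun x => h x PUnit.unit

theorem names_arr_iff {σ τ : FType k} {α : ℕ → ℕ} {f : C(σ.interp X, τ.interp X)} :
    FType.Names r (σ.arr τ) α f ↔ ∀ (p : ℕ → ℕ) (x : σ.interp X), FType.Names r σ p x →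
      ∃ q : ℕ → ℕ, AssocApp α p q ∧ FType.Names r τ q (f x) := Iff.rfl

theorem names_comb_arr_iff {σ τ : FType k} {α : ℕ → ℕ} {n : ℕ} {μ : ℕ → unitInterval} :
    FType.Names r (σ.arr τ) α (((σ.arr τ).proj r c n).comb μ) ↔
      ∀ (p : ℕ → ℕ) (x : σ.interp X), FType.Names r σ p x →
        ∃ q : ℕ → ℕ, AssocApp α p q ∧ FType.Names r τ q ((τ.proj r c n).comb
          (applyWeights (σ.size n) (τ.size n) μ fun a => (σ.proj r c n).weight a x)) := Iff.rfl

theorem WeightComputable.arr {σ τ : FType k} (hC : CombComputable r c σ)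
    (hW : WeightComputable r c τ) : WeightComputable r c (σ.arr τ) := by
  obtain ⟨p, hp, hpn⟩ := hC.exists_names_dirac
  let g : NamedPoint r (σ.arr τ) → C(σ.interp X, τ.interp X) := fun d => d.1.2
  choose q hq hqn using fun (x : ℕ × ℕ) (d : NamedPoint r (σ.arr τ)) =>
    names_arr_iff.1 d.2 _ _ (hpn x)
  have hdig : Computable fun x : (ℕ × ℕ) × ℕ => digit (τ.size x.1.1) x.1.2 x.2 :=
    Computable.digit (τ.computable_size.comp (by fun_prop)) (by fun_prop) (by fun_prop)
  have h1 : CompReal (fun d : NamedPoint r τ => d.1.1) fun (x : (ℕ × ℕ) × ℕ) d =>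
      ((τ.proj r c x.1.1).weight (digit (τ.size x.1.1) x.1.2 x.2) d.1.2 : ℝ) :=
    hW.comp (g := fun x : (ℕ × ℕ) × ℕ => (x.1.1, digit (τ.size x.1.1) x.1.2 x.2))
      ((Computable.fst.comp Computable.fst).prodMk hdig)
  have h2 : CompReal (fun d : NamedPoint r (σ.arr τ) => d.1.1) fun (x : (ℕ × ℕ) × ℕ) d =>
      ((τ.proj r c x.1.1).weight (digit (τ.size x.1.1) x.1.2 x.2)
        (g d ((σ.proj r c x.1.1).comb (diracWeight x.2))) : ℝ) :=
    h1.assocApp (p := fun x => p (x.1.1, x.2))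
      (hp.comp (g := fun x : ((ℕ × ℕ) × ℕ) × ℕ => ((x.1.1.1, x.1.2), x.2)) (by fun_prop))
      (π := fun x d => ⟨(q (x.1.1, x.2) d, g d ((σ.proj r c x.1.1).comb (diracWeight x.2))),
        hqn (x.1.1, x.2) d⟩) fun x d => hq (x.1.1, x.2) d
  exact (CompReal.finset_inf (f := fun (x : ℕ × ℕ) a d => (τ.proj r c x.1).weight
    (digit (τ.size x.1) x.2 a) (g d ((σ.proj r c x.1).comb (diracWeight a)))) h2
    (σ.computable_size.comp Computable.fst)).of_eq fun x d =>
      congrArg Subtype.val (weight_arr r c x.1 σ τ x.2 (g d))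

theorem CombComputable.arr {σ τ : FType k} (hW : WeightComputable r c σ)
    (hC : CombComputable r c τ) : CombComputable r c (σ.arr τ) := by
  intro ι _ D nm n μ hn hμ
  -- The argument of the functional is added to the context.
  let nm' : D × NamedPoint r σ → ℕ → ℕ := fun d j => Nat.pair (nm d.1 j) (d.2.1.1 j)
  have hμ' : CompReal nm' fun (x : ι × ℕ) d => (μ x.1 d.1 x.2 : ℝ) :=
    hμ.pullback (π := Prod.fst) (ρ := fun m => m.unpair.1)
      (Primrec.fst.comp Primrec.unpair) fun d j => by simp [nm']
  have hω : CompReal nm' fun (x : ι × ℕ) d =>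
      ((σ.proj r c (n x.1)).weight x.2 d.2.1.2 : ℝ) :=
    (hW.comp (g := fun x : ι × ℕ => (n x.1, x.2)) ((hn.comp Computable.fst).prodMk
      Computable.snd)).pullback (π := Prod.snd) (ρ := fun m => m.unpair.2)
      (Primrec.snd.comp Primrec.unpair) fun d j => by simp [nm']
  have hσ : Computable fun i => σ.size (n i) := σ.computable_size.comp hn
  have hτ : Computable fun i => τ.size (n i) := τ.computable_size.comp hn
  have hθ := CompReal.applyWeights (nm := nm') (N := fun i => σ.size (n i))
    (M := fun i => τ.size (n i)) (μ := fun i d => μ i d.1)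
    (ω := fun i d a => (σ.proj r c (n i)).weight a d.2.1.2) hσ hτ hμ' hω
  obtain ⟨α, hα, h⟩ := hC ι (D × NamedPoint r σ) nm' n (fun i d =>
    applyWeights (σ.size (n i)) (τ.size (n i)) (μ i d.1) fun a =>
      (σ.proj r c (n i)).weight a d.2.1.2) hn hθ
  refine ⟨fun i => curryAssoc (α i), computable_curryAssoc hα, fun i d =>
    ⟨_, assocApp_curryAssoc (α i) (nm d), names_comb_arr_iff.2 fun p x hpx => ?_⟩⟩
  obtain ⟨q, hq, hqn⟩ := h i (d, ⟨(p, x), hpx⟩)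
  exact ⟨q, assocApp_curryValue hq, hqn⟩

/-- The two properties are proved by simultaneous induction on the type: the weights of codes of
functionals are computed by applying the functional to coded arguments, and combinations of
functionals are computed from the weights of the argument. -/
theorem weightComputable_and_combComputable (hr : ∀ i, IsEffectiveEnum (r i))
    (hc : ∀ i, ∀ (ι : Type) [Primcodable ι] (D : Type u) (nm : D → ℕ → ℕ) (n : ι → ℕ)
        (μ : ι → D → ℕ → unitInterval), Computable n →
        CompReal nm (fun (x : ι × ℕ) d => (μ x.1 d x.2 : ℝ)) →
        ∃ α : ι → ℕ → ℕ, Computable (fun x : ι × ℕ => α x.1 x.2) ∧ ∀ i' d, ∃ q,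
          AssocApp (α i') (nm d) q ∧
            ∀ k, dist (r i (q k)) (c i (n i') (μ i' d)) ≤ (1 / 2 : ℝ) ^ k) :
    ∀ σ : FType k, WeightComputable r c σ ∧ CombComputable r c σ
  | .var i => ⟨CompReal.baseWeight (hr i) (x := fun d : NamedPoint r (.var i) => d.1.2)
      fun d => d.2, hc i⟩
  | .arr σ τ =>
    have hσ := weightComputable_and_combComputable hr hc σ
    have hτ := weightComputable_and_combComputable hr hc τ
    ⟨.arr hσ.2 hτ.1, .arr hσ.1 hτ.2⟩

theorem CombComputable.isComputableSeq {σ : FType k} (h : CombComputable r c σ) :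
    σ.IsComputableSeq r fun e : ℕ => (σ.proj r c e.unpair.1).comb (diracWeight e.unpair.2) := by
  obtain ⟨p, hp, hpn⟩ := h.exists_names_dirac
  exact ⟨fun e => p e.unpair, hp.comp (g := fun x : ℕ × ℕ => (x.1.unpair, x.2)) (by fun_prop),
    fun e => hpn e.unpair⟩

end FType

/-! ### The Urysohn space is effective -/

theorem Semi.ratLe {ι : Type} [Primcodable ι] {D : Type*} {nm : D → ℕ → ℕ} {f g : ι → RatCode}
    (hf : Computable f) (hg : Computable g) : Semi nm fun i _ => ratVal (f i) ≤ ratVal (g i) := by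
  refine (Semi.natLe (nm := nm)
    (f := fun i => (f i).1 * ((g i).2.2 + 1) + (g i).2.1 * ((f i).2.2 + 1))
    (g := fun i => (g i).1 * ((f i).2.2 + 1) + (f i).2.1 * ((g i).2.2 + 1))
    (by fun_prop) (by fun_prop)).of_iff fun i _ => ?_
  rw [← not_lt, ratVal_lt_iff, not_lt]

/-- The list `v` consists of `v.length` numbers, at least one and at most `n`, which are possible
upper bounds for the distances from a new point to the first points of the table `T`. -/
def ValidBounds (n : ℕ) (T v : List RatCode) : Prop :=
  (0 < v.length ∧ v.length ≤ n) ∧ ∀ j < v.length, ∀ l < v.length,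
    ratVal (T.getD (Nat.pair j l) (0, 0, 0)) ≤
      ratVal ((v.getD j (0, 0, 0)).add (v.getD l (0, 0, 0)))

/-- The negation of `ValidBounds`, in a form that is visibly semidecidable. -/
def InvalidBounds (n : ℕ) (T v : List RatCode) : Prop :=
  (v.length ≤ 0 ∨ n < v.length) ∨ ∃ j < v.length, ∃ l < v.length,
    ratVal ((v.getD j (0, 0, 0)).add (v.getD l (0, 0, 0))) <
      ratVal (T.getD (Nat.pair j l) (0, 0, 0))

theorem invalidBounds_iff {n : ℕ} {T v : List RatCode} :
    InvalidBounds n T v ↔ ¬ ValidBounds n T v := by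
  unfold InvalidBounds ValidBounds
  rw [not_and_or, not_and_or]
  push Not
  rfl

/-- The number `q` codes the distance of the point `i` to the new point, which is as large as the
bounds `v` permit if they are valid. The new point is a copy of the point `0` otherwise. -/
def NewDist (n : ℕ) (T v : List RatCode) (i : ℕ) (q : RatCode) : Prop :=
  (ValidBounds n T v ∧
    (∀ j < v.length, ratVal q ≤
      ratVal ((v.getD j (0, 0, 0)).add (T.getD (Nat.pair i j) (0, 0, 0)))) ∧
    ∃ j < v.length, q = (v.getD j (0, 0, 0)).add (T.getD (Nat.pair i j) (0, 0, 0))) ∨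
  (InvalidBounds n T v ∧ q = T.getD (Nat.pair i 0) (0, 0, 0))

/-- The list of bounds that is used at stage `n`. Every list is used infinitely often. -/
def boundsAt (n : ℕ) : List RatCode := Denumerable.ofNat (List RatCode) n.unpair.2

/-- The table `T'` of distances between `n + 1` points extends the table `T` of distances between
the first `n` of them. -/
def DistExtends (n : ℕ) (T T' : List RatCode) : Prop :=
  (∀ i < n, ∀ j < n, T'.getD (Nat.pair i j) (0, 0, 0) = T.getD (Nat.pair i j) (0, 0, 0)) ∧
  T'.getD (Nat.pair n n) (0, 0, 0) = (0, 0, 0) ∧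
  ∀ i < n, T'.getD (Nat.pair n i) (0, 0, 0) = T'.getD (Nat.pair i n) (0, 0, 0) ∧
    NewDist n T (boundsAt n) i (T'.getD (Nat.pair i n) (0, 0, 0))

/-- The first `n` rows and columns of the table `T` describe a pseudometric. -/
structure DistTable (n : ℕ) (T : List RatCode) : Prop where
  self : ∀ i < n, ratVal (T.getD (Nat.pair i i) (0, 0, 0)) = 0
  comm : ∀ i < n, ∀ j < n,
    ratVal (T.getD (Nat.pair i j) (0, 0, 0)) = ratVal (T.getD (Nat.pair j i) (0, 0, 0))
  triangle : ∀ i < n, ∀ j < n, ∀ l < n, ratVal (T.getD (Nat.pair i l) (0, 0, 0)) ≤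
    ratVal (T.getD (Nat.pair i j) (0, 0, 0)) + ratVal (T.getD (Nat.pair j l) (0, 0, 0))

section Semi

variable {ι : Type} [Primcodable ι] {D : Type*} {nm : D → ℕ → ℕ} {n : ι → ℕ}
  {T T' v : ι → List RatCode}

theorem ValidBounds.semi (hn : Computable n) (hT : Computable T) (hv : Computable v) :
    Semi nm fun i _ => ValidBounds (n i) (T i) (v i) := by
  have hlen : Computable fun i => (v i).length := by fun_prop
  refine ((Semi.natLt (by fun_prop) hlen).and (Semi.natLe hlen hn)).and ?_
  refine Semi.all_lt (P := fun i j _ => ∀ l < (v i).length,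
    ratVal ((T i).getD (Nat.pair j l) (0, 0, 0)) ≤
      ratVal (((v i).getD j (0, 0, 0)).add ((v i).getD l (0, 0, 0)))) ?_ hlen
  refine Semi.all_lt (P := fun (x : ι × ℕ) l _ =>
    ratVal ((T x.1).getD (Nat.pair x.2 l) (0, 0, 0)) ≤
      ratVal (((v x.1).getD x.2 (0, 0, 0)).add ((v x.1).getD l (0, 0, 0)))) ?_
    (hlen.comp Computable.fst)
  exact Semi.ratLe (by fun_prop) (by fun_prop)

theorem InvalidBounds.semi (hn : Computable n) (hT : Computable T) (hv : Computable v) :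
    Semi nm fun i _ => InvalidBounds (n i) (T i) (v i) := by
  have hlen : Computable fun i => (v i).length := by fun_prop
  refine ((Semi.natLe hlen (by fun_prop)).or (Semi.natLt hn hlen)).or ?_
  refine Semi.ex_lt (P := fun i j _ => ∃ l < (v i).length,
    ratVal (((v i).getD j (0, 0, 0)).add ((v i).getD l (0, 0, 0))) <
      ratVal ((T i).getD (Nat.pair j l) (0, 0, 0))) ?_ hlen
  refine Semi.ex_lt (P := fun (x : ι × ℕ) l _ =>
    ratVal (((v x.1).getD x.2 (0, 0, 0)).add ((v x.1).getD l (0, 0, 0))) <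
      ratVal ((T x.1).getD (Nat.pair x.2 l) (0, 0, 0))) ?_
    (hlen.comp Computable.fst)
  exact Semi.ratLt (by fun_prop) (by fun_prop)

theorem NewDist.semi {i : ι → ℕ} {q : ι → RatCode} (hn : Computable n) (hT : Computable T)
    (hv : Computable v) (hi : Computable i) (hq : Computable q) :
    Semi nm fun x _ => NewDist (n x) (T x) (v x) (i x) (q x) := by
  have hlen : Computable fun i => (v i).length := by fun_prop
  refine Semi.or ((ValidBounds.semi hn hT hv).and (Semi.and ?_ ?_))
    ((InvalidBounds.semi hn hT hv).and (Semi.eq hq (by fun_prop)))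
  · refine Semi.all_lt (P := fun x j _ => ratVal (q x) ≤
      ratVal (((v x).getD j (0, 0, 0)).add ((T x).getD (Nat.pair (i x) j) (0, 0, 0)))) ?_ hlen
    exact Semi.ratLe (by fun_prop) (by fun_prop)
  · refine Semi.ex_lt (P := fun x j _ => q x =
      ((v x).getD j (0, 0, 0)).add ((T x).getD (Nat.pair (i x) j) (0, 0, 0))) ?_ hlen
    exact Semi.eq (by fun_prop) (by fun_prop)

theorem DistExtends.semi (hn : Computable n) (hT : Computable T) (hT' : Computable T') :
    Semi nm fun i _ => DistExtends (n i) (T i) (T' i) := by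
  refine Semi.and ?_ (Semi.and (Semi.eq (by fun_prop) (by fun_prop)) ?_)
  · refine Semi.all_lt (P := fun x i _ => ∀ j < n x,
      (T' x).getD (Nat.pair i j) (0, 0, 0) = (T x).getD (Nat.pair i j) (0, 0, 0)) ?_ hn
    refine Semi.all_lt (P := fun (x : ι × ℕ) j _ =>
      (T' x.1).getD (Nat.pair x.2 j) (0, 0, 0) = (T x.1).getD (Nat.pair x.2 j) (0, 0, 0)) ?_
      (hn.comp Computable.fst)
    exact Semi.eq (by fun_prop) (by fun_prop)
  · refine Semi.all_lt (P := fun x i _ =>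
      (T' x).getD (Nat.pair (n x) i) (0, 0, 0) = (T' x).getD (Nat.pair i (n x)) (0, 0, 0) ∧
        NewDist (n x) (T x) (boundsAt (n x)) i ((T' x).getD (Nat.pair i (n x)) (0, 0, 0))) ?_ hn
    refine (Semi.eq (by fun_prop) (by fun_prop)).and (NewDist.semi (by fun_prop) (by fun_prop)
      ?_ (by fun_prop) (by fun_prop))
    unfold boundsAt
    fun_prop

end Semi

theorem exists_newDist {n : ℕ} {T v : List RatCode} (i : ℕ) : ∃ q, NewDist n T v i q := by
  by_cases h : ValidBounds n T v
  · obtain ⟨j, hj, hmin⟩ := (Finset.range v.length).exists_min_image (fun j =>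
      ratVal ((v.getD j (0, 0, 0)).add (T.getD (Nat.pair i j) (0, 0, 0))))
      ⟨0, Finset.mem_range.2 h.1.1⟩
    exact ⟨_, .inl ⟨h, fun l hl => hmin l (Finset.mem_range.2 hl), j, Finset.mem_range.1 hj, rfl⟩⟩
  · exact ⟨_, .inr ⟨invalidBounds_iff.2 h, rfl⟩⟩

theorem exists_distExtends (n : ℕ) (T : List RatCode) : ∃ T', DistExtends n T T' := by
  choose q hq using fun i => exists_newDist (n := n) (T := T) (v := boundsAt n) i
  let w : ℕ → ℕ → RatCode := fun i j => if i < n then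
    if j < n then T.getD (Nat.pair i j) (0, 0, 0) else q i
    else if j < n then q j else (0, 0, 0)
  let T' : List RatCode := (List.range ((n + 1) ^ 2)).map fun m => w m.unpair.1 m.unpair.2
  have hw : ∀ i ≤ n, ∀ j ≤ n, T'.getD (Nat.pair i j) (0, 0, 0) = w i j := by
    intro i hi j hj
    have h : Nat.pair i j < (n + 1) ^ 2 := (Nat.pair_lt_max_add_one_sq i j).trans_le
      (Nat.pow_le_pow_left (Nat.succ_le_succ (max_le hi hj)) 2)
    simp [T', List.getD_eq_getElem?_getD, h]
  refine ⟨T', fun i hi j hj => ?_, ?_, fun i hi => ⟨?_, ?_⟩⟩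
  · rw [hw i hi.le j hj.le]; simp [w, hi, hj]
  · rw [hw n le_rfl n le_rfl]; simp [w]
  · rw [hw n le_rfl i hi.le, hw i hi.le n le_rfl]; simp [w, hi]
  · rw [hw i hi.le n le_rfl]
    have : w i n = q i := by simp [w, hi]
    rw [this]
    exact hq i

/-- New distances satisfy the triangle inequality. -/
theorem NewDist.triangle {n : ℕ} {T v : List RatCode} (hT : DistTable n T) {i j : ℕ} (hi : i < n)
    (hj : j < n) {q s : RatCode} (hq : NewDist n T v i q) (hs : NewDist n T v j s) :
    ratVal q ≤ ratVal (T.getD (Nat.pair i j) (0, 0, 0)) + ratVal s ∧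
      ratVal (T.getD (Nat.pair i j) (0, 0, 0)) ≤ ratVal q + ratVal s := by
  have h0 : 0 < n := hi.pos
  rcases hq with ⟨hv, hq, l, hl, hql⟩ | ⟨hv, rfl⟩
  · rcases hs with ⟨-, hs, m, hm, hsm⟩ | ⟨hv', -⟩
    · have hln := hl.trans_le hv.1.2
      have hmn := hm.trans_le hv.1.2
      have h1 := hq m hm
      have h2 := hv.2 l hl m hm
      have h3 := hT.triangle i hi j hj m hmn
      have h4 := hT.triangle i hi l hln j hj
      have h5 := hT.triangle l hln m hmn j hj
      have h6 := hT.comm m hmn j hj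
      rw [ratVal_add] at h1 h2
      rw [hql, hsm, ratVal_add, ratVal_add]
      rw [hql, ratVal_add] at h1
      constructor <;> linarith
    · exact absurd hv (invalidBounds_iff.1 hv')
  · rcases hs with ⟨hv', -⟩ | ⟨-, rfl⟩
    · exact absurd hv' (invalidBounds_iff.1 hv)
    · refine ⟨hT.triangle i hi j hj 0 h0, ?_⟩
      rw [hT.comm j hj 0 h0]
      exact hT.triangle i hi 0 h0 j hj

theorem DistExtends.distTable {n : ℕ} {T T' : List RatCode} (hT : DistTable n T)
    (h : DistExtends n T T') : DistTable (n + 1) T' := by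
  obtain ⟨h1, h2, h3⟩ := h
  have h0 : ratVal (0, 0, 0) = 0 := by simp [ratVal]
  have hnn : ∀ i < n, 0 ≤ ratVal (T'.getD (Nat.pair i n) (0, 0, 0)) := fun i hi => by
    have := (NewDist.triangle hT hi hi (h3 i hi).2 (h3 i hi).2).2
    rw [hT.self i hi] at this
    linarith
  refine ⟨fun i hi => ?_, fun i hi j hj => ?_, fun i hi j hj l hl => ?_⟩
  · rcases Nat.lt_succ_iff_lt_or_eq.1 hi with hi | rfl
    · rw [h1 i hi i hi, hT.self i hi]
    · rw [h2, h0]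
  · rcases Nat.lt_succ_iff_lt_or_eq.1 hi with hi | rfl <;>
    rcases Nat.lt_succ_iff_lt_or_eq.1 hj with hj | rfl
    · rw [h1 i hi j hj, h1 j hj i hi, hT.comm i hi j hj]
    · rw [(h3 i hi).1]
    · rw [(h3 j hj).1]
    · rfl
  · rcases Nat.lt_succ_iff_lt_or_eq.1 hi with hi | rfl <;>
    rcases Nat.lt_succ_iff_lt_or_eq.1 hj with hj | rfl <;>
    rcases Nat.lt_succ_iff_lt_or_eq.1 hl with hl | rfl
    · rw [h1 i hi l hl, h1 i hi j hj, h1 j hj l hl]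
      exact hT.triangle i hi j hj l hl
    · rw [h1 i hi j hj]
      exact (NewDist.triangle hT hi hj (h3 i hi).2 (h3 j hj).2).1
    · rw [h1 i hi l hl, (h3 l hl).1]
      exact (NewDist.triangle hT hi hl (h3 i hi).2 (h3 l hl).2).2
    · rw [h2, h0, add_zero]
    · rw [(h3 l hl).1, (h3 j hj).1, h1 j hj l hl, hT.comm j hj l hl, add_comm]
      exact (NewDist.triangle hT hl hj (h3 l hl).2 (h3 j hj).2).1
    · rw [h2, h0, (h3 j hj).1]
      have := hnn j hj
      linarith
    · rw [h2, h0, zero_add]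
    · rw [h2, h0, add_zero]

/-- There is a computable countable pseudometric space with the extension property of the rational
Urysohn space: whenever rational numbers `v j` are possible upper bounds for the distances of a new
point to the first `N` points, some point has the largest distances from the earlier points that
these bounds permit. -/
theorem exists_computable_urysohn_pseudometric : ∃ d : ℕ → ℕ → ℝ,
    IsComputableReals (fun ij : ℕ × ℕ => d ij.1 ij.2) ∧ (∀ i, d i i = 0) ∧
      (∀ i j, d i j = d j i) ∧ (∀ i j l, d i l ≤ d i j + d j l) ∧
      ∀ N, 0 < N → ∀ v : ℕ → ℚ, (∀ j < N, ∀ l < N, d j l ≤ v j + v l) →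
        ∃ n ≥ N, ∀ i < n, (∀ j < N, d i n ≤ v j + d i j) ∧ ∃ j < N, d i n = v j + d i j := by
  obtain ⟨T, hTc, -, hT⟩ := Semi.exists_chain (ι := Unit) (κ := List RatCode)
    (E := fun _ n T T' => DistExtends n T T') (V := fun _ n T => DistTable n T)
    (DistExtends.semi (ι := (Unit × ℕ × List RatCode) × List RatCode) (n := fun x => x.1.2.1)
      (T := fun x => x.1.2.2) (T' := fun x => x.2) (by fun_prop) (by fun_prop) (by fun_prop))
    (s₀ := fun _ => []) (by fun_prop) (fun _ => ⟨by simp, by simp, by simp⟩)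
    (fun _ n T _ => exists_distExtends n T) fun _ n T T' hV hE => hE.distTable hV
  replace hT := hT ()
  have hstable : ∀ m n, n ≤ m → ∀ i < n, ∀ j < n, (T () m).getD (Nat.pair i j) (0, 0, 0) =
      (T () n).getD (Nat.pair i j) (0, 0, 0) := by
    intro m n hnm i hi j hj
    induction m, hnm using Nat.le_induction with
    | base => rfl
    | succ m hm ih => rw [(hT m).2.1 i (hi.trans_le hm) j (hj.trans_le hm), ih]
  let d : ℕ → ℕ → ℝ := fun i j =>
    ratVal ((T () (i + j + 1)).getD (Nat.pair i j) (0, 0, 0))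
  have hd : ∀ n, ∀ i < n, ∀ j < n, d i j = ratVal ((T () n).getD (Nat.pair i j) (0, 0, 0)) := by
    intro n i hi j hj
    have h1 := hstable (n + (i + j + 1)) n (by omega) i hi j hj
    have h2 := hstable (n + (i + j + 1)) (i + j + 1) (by omega) i (by omega) j (by omega)
    simp only [d]
    rw [← h1, ← h2]
  refine ⟨d, ⟨fun x _ => (T () (x.1 + x.2 + 1)).getD (Nat.pair x.1 x.2) (0, 0, 0), ?_, ?_⟩,
    fun i => ?_, fun i j => ?_, fun i j l => ?_, fun N hN v hv => ?_⟩
  · have h1 : Computable fun x : (ℕ × ℕ) × ℕ => T () (x.1.1 + x.1.2 + 1) :=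
      hTc.comp (g := fun x : (ℕ × ℕ) × ℕ => ((), x.1.1 + x.1.2 + 1)) (by fun_prop)
    exact (by fun_prop : Computable fun x : (ℕ × ℕ) × ℕ =>
      (T () (x.1.1 + x.1.2 + 1)).getD (Nat.pair x.1.1 x.1.2) (0, 0, 0))
  · intro x n
    simp [d]
  · rw [hd (i + 1) i (by omega) i (by omega)]
    exact (hT (i + 1)).1.self i (by omega)
  · rw [hd (i + j + 1) i (by omega) j (by omega), hd (i + j + 1) j (by omega) i (by omega)]
    exact (hT (i + j + 1)).1.comm i (by omega) j (by omega)
  · rw [hd (i + j + l + 1) i (by omega) l (by omega), hd (i + j + l + 1) i (by omega) j (by omega),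
      hd (i + j + l + 1) j (by omega) l (by omega)]
    exact (hT (i + j + l + 1)).1.triangle i (by omega) j (by omega) l (by omega)
  · choose q hq using fun j => exists_ratVal_eq (v j)
    let w : List RatCode := (List.range N).map q
    have hlen : w.length = N := by simp [w]
    have hwj : ∀ j < N, w.getD j (0, 0, 0) = q j := fun j hj => by
      simp [w, List.getD_eq_getElem?_getD, hj]
    have hNn : N ≤ Nat.pair N (Encodable.encode w) := Nat.left_le_pair _ _
    have hbd : boundsAt (Nat.pair N (Encodable.encode w)) = w := by
      rw [boundsAt, Nat.unpair_pair]
      exact Denumerable.ofNat_encode w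
    generalize Nat.pair N (Encodable.encode w) = n at hNn hbd
    have hvalid : ValidBounds n (T () n) w := by
      refine ⟨⟨hlen.symm ▸ hN, hlen.symm ▸ hNn⟩, ?_⟩
      rw [hlen]
      intro j hj l hl
      rw [hwj j hj, hwj l hl, ratVal_add, hq, hq, ← hd n j (by omega) l (by omega)]
      exact hv j hj l hl
    refine ⟨n, hNn, fun i hi => ?_⟩
    have h1 := ((hT n).2.2.2 i hi).2
    rw [hbd] at h1
    rcases h1 with ⟨-, h1, h2⟩ | ⟨h1, -⟩
    · rw [hlen] at h1 h2
      rw [hd (n + 1) i (by omega) n (by omega)]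
      refine ⟨fun j hj => ?_, ?_⟩
      · have := h1 j hj
        rwa [hwj j hj, ratVal_add, hq, ← hd n i hi j (by omega)] at this
      · obtain ⟨j, hj, h2⟩ := h2
        refine ⟨j, hj, ?_⟩
        rw [h2, hwj j hj, ratVal_add, hq, ← hd n i hi j (by omega)]
    · exact absurd hvalid (invalidBounds_iff.1 h1)

section Realization

variable {X : Type u} [MetricSpace X] {d : ℕ → ℕ → ℝ}

/-- A one-point extension that also controls the distance to an additional point `s`. -/
theorem FinitelySaturated.exists_point (hX : FinitelySaturated X) (N : ℕ) (u : Fin N → X) (s : X)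
    (f : Fin N → ℝ) (hf : ∀ i j, f i ≤ dist (u i) (u j) + f j)
    (hf' : ∀ i j, dist (u i) (u j) ≤ f i + f j) {ε : ℝ} (hε : 0 ≤ ε)
    (hs : ∀ i, |dist s (u i) - f i| ≤ ε) :
    ∃ y, (∀ i, dist y (u i) = f i) ∧ dist y s ≤ ε := by
  -- All the points are represented by their vectors of distances to the points `u i`.
  let w : Option (Option (Fin N)) → Fin N → ℝ := fun a => a.elim f fun b =>
    b.elim (fun i => dist s (u i)) fun j i => dist (u j) (u i)
  let _ : PseudoMetricSpace (Option (Option (Fin N))) := PseudoMetricSpace.induced w inferInstance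
  have hd : ∀ a b : Option (Option (Fin N)), dist a b = dist (w a) (w b) := fun _ _ => rfl
  have hvec : ∀ (g : Fin N → ℝ) (j : Fin N), (∀ i i', g i ≤ dist (u i) (u i') + g i') →
      (∀ i i', dist (u i) (u i') ≤ g i + g i') → dist g (fun i => dist (u j) (u i)) = g j := by
    intro g j h1 h2
    have h0 : 0 ≤ g j := by have := h2 j j; rw [dist_self] at this; linarith
    apply le_antisymm
    · refine (dist_pi_le_iff h0).2 fun i => ?_
      have h3 := h1 i j
      have h4 := h2 j i
      rw [dist_comm (u i)] at h3
      rw [Real.dist_eq, abs_le]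
      constructor <;> linarith
    · refine le_trans ?_ (dist_le_pi_dist _ _ j)
      rw [dist_self, Real.dist_eq, sub_zero]
      exact le_abs_self _
  have hsu : ∀ j, dist (fun i => dist s (u i)) (fun i => dist (u j) (u i)) = dist s (u j) :=
    fun j => hvec _ j (fun i i' => by
        rw [add_comm, dist_comm (u i)]; exact dist_triangle _ _ _)
      fun i i' => dist_triangle_left _ _ _
  obtain ⟨ψ, hψ, hψS⟩ := hX.exists_extension (Set.range some)
    (fun a : Option (Option (Fin N)) => a.elim s fun b => b.elim s u) (by
      rintro _ ⟨a, rfl⟩ _ ⟨b, rfl⟩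
      rw [hd]
      rcases a with _ | a <;> rcases b with _ | b
      · simp
      · exact (hsu b).symm
      · exact (dist_comm _ _).trans ((hsu a).symm.trans (dist_comm _ _))
      · exact (dist_kuratowski u a b).symm)
  refine ⟨ψ none, fun i => ?_, ?_⟩
  · have h1 : ψ (some (some i)) = u i := hψS _ ⟨_, rfl⟩
    rw [← h1, hψ.dist_eq, hd]
    exact hvec f i hf hf'
  · have h1 : ψ (some none) = s := hψS _ ⟨_, rfl⟩
    rw [← h1, hψ.dist_eq, hd, dist_comm]
    refine (dist_pi_le_iff hε).2 fun i => ?_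
    rw [Real.dist_eq]
    exact hs i

/-- The points `u 0, …, u (N - 1)` have the distances given by `d`. -/
def Realizes (d : ℕ → ℕ → ℝ) (N : ℕ) (u : ℕ → X) : Prop :=
  ∀ i < N, ∀ j < N, dist (u i) (u j) = d i j

/-- A partial realization of `d` in the Urysohn space can be extended so that it comes close to a
given point `s`. -/
theorem Realizes.exists_extension (hX : FinitelySaturated X) (hself : ∀ i, d i i = 0)
    (hcomm : ∀ i j, d i j = d j i) (htri : ∀ i j l, d i l ≤ d i j + d j l)
    (hext : ∀ N, 0 < N → ∀ v : ℕ → ℚ, (∀ j < N, ∀ l < N, d j l ≤ v j + v l) →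
      ∃ n ≥ N, ∀ i < n, (∀ j < N, d i n ≤ v j + d i j) ∧ ∃ j < N, d i n = v j + d i j)
    {N : ℕ} (hN : 0 < N) {u : ℕ → X} (hu : Realizes d N u) (s : X) {ε : ℝ} (hε : 0 < ε) :
    ∃ M > N, ∃ u' : ℕ → X, Realizes d M u' ∧ (∀ i < N, u' i = u i) ∧
      ∃ m < M, dist (u' m) s ≤ ε := by
  -- Rational upper bounds for the distances from `s` give an index `n` whose distances from the
  -- first `N` points are at least those of `s` and exceed them by at most `ε`.
  choose v hv1 hv2 using fun j => exists_rat_btwn (show dist s (u j) < dist s (u j) + ε by linarith)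
  obtain ⟨n, hNn, hn⟩ := hext N hN v fun j hj l hl => by
    have := dist_triangle_left (u j) (u l) s
    rw [hu j hj l hl] at this
    have := hv1 j
    have := hv1 l
    linarith
  have hlow : ∀ i < N, dist s (u i) ≤ d i n := fun i hi => by
    obtain ⟨j, hj, h⟩ := (hn i (hi.trans_le hNn)).2
    have h1 := dist_triangle_right s (u i) (u j)
    rw [hu i hi j hj] at h1
    have := hv1 j
    linarith
  have hup : ∀ i < N, d i n ≤ dist s (u i) + ε := fun i hi => by
    have h1 := (hn i (hi.trans_le hNn)).1 i hi
    rw [hself] at h1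
    have := hv2 i
    linarith
  obtain ⟨y, hy, hys⟩ := hX.exists_point N (fun i => u i) s (fun i => d i n)
    (fun i j => by rw [hu i i.2 j j.2]; exact htri _ _ _)
    (fun i j => by rw [hu i i.2 j j.2, hcomm j n]; exact htri _ _ _) hε.le fun i => by
      have h1 := hlow i i.2
      have h2 := hup i i.2
      rw [abs_le]
      constructor <;> linarith
  -- The points with indices between `N` and `n` are added last.
  let _ : PseudoMetricSpace (Fin (n + 1)) :=
    { dist := fun i j => d i j
      dist_self := fun i => hself i
      dist_comm := fun i j => hcomm i j
      dist_triangle := fun i j l => htri i j l }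
  have hd : ∀ i j : Fin (n + 1), dist i j = d i j := fun _ _ => rfl
  let u₁ : ℕ → X := fun i => if i < N then u i else y
  have hu₁ : ∀ i < N, u₁ i = u i := fun i hi => if_pos hi
  have hu₁n : u₁ n = y := if_neg hNn.not_gt
  obtain ⟨ψ, hψ, hψS⟩ := hX.exists_extension (L := Fin (n + 1)) {i | (i : ℕ) < N ∨ (i : ℕ) = n}
    (fun i => u₁ i) (by
      rintro a (ha | ha) b (hb | hb) <;> rw [hd]
      · rw [hu₁ a ha, hu₁ b hb, hu a ha b hb]
      · rw [hu₁ a ha, hb, hu₁n, dist_comm]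
        exact hy ⟨a, ha⟩
      · rw [ha, hu₁n, hu₁ b hb, hcomm]
        exact hy ⟨b, hb⟩
      · rw [ha, hb, hself, dist_self])
  refine ⟨n + 1, Nat.lt_succ_of_le hNn, fun i => if h : i < n + 1 then ψ ⟨i, h⟩ else y,
    fun i hi j hj => ?_, fun i hi => ?_, n, Nat.lt_succ_self n, ?_⟩
  · simp only [hi, hj, dif_pos]
    exact hψ.dist_eq _ _
  · have hi' : i < n + 1 := by omega
    simp only [hi', dif_pos]
    exact (hψS ⟨i, hi'⟩ (.inl hi)).trans (hu₁ i hi)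
  · simp only [Nat.lt_succ_self, dif_pos]
    rw [hψS ⟨n, Nat.lt_succ_self n⟩ (.inr rfl)]
    simp only [hu₁n]
    exact hys

/-- The pseudometric `d` is realized by a dense sequence: finite partial realizations are extended
step by step so that they come close to all the members of a dense sequence. -/
theorem exists_dense_realization [TopologicalSpace.SeparableSpace X] (hX : FinitelySaturated X)
    (hself : ∀ i, d i i = 0)
    (hcomm : ∀ i j, d i j = d j i) (htri : ∀ i j l, d i l ≤ d i j + d j l)
    (hext : ∀ N, 0 < N → ∀ v : ℕ → ℚ, (∀ j < N, ∀ l < N, d j l ≤ v j + v l) →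
      ∃ n ≥ N, ∀ i < n, (∀ j < N, d i n ≤ v j + d i j) ∧ ∃ j < N, d i n = v j + d i j) :
    ∃ r : ℕ → X, DenseRange r ∧ ∀ i j, dist (r i) (r j) = d i j := by
  have : Nonempty X := by
    obtain ⟨ψ, -⟩ := hX Unit ∅ (fun x => x.2.elim) (fun x => x.2.elim)
    exact ⟨ψ ()⟩
  let s : ℕ → X := TopologicalSpace.denseSeq X
  let State := {p : ℕ × (ℕ → X) // 0 < p.1 ∧ Realizes d p.1 p.2}
  have hstep : ∀ (t : ℕ) (p : State), ∃ p' : State, p.1.1 < p'.1.1 ∧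
      (∀ i < p.1.1, p'.1.2 i = p.1.2 i) ∧
        ∃ m < p'.1.1, dist (p'.1.2 m) (s t.unpair.1) ≤ (1 / 2 : ℝ) ^ t.unpair.2 := by
    rintro t ⟨⟨N, u⟩, hN, hu⟩
    obtain ⟨M, hM, u', hu', h1, h2⟩ := hu.exists_extension hX hself hcomm htri hext hN
      (s t.unpair.1) (show 0 < (1 / 2 : ℝ) ^ t.unpair.2 by positivity)
    exact ⟨⟨(M, u'), hN.trans hM, hu'⟩, hM, h1, h2⟩
  obtain ⟨M, U, hU, hM, hUM, hs⟩ : ∃ (M : ℕ → ℕ) (U : ℕ → ℕ → X),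
      (∀ t, 0 < M t ∧ Realizes d (M t) (U t)) ∧ (∀ t, M t < M (t + 1)) ∧
      (∀ t, ∀ i < M t, U (t + 1) i = U t i) ∧ ∀ t, ∃ m < M (t + 1),
        dist (U (t + 1) m) (s t.unpair.1) ≤ (1 / 2 : ℝ) ^ t.unpair.2 := by
    choose next h1 h2 h3 using hstep
    let st : ℕ → State := fun t => Nat.rec ⟨(1, fun _ => s 0), one_pos, fun i hi j hj => by
      obtain rfl : i = 0 := by omega
      obtain rfl : j = 0 := by omega
      rw [dist_self, hself]⟩ next t
    exact ⟨fun t => (st t).1.1, fun t => (st t).1.2, fun t => (st t).2, fun t => h1 t (st t),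
      fun t => h2 t (st t), fun t => h3 t (st t)⟩
  have hmono : StrictMono M := strictMono_nat_of_lt_succ hM
  have hlt : ∀ t, t < M t := fun t => by
    induction t with
    | zero => exact (hU 0).1
    | succ t ih => exact (Nat.succ_le_of_lt ih).trans_lt (hM t)
  have hstable : ∀ t t', t ≤ t' → ∀ i < M t, U t' i = U t i := by
    intro t t' htt' i hi
    induction t', htt' using Nat.le_induction with
    | base => rfl
    | succ t' ht' ih => rw [hUM t' i (hi.trans_le (hmono.monotone ht')), ih]
  have hr : ∀ t, ∀ i < M t, U t i = U i i := fun t i hi => by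
    rcases le_total t i with h | h
    · exact (hstable t i h i hi).symm
    · exact hstable i t h i (hlt i)
  refine ⟨fun i => U i i, ?_, fun i j => ?_⟩
  · rw [Metric.denseRange_iff]
    intro x ε hε
    obtain ⟨m, hm⟩ := (TopologicalSpace.denseRange_denseSeq X).exists_dist_lt x
      (show 0 < ε / 2 by positivity)
    obtain ⟨e, he⟩ := exists_pow_lt_of_lt_one (show 0 < ε / 2 by positivity)
      (show (1 / 2 : ℝ) < 1 by norm_num)
    obtain ⟨i, hi, hd⟩ := hs (Nat.pair m e)
    rw [hr _ i hi, Nat.unpair_pair] at hd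
    refine ⟨i, ?_⟩
    have := dist_triangle_right x (U i i) (s m)
    dsimp only at hd ⊢
    linarith
  · have hi : i < M (max i j) := (hlt i).trans_le (hmono.monotone (le_max_left _ _))
    have hj : j < M (max i j) := (hlt j).trans_le (hmono.monotone (le_max_right _ _))
    dsimp only
    rw [← hr _ i hi, ← hr _ j hj]
    exact (hU (max i j)).2 i hi j hj

end Realization

theorem IsUrysohnSpace.isEffectiveMetricSpace {X : Type u} [MetricSpace X]
    (hX : IsUrysohnSpace X) : IsEffectiveMetricSpace X := by
  obtain ⟨-, _, hsat⟩ := hX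
  obtain ⟨d, hd, hself, hcomm, htri, hext⟩ := exists_computable_urysohn_pseudometric
  obtain ⟨r, hr, hrd⟩ := exists_dense_realization hsat hself hcomm htri hext
  refine ⟨r, hr, ?_⟩
  simpa only [hrd] using hd

theorem mainTheorem5 {k : ℕ} (X : Fin k → Type u) [∀ i, MetricSpace (X i)]
    (hX : ∀ i, (IsBanachSpace (X i) ∧ IsEffectiveMetricSpace (X i)) ∨ IsUrysohnSpace (X i))
    (σ : FType k) :
    (∀ i, IsEffectiveMetricSpace (X i)) ∧
      ∀ r : (i : Fin k) → ℕ → X i, (∀ i, IsEffectiveEnum (r i)) →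
        ∃ f : ℕ → σ.interp X, DenseRange f ∧ σ.IsComputableSeq r f := by
  refine ⟨fun i => (hX i).elim And.right IsUrysohnSpace.isEffectiveMetricSpace, fun r hr => ?_⟩
  have hcomplete : ∀ i, CompleteSpace (X i) := fun i => (hX i).elim (fun h => h.1.1) And.left
  have hmid : ∀ i, HasMidpoints (X i) := fun i =>
    (hX i).elim (fun h => h.1.hasMidpoints) fun h => h.2.2.hasMidpoints
  choose c hc hcomp using fun i => exists_combination (hr i) (hmid i)
  exact ⟨_, FType.denseRange_comb_dirac r c hc (fun i => (hr i).1) σ,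
    (FType.weightComputable_and_combComputable hr hcomp σ).2.isComputableSeq⟩
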